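/- For $S\subseteq[d]$ let $Q_S:\{0,1\}^d\to\{0,1\}$, $Q_S(x)=\prod_{i\in S}x_i$, and let $C_{d-k}=\{Q_S : |S|=d-k\}$ be the class of conjunctions on $d-k$ literals. A database is a finite multiset $D$ of elements of $\{0,1\}^d$; its size $n$ is its number of elements, and $Q(D)=\frac1n\sum_{x\in D}Q(x)$. Databases $D,D'$ are neighbors if $|D\triangle D'|\le 1$ (multiset symmetric difference). A randomized algorithm $M$ is $(\epsilon,\delta)$-differentially private if $\Pr[M(D)\in S]\le e^{\epsilon}\Pr[M(D')\in S]+\delta$ for all neighbors $D,D'$ and all measurable sets $S$ of outputs. The machine model is a randomized real RAM: arrays of natural and of real numbers with random access; unit-cost addition and truncated subtraction of natural numbers; unit-cost $+,-,\times,/,\exp,\log$ and comparison of real numbers; conversion of natural numbers to real numbers (but not back); unit-cost independent uniform samples from $[0,1]$; and unit-cost read access to the size of the database and to its multiplicities $D[x]$, where $x\in\{0,1\}^d$ is read as a binary number. Its output is a write-only array of real numbers. **Corollary.** There are absolute constants $K_1,K_2,c$ and a single program such that, for all integers $1\le k\le d$ and all reals $0<\epsilon,\delta,\beta<1$ and $0<\alpha\le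 1$, the program, given $d,k,\epsilon,\delta,\alpha,\beta$ and a database $D$, computes a non-interactive randomized algorithm $M$ with the following properties. 1. (Running time.) On every database and for all outcomes of the coins it halts after at most $\tilde O\big(|C_{d-k}|\cdot 2^k/\alpha^2\big)$ steps, and at most $\tilde O\big((2d)^k/\alpha^2\big)$ steps, where $\tilde O(x)$ stands for $K_1\,x\,(\log(x+2))^{c}$. 2. (Privacy.) $M$, with its whole output array as its output, is $(\epsilon,\delta)$-differentially private. 3. (Accuracy.) $M$ is $(\alpha,\beta)$-accurate for $C_{d-k}$ on databases of size $$n\;\ge\;K_2\cdot\frac{k^{1.5}\,\log\frac4\delta\,\log\frac d\beta}{\epsilon\,\alpha^2}:$$ for every database $D$ of such a size $n$, with probability at least $1-\beta$ over the coins, $\max_{Q\in C_{d-k}}|Q(D)-a_Q|\le\alpha$, where the answer $a_{Q_S}$ is the entry of the output array at the index $\sum_{i\in S}2^{i}$ (variables numbered from $0$ to $d-1$). -/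

import Mathlib

open MeasureTheory

noncomputable section

namespace SparseRelease

/-! ## Databases, linear queries, privacy, accuracy -/

/-- The value of a linear query on a database (a finite multiset of records):
the average of the query over the records. -/
def queryValue {X : Type*} (Q : X → ℝ) (D : Multiset X) : ℝ :=
  (D.map Q).sum / (Multiset.card D : ℝ)

/-- Neighboring databases: the symmetric difference, as multisets, has at most one element. -/
def Neighbors {X : Type*} [DecidableEq X] (D D' : Multiset X) : Prop :=
  Multiset.card (D - D') + Multiset.card (D' - D) ≤ 1

/-- `M` is a randomized algorithm, given as a function of the database and of its coins `ω : Ω`,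
where the coins are distributed according to `μ`. This is `(ε, δ)`-differential privacy. -/
def IsDifferentiallyPrivate {X Ω R : Type*} [DecidableEq X] [MeasurableSpace Ω]
    [MeasurableSpace R] (μ : Measure Ω) (ε δ : ℝ) (M : Multiset X → Ω → R) : Prop :=
  ∀ D D' : Multiset X, Neighbors D D' → ∀ S : Set R, MeasurableSet S →
    μ {ω | M D ω ∈ S} ≤ ENNReal.ofReal (Real.exp ε) * μ {ω | M D' ω ∈ S} + ENNReal.ofReal δ

/-- `(α, β)`-accuracy of the non-interactive mechanism `M` for the queries `Q i`, `i : ι`, when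
they are evaluated on an output by `Eval`, on all databases of size `n`. -/
def IsAccurate {X Ω R ι : Type*} [MeasurableSpace Ω] (μ : Measure Ω) (α β : ℝ)
    (Q : ι → X → ℝ) (Eval : ι → R → ℝ) (M : Multiset X → Ω → R) (n : ℕ) : Prop :=
  ∀ D : Multiset X, Multiset.card D = n →
    ENNReal.ofReal (1 - β) ≤ μ {ω | ∀ i, |queryValue (Q i) D - Eval i (M D ω)| ≤ α}

/-! ## Conjunctions over the hypercube `{0,1}^d` -/

/-- The conjunction `Q_S(x) = ∏_{i ∈ S} x_i`. -/
def conjunction {d : ℕ} (S : Finset (Fin d)) (x : Fin d → Bool) : ℝ :=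
  ∏ i ∈ S, if x i then 1 else 0

/-- Index set of the class of conjunctions on `t` literals over `d` variables. (Distinct sets `S`
give distinct queries `Q_S`.) -/
abbrev Conj (d t : ℕ) : Type := {S : Finset (Fin d) // S.card = t}

/-- A point of the hypercube, read as a binary number. -/
def recordCode {d : ℕ} (x : Fin d → Bool) : ℕ :=
  ∑ i : Fin d, if x i then 2 ^ (i : ℕ) else 0

/-- A set of variables, read as a binary number. -/
def setCode {d : ℕ} (S : Finset (Fin d)) : ℕ :=
  ∑ i ∈ S, 2 ^ (i : ℕ)

/-- The database as a vector of multiplicities, indexed by the codes of the records. -/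
def histogram {d : ℕ} (D : Multiset (Fin d → Bool)) (a : ℕ) : ℕ :=
  (D.map recordCode).count a

/-! ## A randomized real RAM with a step count

The machine has finitely many named arrays of natural numbers and of real numbers with random
access, read-only random access to the multiplicities of the database, a source of independent
uniform samples from `[0,1]`, and a write-only output array of real numbers. Programs are
`while`-programs. The operations on natural numbers are addition and truncated subtraction; the
ones on reals are `+ - * /`, `exp`, `log` and comparison. There is no conversion from real numbers
to natural numbers and there are no real constants. -/

/-- Expressions for natural numbers. -/
inductive NExp where
  | const (n : ℕ)
  | get (a : ℕ) (i : NExp)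
  | count (i : NExp)
  | add (e f : NExp)
  | sub (e f : NExp)

/-- Expressions for real numbers. -/
inductive RExp where
  | ofNat (e : NExp)
  | get (a : ℕ) (i : NExp)
  | add (e f : RExp)
  | sub (e f : RExp)
  | mul (e f : RExp)
  | div (e f : RExp)
  | exp (e : RExp)
  | log (e : RExp)

/-- Tests. -/
inductive BExp where
  | ltNat (e f : NExp)
  | ltReal (e f : RExp)
  | not (b : BExp)
  | and (b c : BExp)

/-- Programs. -/
inductive Prog where
  | skip
  | setNat (a : ℕ) (i : NExp) (e : NExp)
  | setReal (a : ℕ) (i : NExp) (e : RExp)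
  | sample (a : ℕ) (i : NExp)
  | output (i : NExp) (e : RExp)
  | seq (p q : Prog)
  | ite (b : BExp) (p q : Prog)
  | while (b : BExp) (p : Prog)

/-- States: `nat a i` and `real a i` are the entries of index `i` of the arrays named `a`, `out` is
the output array and `used` is the number of random samples drawn so far. -/
structure State where
  nat : ℕ → ℕ → ℕ
  real : ℕ → ℕ → ℝ
  out : ℕ → ℝ
  used : ℕ

/-- Value of an expression, where `db` is the vector of multiplicities of the database. -/
def NExp.eval (db : ℕ → ℕ) (s : State) : NExp → ℕ
  | .const n => n
  | .get a i => s.nat a (i.eval db s)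
  | .count i => db (i.eval db s)
  | .add e f => e.eval db s + f.eval db s
  | .sub e f => e.eval db s - f.eval db s

/-- Number of elementary operations in the evaluation of an expression. -/
def NExp.cost : NExp → ℕ
  | .const _ => 1
  | .get _ i => i.cost + 1
  | .count i => i.cost + 1
  | .add e f => e.cost + f.cost + 1
  | .sub e f => e.cost + f.cost + 1

/-- Value of a real expression; `x / 0 = 0` and `log 0 = 0`, `log x = log |x|` for `x < 0`. -/
def RExp.eval (db : ℕ → ℕ) (s : State) : RExp → ℝ
  | .ofNat e => (e.eval db s : ℝ)
  | .get a i => s.real a (i.eval db s)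
  | .add e f => e.eval db s + f.eval db s
  | .sub e f => e.eval db s - f.eval db s
  | .mul e f => e.eval db s * f.eval db s
  | .div e f => e.eval db s / f.eval db s
  | .exp e => Real.exp (e.eval db s)
  | .log e => Real.log (e.eval db s)

/-- Number of elementary operations in the evaluation of an expression. -/
def RExp.cost : RExp → ℕ
  | .ofNat e => e.cost + 1
  | .get _ i => i.cost + 1
  | .add e f => e.cost + f.cost + 1
  | .sub e f => e.cost + f.cost + 1
  | .mul e f => e.cost + f.cost + 1
  | .div e f => e.cost + f.cost + 1
  | .exp e => e.cost + 1
  | .log e => e.cost + 1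

/-- Truth of a test. -/
def BExp.holds (db : ℕ → ℕ) (s : State) : BExp → Prop
  | .ltNat e f => e.eval db s < f.eval db s
  | .ltReal e f => e.eval db s < f.eval db s
  | .not b => ¬ b.holds db s
  | .and b c => b.holds db s ∧ c.holds db s

/-- Number of elementary operations in the evaluation of a test. -/
def BExp.cost : BExp → ℕ
  | .ltNat e f => e.cost + f.cost + 1
  | .ltReal e f => e.cost + f.cost + 1
  | .not b => b.cost + 1
  | .and b c => b.cost + c.cost + 1

/-- Replace the entry of index `i` of the array named `a`. -/
def setEntry {V : Type*} (m : ℕ → ℕ → V) (a i : ℕ) (v : V) : ℕ → ℕ → V :=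
  Function.update m a (Function.update (m a) i v)

/-- The coins of the machine: a sequence of samples from `[0,1]`. -/
abbrev Coins : Type := ℕ → unitInterval

/-- The samples are independent and uniform. -/
def coinMeasure : Measure Coins :=
  Measure.infinitePi fun _ : ℕ => (volume : Measure unitInterval)

/-- `Exec db ω p s t s'`: on the database vector `db` and the coins `ω`, the program `p`, started in
the state `s`, halts in the state `s'` after exactly `t` elementary steps. -/
inductive Exec (db : ℕ → ℕ) (ω : Coins) : Prog → State → ℕ → State → Prop where
  | skip (s : State) : Exec db ω .skip s 1 s
  | setNat (a : ℕ) (i e : NExp) (s : State) :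
      Exec db ω (.setNat a i e) s (i.cost + e.cost + 1)
        { s with nat := setEntry s.nat a (i.eval db s) (e.eval db s) }
  | setReal (a : ℕ) (i : NExp) (e : RExp) (s : State) :
      Exec db ω (.setReal a i e) s (i.cost + e.cost + 1)
        { s with real := setEntry s.real a (i.eval db s) (e.eval db s) }
  | sample (a : ℕ) (i : NExp) (s : State) :
      Exec db ω (.sample a i) s (i.cost + 1)
        { s with real := setEntry s.real a (i.eval db s) (ω s.used : ℝ), used := s.used + 1 }
  | output (i : NExp) (e : RExp) (s : State) :
      Exec db ω (.output i e) s (i.cost + e.cost + 1)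
        { s with out := Function.update s.out (i.eval db s) (e.eval db s) }
  | seq {p q : Prog} {s s₁ s₂ : State} {t₁ t₂ : ℕ} :
      Exec db ω p s t₁ s₁ → Exec db ω q s₁ t₂ s₂ → Exec db ω (.seq p q) s (t₁ + t₂) s₂
  | iteTrue {b : BExp} {p q : Prog} {s s' : State} {t : ℕ} :
      b.holds db s → Exec db ω p s t s' → Exec db ω (.ite b p q) s (b.cost + t) s'
  | iteFalse {b : BExp} {p q : Prog} {s s' : State} {t : ℕ} :
      ¬ b.holds db s → Exec db ω q s t s' → Exec db ω (.ite b p q) s (b.cost + t) s'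
  | whileTrue {b : BExp} {p : Prog} {s s₁ s₂ : State} {t₁ t₂ : ℕ} :
      b.holds db s → Exec db ω p s t₁ s₁ → Exec db ω (.while b p) s₁ t₂ s₂ →
        Exec db ω (.while b p) s (b.cost + t₁ + t₂) s₂
  | whileFalse {b : BExp} {p : Prog} {s : State} :
      ¬ b.holds db s → Exec db ω (.while b p) s b.cost s

/-- The initial state: array `0` of natural numbers holds `d`, `k` and the database size `n`, array
`0` of real numbers holds `ε`, `δ`, `α`, `β`, and everything else is `0`. -/
def initialState (d k n : ℕ) (ε δ α β : ℝ) : State where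
  nat := setEntry (setEntry (setEntry (fun _ _ => 0) 0 0 d) 0 1 k) 0 2 n
  real := setEntry (setEntry (setEntry (setEntry (fun _ _ => 0) 0 0 ε) 0 1 δ) 0 2 α) 0 3 β
  out := fun _ => 0
  used := 0

/-- The bound `K · x · (log (x + 2)) ^ c` behind the notation `Õ(x)`. -/
def softO (K : ℝ) (c : ℕ) (x : ℝ) : ℝ := K * x * Real.log (x + 2) ^ c

end SparseRelease

end

/-! Let `A` be the complement of `S`, so `|A| = k`. Then `Q_S(x) = 1` exactly when the zeros of `x`
lie in `A`. Every query is therefore the indicator of only `m = 2^k` records, its block, and private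
multiplicative weights can be run with work and regret governed by `m` instead of the `2^d` possible
records.

Regret. The weights are not normalised: record `c` has weight `v c + 1/m`, only `v ≥ 0` is stored,
`v` starts at zero, and an update touches one block. The potential is the unnormalised relative
entropy of the empirical distribution, shifted by the same `1/m`, from these weights. It starts at
no more than `log (1 + m) ≤ 2k`, because records absent from the database contribute nothing
(`potential_zero_le`). A round lowers it by at least `η` times the revealed gap minus `2η²`, because
the offsets of a block sum to 1 (`potential_step_le`). With `η = α/8` and about `64k/α²` rounds, the
gaps of the selected candidates average at most `α/2` (`sum_gap_le`).

Selection. A candidate is a query with a sign for its error, and each round selects one by an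
exponential mechanism. Its total loss against the best candidates is bounded through one exponential
moment and Markov's inequality (`le_measure_expWeight`). So for every query and both signs the
cumulative error is at most that of the selected candidates plus this loss, and the averages of the
estimates over all rounds are accurate for all queries at once (`IsLayout.accurate`). No noisy
answers are needed.

Privacy. The scores are counts of sensitivity one, and given the choices neither the weights nor the
output depend on the data. The exponential moments of the privacy loss multiply along the adaptive
sequence (`expWeight_moment_le`), and a Chernoff bound gives `(ε, δ)` (`measure_expWeight_le`) for a
parameter of order `εα / (√k log (4/δ))`.

Program. Rules for total correctness with step counts show that the program computes exactly
`mechanism`. It enumerates the sets of at most `k` variables, of which there are at most `C(d,k)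
2^k`, lists each block by doubling, and spends `O(C(d,k) 2^k)` steps per round. The factor `k` in
the number of rounds is absorbed by the logarithm in `softO`. -/

noncomputable section

namespace SparseRelease

/-! ## Total correctness with a step count -/

/-- The program `p`, started in `s`, halts, and the number of steps and the final state
satisfy `Q`. -/
def Reach (db : ℕ → ℕ) (ω : Coins) (p : Prog) (s : State) (Q : ℕ → State → Prop) : Prop :=
  ∃ t s', Exec db ω p s t s' ∧ Q t s'

section Rules

variable {db : ℕ → ℕ} {ω : Coins} {s : State} {Q : ℕ → State → Prop}

theorem Reach.mono {p : Prog} {Q' : ℕ → State → Prop} (h : Reach db ω p s Q)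
    (hQ : ∀ t s', Q t s' → Q' t s') : Reach db ω p s Q' := by
  obtain ⟨t, s', he, hq⟩ := h
  exact ⟨t, s', he, hQ _ _ hq⟩

/-- The rules for loop-free code are equivalences, so that `simp` can execute straight-line programs
symbolically. -/
theorem reach_skip : Reach db ω .skip s Q ↔ Q 1 s := by
  constructor
  · rintro ⟨t, s', h, hq⟩
    cases h
    exact hq
  · exact fun h => ⟨_, _, .skip s, h⟩

theorem reach_setNat {a : ℕ} {i e : NExp} : Reach db ω (.setNat a i e) s Q ↔
    Q (i.cost + e.cost + 1) { s with nat := setEntry s.nat a (i.eval db s) (e.eval db s) } := by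
  constructor
  · rintro ⟨t, s', h, hq⟩
    cases h
    exact hq
  · exact fun h => ⟨_, _, .setNat a i e s, h⟩

theorem reach_setReal {a : ℕ} {i : NExp} {e : RExp} : Reach db ω (.setReal a i e) s Q ↔
    Q (i.cost + e.cost + 1) { s with real := setEntry s.real a (i.eval db s) (e.eval db s) } := by
  constructor
  · rintro ⟨t, s', h, hq⟩
    cases h
    exact hq
  · exact fun h => ⟨_, _, .setReal a i e s, h⟩

theorem reach_sample {a : ℕ} {i : NExp} : Reach db ω (.sample a i) s Q ↔
    Q (i.cost + 1) { s with
      real := setEntry s.real a (i.eval db s) (ω s.used : ℝ), used := s.used + 1 } := by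
  constructor
  · rintro ⟨t, s', h, hq⟩
    cases h
    exact hq
  · exact fun h => ⟨_, _, .sample a i s, h⟩

theorem reach_output {i : NExp} {e : RExp} : Reach db ω (.output i e) s Q ↔
    Q (i.cost + e.cost + 1)
      { s with out := Function.update s.out (i.eval db s) (e.eval db s) } := by
  constructor
  · rintro ⟨t, s', h, hq⟩
    cases h
    exact hq
  · exact fun h => ⟨_, _, .output i e s, h⟩

theorem reach_seq {p q : Prog} : Reach db ω (.seq p q) s Q ↔
    Reach db ω p s fun t s' => Reach db ω q s' fun t' s'' => Q (t + t') s'' := by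
  constructor
  · rintro ⟨t, s', h, hq⟩
    cases h with
    | seq h₁ h₂ => exact ⟨_, _, h₁, _, _, h₂, hq⟩
  · rintro ⟨t, s', h₁, t', s'', h₂, hq⟩
    exact ⟨_, _, .seq h₁ h₂, hq⟩

theorem reach_ite {b : BExp} {p q : Prog} : Reach db ω (.ite b p q) s Q ↔
    (b.holds db s → Reach db ω p s fun t s' => Q (b.cost + t) s') ∧
      (¬ b.holds db s → Reach db ω q s fun t s' => Q (b.cost + t) s') := by
  constructor
  · rintro ⟨t, s', h, hq⟩
    cases h with
    | iteTrue hb h => exact ⟨fun _ => ⟨_, _, h, hq⟩, fun hn => absurd hb hn⟩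
    | iteFalse hb h => exact ⟨fun hn => absurd hn hb, fun _ => ⟨_, _, h, hq⟩⟩
  · rintro ⟨h₁, h₂⟩
    by_cases hb : b.holds db s
    · obtain ⟨t, s', h, hq⟩ := h₁ hb
      exact ⟨_, _, .iteTrue hb h, hq⟩
    · obtain ⟨t, s', h, hq⟩ := h₂ hb
      exact ⟨_, _, .iteFalse hb h, hq⟩

/-- A loop with an indexed invariant that can hold before an iteration only at indices below `n`
makes at most `n` iterations. -/
theorem reach_while {b : BExp} {p : Prog} (n c : ℕ) (I : ℕ → State → Prop) (h0 : I 0 s)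
    (hstep : ∀ i s, I i s → b.holds db s →
      i < n ∧ Reach db ω p s fun t s' => t ≤ c ∧ I (i + 1) s')
    (hQ : ∀ i t s', I i s' → ¬ b.holds db s' → t ≤ n * (b.cost + c) + b.cost → Q t s') :
    Reach db ω (.while b p) s Q := by
  -- Here `m` is fuel: a bound on the number of iterations still possible at index `i`.
  suffices H : ∀ m i s, I i s → n ≤ i + m →
      ∃ t s', Exec db ω (.while b p) s t s' ∧ (∃ j, I j s') ∧ ¬ b.holds db s' ∧
        t ≤ m * (b.cost + c) + b.cost by
    obtain ⟨t, s', he, ⟨j, hj⟩, hb, ht⟩ := H n 0 s h0 (by omega)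
    exact ⟨t, s', he, hQ j t s' hj hb ht⟩
  intro m
  induction m with
  | zero =>
    intro i s hi hn
    by_cases hb : b.holds db s
    · have := (hstep i s hi hb).1
      omega
    · exact ⟨_, s, .whileFalse hb, ⟨i, hi⟩, hb, by omega⟩
  | succ m ih =>
    intro i s hi hn
    by_cases hb : b.holds db s
    · obtain ⟨-, t, s', he, ht, hi'⟩ := hstep i s hi hb
      obtain ⟨t', s'', he', hj, hb', ht'⟩ := ih (i + 1) s' hi' (by omega)
      refine ⟨_, s'', .whileTrue hb he he', hj, hb', ?_⟩
      rw [add_mul]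
      omega
    · exact ⟨_, s, .whileFalse hb, ⟨i, hi⟩, hb, by omega⟩

end Rules

theorem setEntry_apply {V : Type*} (m : ℕ → ℕ → V) (a i : ℕ) (v : V) (b j : ℕ) :
    setEntry m a i v b j = if b = a ∧ j = i then v else m b j := by
  unfold setEntry
  by_cases h : b = a
  · subst h
    by_cases hj : j = i
    · subst hj
      simp
    · simp [hj]
  · simp [h]

theorem setEntry_ne {V : Type*} (m : ℕ → ℕ → V) {a b : ℕ} (i : ℕ) (v : V) (h : b ≠ a) :
    setEntry m a i v b = m b := by
  simp [setEntry, h]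

/-! ## Frame conditions -/

/-- No instruction of the program writes to the array `a` of natural numbers. -/
def Prog.KeepsNat (a : ℕ) : Prog → Prop
  | .setNat b _ _ => a ≠ b
  | .seq p q => p.KeepsNat a ∧ q.KeepsNat a
  | .ite _ p q => p.KeepsNat a ∧ q.KeepsNat a
  | .while _ p => p.KeepsNat a
  | _ => True

/-- No instruction of the program writes to the array `a` of real numbers. -/
def Prog.KeepsReal (a : ℕ) : Prog → Prop
  | .setReal b _ _ => a ≠ b
  | .sample b _ => a ≠ b
  | .seq p q => p.KeepsReal a ∧ q.KeepsReal a
  | .ite _ p q => p.KeepsReal a ∧ q.KeepsReal a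
  | .while _ p => p.KeepsReal a
  | _ => True

/-- The program has no output instruction. -/
def Prog.KeepsOut : Prog → Prop
  | .output _ _ => False
  | .seq p q => p.KeepsOut ∧ q.KeepsOut
  | .ite _ p q => p.KeepsOut ∧ q.KeepsOut
  | .while _ p => p.KeepsOut
  | _ => True

/-- The program draws no sample. -/
def Prog.KeepsUsed : Prog → Prop
  | .sample _ _ => False
  | .seq p q => p.KeepsUsed ∧ q.KeepsUsed
  | .ite _ p q => p.KeepsUsed ∧ q.KeepsUsed
  | .while _ p => p.KeepsUsed
  | _ => True

/-- The final state `s'` differs from `s` only where `p` writes. -/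
structure Frame (p : Prog) (s s' : State) : Prop where
  nat : ∀ a, p.KeepsNat a → s'.nat a = s.nat a
  real : ∀ a, p.KeepsReal a → s'.real a = s.real a
  out : p.KeepsOut → s'.out = s.out
  used : p.KeepsUsed → s'.used = s.used

/-- For a concrete program `simp` decides the syntactic conditions, so loop invariants need not
mention the arrays that stay fixed. -/
theorem Exec.frame {db : ℕ → ℕ} {ω : Coins} {p : Prog} {s s' : State} {t : ℕ}
    (h : Exec db ω p s t s') : Frame p s s' := by
  induction h with
  | skip => exact ⟨fun _ _ => rfl, fun _ _ => rfl, fun _ => rfl, fun _ => rfl⟩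
  | setNat a i e s =>
    exact ⟨fun b hb => setEntry_ne _ _ _ hb, fun _ _ => rfl, fun _ => rfl, fun _ => rfl⟩
  | setReal a i e s =>
    exact ⟨fun _ _ => rfl, fun b hb => setEntry_ne _ _ _ hb, fun _ => rfl, fun _ => rfl⟩
  | sample a i s =>
    exact ⟨fun _ _ => rfl, fun b hb => setEntry_ne _ _ _ hb, fun _ => rfl, fun h => h.elim⟩
  | output i e s => exact ⟨fun _ _ => rfl, fun _ _ => rfl, fun h => h.elim, fun _ => rfl⟩
  | seq _ _ ih₁ ih₂ =>
    exact ⟨fun a ha => (ih₂.nat a ha.2).trans (ih₁.nat a ha.1),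
      fun a ha => (ih₂.real a ha.2).trans (ih₁.real a ha.1),
      fun h => (ih₂.out h.2).trans (ih₁.out h.1),
      fun h => (ih₂.used h.2).trans (ih₁.used h.1)⟩
  | iteTrue _ _ ih =>
    exact ⟨fun a ha => ih.nat a ha.1, fun a ha => ih.real a ha.1, fun h => ih.out h.1,
      fun h => ih.used h.1⟩
  | iteFalse _ _ ih =>
    exact ⟨fun a ha => ih.nat a ha.2, fun a ha => ih.real a ha.2, fun h => ih.out h.2,
      fun h => ih.used h.2⟩
  | whileTrue _ _ _ ih₁ ih₂ =>
    exact ⟨fun a ha => (ih₂.nat a ha).trans (ih₁.nat a ha),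
      fun a ha => (ih₂.real a ha).trans (ih₁.real a ha),
      fun h => (ih₂.out h).trans (ih₁.out h),
      fun h => (ih₂.used h).trans (ih₁.used h)⟩
  | whileFalse _ => exact ⟨fun _ _ => rfl, fun _ _ => rfl, fun _ => rfl, fun _ => rfl⟩

theorem Reach.withFrame {db : ℕ → ℕ} {ω : Coins} {p : Prog} {s : State} {Q : ℕ → State → Prop}
    (h : Reach db ω p s Q) : Reach db ω p s fun t s' => Q t s' ∧ Frame p s s' := by
  obtain ⟨t, s', he, hq⟩ := h
  exact ⟨t, s', he, hq, he.frame⟩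

/-! ## Programs that depend on part of the state only -/

/-- The value of the expression depends on the arrays in `R` only. -/
def NExp.ReadsOnly (R : ℕ → Prop) : NExp → Prop
  | .const _ => True
  | .get a i => R a ∧ i.ReadsOnly R
  | .count _ => False
  | .add e f => e.ReadsOnly R ∧ f.ReadsOnly R
  | .sub e f => e.ReadsOnly R ∧ f.ReadsOnly R

/-- The truth of the test depends on the arrays of natural numbers in `R` only. -/
def BExp.ReadsOnly (R : ℕ → Prop) : BExp → Prop
  | .ltNat e f => e.ReadsOnly R ∧ f.ReadsOnly R
  | .ltReal _ _ => False
  | .not b => b.ReadsOnly R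
  | .and b c => b.ReadsOnly R ∧ c.ReadsOnly R

/-- The program works on natural numbers only and reads the arrays in `R` only. -/
def Prog.ReadsOnly (R : ℕ → Prop) : Prog → Prop
  | .skip => True
  | .setNat _ i e => i.ReadsOnly R ∧ e.ReadsOnly R
  | .setReal _ _ _ => False
  | .sample _ _ => False
  | .output _ _ => False
  | .seq p q => p.ReadsOnly R ∧ q.ReadsOnly R
  | .ite b p q => b.ReadsOnly R ∧ p.ReadsOnly R ∧ q.ReadsOnly R
  | .while b p => b.ReadsOnly R ∧ p.ReadsOnly R

/-- The two states agree on the arrays of natural numbers in `R`. -/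
def Agree (R : ℕ → Prop) (s₁ s₂ : State) : Prop := ∀ a, R a → s₁.nat a = s₂.nat a

theorem NExp.eval_agree {R : ℕ → Prop} {db db' : ℕ → ℕ} {s₁ s₂ : State} (h : Agree R s₁ s₂)
    (e : NExp) (he : e.ReadsOnly R) : e.eval db s₁ = e.eval db' s₂ := by
  induction e with
  | const n => rfl
  | get a i ih => simp only [NExp.eval, h a he.1, ih he.2]
  | count i ih => exact he.elim
  | add e f ih₁ ih₂ => simp only [NExp.eval, ih₁ he.1, ih₂ he.2]
  | sub e f ih₁ ih₂ => simp only [NExp.eval, ih₁ he.1, ih₂ he.2]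

theorem BExp.holds_agree {R : ℕ → Prop} {db db' : ℕ → ℕ} {s₁ s₂ : State} (h : Agree R s₁ s₂)
    (b : BExp) (hb : b.ReadsOnly R) : b.holds db s₁ ↔ b.holds db' s₂ := by
  induction b with
  | ltNat e f =>
    simp only [BExp.holds, NExp.eval_agree (db' := db') h e hb.1,
      NExp.eval_agree (db' := db') h f hb.2]
  | ltReal e f => exact hb.elim
  | not b ih => exact not_congr (ih hb)
  | and b c ih₁ ih₂ => exact and_congr (ih₁ hb.1) (ih₂ hb.2)

/-- This carries one run of the layout code over to all databases and coins, so that the layout can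
be fixed before the database is known. -/
theorem Exec.agree {R : ℕ → Prop} {db db' : ℕ → ℕ} {ω ω' : Coins} {p : Prog} {s₁ s₁' : State}
    {t : ℕ} (h : Exec db ω p s₁ t s₁') :
    p.ReadsOnly R → ∀ s₂, Agree R s₁ s₂ → ∃ s₂', Exec db' ω' p s₂ t s₂' ∧ Agree R s₁' s₂' := by
  induction h with
  | skip s => exact fun _ s₂ h => ⟨s₂, .skip s₂, h⟩
  | setNat a i e s =>
    intro hp s₂ h
    refine ⟨_, .setNat a i e s₂, fun b hb => ?_⟩
    simp only [setEntry, NExp.eval_agree (db' := db') h i hp.1,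
      NExp.eval_agree (db' := db') h e hp.2]
    by_cases hab : b = a
    · subst hab
      simp [h b hb]
    · simp [hab, h b hb]
  | setReal => exact fun hp => hp.elim
  | sample => exact fun hp => hp.elim
  | output => exact fun hp => hp.elim
  | seq _ _ ih₁ ih₂ =>
    intro hp s₂ h
    obtain ⟨s₃, h₃, ha₃⟩ := ih₁ hp.1 s₂ h
    obtain ⟨s₄, h₄, ha₄⟩ := ih₂ hp.2 s₃ ha₃
    exact ⟨s₄, .seq h₃ h₄, ha₄⟩
  | iteTrue hb _ ih =>
    intro hp s₂ h
    obtain ⟨s₃, h₃, ha₃⟩ := ih hp.2.1 s₂ h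
    exact ⟨s₃, .iteTrue ((BExp.holds_agree h _ hp.1).1 hb) h₃, ha₃⟩
  | iteFalse hb _ ih =>
    intro hp s₂ h
    obtain ⟨s₃, h₃, ha₃⟩ := ih hp.2.2 s₂ h
    exact ⟨s₃, .iteFalse (fun hb' => hb ((BExp.holds_agree h _ hp.1).2 hb')) h₃, ha₃⟩
  | whileTrue hb _ _ ih₁ ih₂ =>
    intro hp s₂ h
    obtain ⟨s₃, h₃, ha₃⟩ := ih₁ hp.2 s₂ h
    obtain ⟨s₄, h₄, ha₄⟩ := ih₂ hp s₃ ha₃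
    exact ⟨s₄, .whileTrue ((BExp.holds_agree h _ hp.1).1 hb) h₃ h₄, ha₄⟩
  | whileFalse hb =>
    intro hp s₂ h
    exact ⟨s₂, .whileFalse (fun hb' => hb ((BExp.holds_agree h _ hp.1).2 hb')), h⟩

open Finset

/-! ## Choosing an index with given probabilities from one uniform sample -/

/-- The index `r < K` with `∑_{i<r} w i ≤ u ∑_{i<K} w i < ∑_{i≤r} w i`. -/
def pick (w : ℕ → ℝ) (K : ℕ) (u : ℝ) : ℕ :=
  Nat.findGreatest (fun r => ∑ i ∈ range r, w i ≤ u * ∑ i ∈ range K, w i) (K - 1)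

section Pick

variable {w : ℕ → ℝ} {K r : ℕ} {u : ℝ}

theorem pick_lt (hK : 0 < K) : pick w K u < K :=
  (Nat.findGreatest_le _).trans_lt (by omega)

/-- The alternative `r + 1 = K` covers `u = 1`, where no partial sum exceeds `u` times the total. -/
theorem pick_eq_iff (hw : ∀ i, 0 < w i) (hr : r < K) (hu : 0 ≤ u) :
    pick w K u = r ↔ ∑ i ∈ range r, w i ≤ u * ∑ i ∈ range K, w i ∧
      (r + 1 = K ∨ u * ∑ i ∈ range K, w i < ∑ i ∈ range (r + 1), w i) := by
  have hmono : Monotone fun r => ∑ i ∈ range r, w i := fun a b h =>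
    sum_le_sum_of_subset_of_nonneg (range_mono h) fun i _ _ => (hw i).le
  unfold pick
  rw [Nat.findGreatest_eq_iff]
  constructor
  · rintro ⟨h₁, h₂, h₃⟩
    refine ⟨?_, ?_⟩
    · rcases Nat.eq_zero_or_pos r with rfl | h
      · simpa using mul_nonneg hu (sum_nonneg fun i _ => (hw i).le)
      · exact h₂ h.ne'
    · by_cases h : r + 1 = K
      · exact Or.inl h
      · exact Or.inr (not_le.1 (h₃ (Nat.lt_succ_self r) (by omega)))
  · rintro ⟨h₁, h₂⟩
    refine ⟨by omega, fun _ => h₁, fun {n} hn hn' hle => ?_⟩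
    rcases h₂ with h₂ | h₂
    · omega
    · exact absurd (h₂.trans_le (hmono hn)) (not_lt.2 hle)

/-- Inversion of the distribution function: the samples leading to `r` form an interval of length `w
r / ∑ w`, closed on the right for the last index. -/
theorem volume_pick (hw : ∀ i, 0 < w i) (hr : r < K) :
    MeasurableSet {u : unitInterval | pick w K u = r} ∧
      (volume : Measure unitInterval) {u | pick w K u = r}
        = ENNReal.ofReal (w r / ∑ i ∈ range K, w i) := by
  have hW : 0 < ∑ i ∈ range K, w i := sum_pos (fun i _ => hw i) ⟨r, mem_range.2 hr⟩
  have hmono : Monotone fun r => ∑ i ∈ range r, w i := fun a b h =>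
    sum_le_sum_of_subset_of_nonneg (range_mono h) fun i _ _ => (hw i).le
  have h0 : ∀ j, 0 ≤ (∑ i ∈ range j, w i) / ∑ i ∈ range K, w i := fun j =>
    div_nonneg (sum_nonneg fun i _ => (hw i).le) hW.le
  have h1 : ∀ j ≤ K, (∑ i ∈ range j, w i) / ∑ i ∈ range K, w i ≤ 1 := fun j hj =>
    (div_le_one hW).2 (hmono hj)
  let x : unitInterval := ⟨_, h0 r, h1 r hr.le⟩
  let y : unitInterval := ⟨_, h0 (r + 1), h1 (r + 1) hr⟩
  have hxy : (y : ℝ) - x = w r / ∑ i ∈ range K, w i := by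
    simp only [x, y, sum_range_succ]
    ring
  have key : ∀ u : unitInterval, pick w K u = r ↔ x ≤ u ∧ (r + 1 = K ∨ u < y) := fun u => by
    rw [pick_eq_iff hw hr u.2.1, ← div_le_iff₀ hW, ← lt_div_iff₀ hW]
    rfl
  by_cases hK : r + 1 = K
  · have hset : {u : unitInterval | pick w K u = r} = Set.Ici x := by
      ext u
      simp [key, hK]
    have hy : (y : ℝ) = 1 := by
      simp only [y, hK]
      exact div_self hW.ne'
    rw [hset, unitInterval.volume_Ici, ← hxy, hy]
    exact ⟨measurableSet_Ici, rfl⟩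
  · have hset : {u : unitInterval | pick w K u = r} = Set.Ico x y := by
      ext u
      simp [key, hK]
    rw [hset, unitInterval.volume_Ico, hxy]
    exact ⟨measurableSet_Ico, rfl⟩

end Pick

/-! ## Adaptive sequences of random choices -/

section Adaptive

variable {V : Type*} (step : V → ℕ → V)

/-- The states passed through when the choices are `τ 0, τ 1, …`. -/
def path (v : V) (τ : ℕ → ℕ) : ℕ → V
  | 0 => v
  | t + 1 => step (path v τ t) (τ t)

theorem path_congr {v : V} {τ τ' : ℕ → ℕ} {t : ℕ} (h : ∀ s < t, τ s = τ' s) :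
    path step v τ t = path step v τ' t := by
  induction t with
  | zero => rfl
  | succ t ih =>
    simp only [path, ih fun s hs => h s (by omega), h t (Nat.lt_succ_self t)]

theorem path_shift (v : V) (τ : ℕ → ℕ) (t : ℕ) :
    path step v τ (t + 1) = path step (step v (τ 0)) (fun s => τ (s + 1)) t := by
  induction t with
  | zero => rfl
  | succ t ih => rw [path, ih, path]

/-- The product of `f` along the first `T` steps of a path. -/
def pathProd (f : V → ℕ → ℝ) (v : V) (τ : ℕ → ℕ) (T : ℕ) : ℝ :=
  ∏ t ∈ range T, f (path step v τ t) (τ t)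

/-- A finite sequence of choices, continued by zeros. -/
def extend {T K : ℕ} (τ : Fin T → Fin K) (t : ℕ) : ℕ := if h : t < T then τ ⟨t, h⟩ else 0

theorem pathProd_extend_cons {T K : ℕ} (f : V → ℕ → ℝ) (v : V) (r : Fin K) (τ : Fin T → Fin K) :
    pathProd step f v (extend (Fin.cons r τ : Fin (T + 1) → Fin K)) (T + 1)
      = f v r * pathProd step f (step v r) (extend τ) T := by
  have h0 : extend (Fin.cons r τ : Fin (T + 1) → Fin K) 0 = r := by simp [extend]
  have hs : (fun s => extend (Fin.cons r τ : Fin (T + 1) → Fin K) (s + 1)) = extend τ := by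
    funext s
    by_cases h : s < T
    · have : (⟨s + 1, by omega⟩ : Fin (T + 1)) = Fin.succ ⟨s, h⟩ := rfl
      rw [extend, dif_pos (by omega : s + 1 < T + 1), this, Fin.cons_succ, extend, dif_pos h]
    · rw [extend, dif_neg (by omega), extend, dif_neg h]
  rw [pathProd, pathProd, prod_range_succ', mul_comm]
  refine congrArg₂ (· * ·) ?_ (prod_congr rfl fun t _ => ?_)
  · rw [h0]
    rfl
  · rw [path_shift, h0, hs]
    exact congrArg _ (congrFun hs t)

theorem sum_cons {T K : ℕ} (F : (Fin (T + 1) → Fin K) → ℝ) :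
    ∑ τ, F τ = ∑ r : Fin K, ∑ τ : Fin T → Fin K, F (Fin.cons r τ) := by
  rw [← Fintype.sum_prod_type']
  exact (Fintype.sum_equiv (Fin.consEquiv fun _ => Fin K) _ _ fun _ => rfl).symm

theorem pathProd_nonneg {f : V → ℕ → ℝ} (hf : ∀ v r, 0 ≤ f v r) (v : V) (τ : ℕ → ℕ) (T : ℕ) :
    0 ≤ pathProd step f v τ T := prod_nonneg fun _ _ => hf _ _

/-- Peel off the first choice; the rest starts from another state, so the induction runs over all
states. With `f` a probability times an exponential, this bounds the exponential moment of an
adaptive sum. -/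
theorem sum_pathProd_le {K : ℕ} {f : V → ℕ → ℝ} {B : ℝ} (hf : ∀ v r, 0 ≤ f v r) (hB0 : 0 ≤ B)
    (hB : ∀ v, ∑ r ∈ range K, f v r ≤ B) (T : ℕ) (v : V) :
    ∑ τ : Fin T → Fin K, pathProd step f v (extend τ) T ≤ B ^ T := by
  induction T generalizing v with
  | zero => simp [pathProd]
  | succ T ih =>
    rw [sum_cons]
    simp only [pathProd_extend_cons, ← mul_sum]
    calc ∑ r : Fin K, f v r * ∑ τ : Fin T → Fin K, pathProd step f (step v r) (extend τ) T
        ≤ ∑ r : Fin K, f v r * B ^ T :=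
          sum_le_sum fun r _ => mul_le_mul_of_nonneg_left (ih _) (hf _ _)
      _ = (∑ r ∈ range K, f v r) * B ^ T := by rw [← sum_mul, sum_range]
      _ ≤ B ^ (T + 1) := by
          rw [pow_succ, mul_comm]
          exact mul_le_mul_of_nonneg_left (hB v) (pow_nonneg hB0 T)

theorem sum_pathProd_eq_one {K : ℕ} {f : V → ℕ → ℝ} (hB : ∀ v, ∑ r ∈ range K, f v r = 1)
    (T : ℕ) (v : V) : ∑ τ : Fin T → Fin K, pathProd step f v (extend τ) T = 1 := by
  induction T generalizing v with
  | zero => simp [pathProd]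
  | succ T ih =>
    rw [sum_cons]
    simp only [pathProd_extend_cons, ← mul_sum, ih, mul_one]
    rw [← hB v, sum_range]

variable (w : V → ℕ → ℝ) (K : ℕ)

/-- The states passed through when every choice is made by `pick` with the weights of the current
state and the next sample. -/
def randomPath (v : V) (ω : Coins) : ℕ → V
  | 0 => v
  | t + 1 => step (randomPath v ω t) (pick (w (randomPath v ω t)) K (ω t))

/-- The choices made along `randomPath`. -/
def randomChoice (v : V) (ω : Coins) (t : ℕ) : ℕ :=
  pick (w (randomPath step w K v ω t)) K (ω t)

theorem randomPath_eq_path (v : V) (ω : Coins) (t : ℕ) :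
    randomPath step w K v ω t = path step v (randomChoice step w K v ω) t := by
  induction t with
  | zero => rfl
  | succ t ih => rw [randomPath, path, ← ih, randomChoice]

variable {K}

/-- The first `T` choices along `randomPath`. -/
def randomChoices (hK : 0 < K) (T : ℕ) (v : V) (ω : Coins) (t : Fin T) : Fin K :=
  ⟨randomChoice step w K v ω t, pick_lt hK⟩

theorem extend_randomChoices (hK : 0 < K) {T : ℕ} (v : V) (ω : Coins) {t : ℕ} (ht : t < T) :
    extend (randomChoices step w hK T v ω) t = randomChoice step w K v ω t := by
  simp [extend, ht, randomChoices]

/-- The probability of a choice. -/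
def choiceProb (w : V → ℕ → ℝ) (K : ℕ) (v : V) (r : ℕ) : ℝ := w v r / ∑ i ∈ range K, w v i

variable {step w}

/-- Prescribing the choices prescribes the states, so the event is a box: the sample `t` alone
decides the choice `t`, and the probability is a product. -/
theorem measure_randomChoices_eq (hw : ∀ v r, 0 < w v r) (hK : 0 < K) (T : ℕ) (v : V)
    (τ : Fin T → Fin K) :
    MeasurableSet {ω | randomChoices step w hK T v ω = τ} ∧
      coinMeasure {ω | randomChoices step w hK T v ω = τ}
        = ENNReal.ofReal (pathProd step (choiceProb w K) v (extend τ) T) := by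
  have hlt : ∀ t ∈ range T, extend τ t < K := fun t ht => by
    simp [extend, mem_range.1 ht]
  let I : ℕ → Set unitInterval := fun t =>
    {u | pick (w (path step v (extend τ) t)) K u = extend τ t}
  have hset : {ω | randomChoices step w hK T v ω = τ} = Set.pi (range T : Finset ℕ) I := by
    ext ω
    simp only [Set.mem_ofPred_eq, Set.mem_pi, I]
    constructor
    · rintro h t ht
      have ht' := mem_range.1 (mem_coe.1 ht)
      have hp : path step v (extend τ) t = randomPath step w K v ω t := by
        rw [randomPath_eq_path]
        refine path_congr step fun s hs => ?_
        rw [← h, extend_randomChoices _ _ _ _ _ (hs.trans ht')]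
      rw [hp, ← h, extend_randomChoices _ _ _ _ _ ht', randomChoice]
    · intro h
      have hc : ∀ t, t < T → randomChoice step w K v ω t = extend τ t := by
        intro t
        induction t using Nat.strong_induction_on with
        | _ t ih =>
          intro ht
          rw [← h t (by simpa using ht), randomChoice, randomPath_eq_path,
            path_congr step fun s hs => ih s hs (hs.trans ht)]
      funext t
      apply Fin.ext
      rw [randomChoices]
      simp only [hc t t.2]
      simp [extend]
  have hm : ∀ t ∈ range T, MeasurableSet (I t) := fun t ht =>
    (volume_pick (fun i => hw _ i) (hlt t ht)).1
  rw [hset]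
  refine ⟨MeasurableSet.pi (range T).countable_toSet hm, ?_⟩
  unfold coinMeasure
  rw [Measure.infinitePi_pi _ hm, pathProd, ENNReal.ofReal_prod_of_nonneg]
  · exact prod_congr rfl fun t ht => (volume_pick (fun i => hw _ i) (hlt t ht)).2
  · exact fun t _ => div_nonneg (hw _ _).le (sum_nonneg fun i _ => (hw _ i).le)

theorem measurable_randomChoices (hw : ∀ v r, 0 < w v r) (hK : 0 < K) (T : ℕ) (v : V) :
    Measurable (randomChoices step w hK T v) :=
  measurable_to_countable' fun τ => (measure_randomChoices_eq hw hK T v τ).1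

open scoped Classical in
theorem measure_randomChoices_mem (hw : ∀ v r, 0 < w v r) (hK : 0 < K) (T : ℕ) (v : V)
    (E : Set (Fin T → Fin K)) :
    coinMeasure {ω | randomChoices step w hK T v ω ∈ E}
      = ENNReal.ofReal (∑ τ with τ ∈ E, pathProd step (choiceProb w K) v (extend τ) T) := by
  have hset : {ω | randomChoices step w hK T v ω ∈ E}
      = ⋃ τ ∈ univ.filter (· ∈ E), {ω | randomChoices step w hK T v ω = τ} := by
    ext ω
    simp
  rw [hset, measure_biUnion_finset, ENNReal.ofReal_sum_of_nonneg]
  · exact sum_congr rfl fun τ _ => (measure_randomChoices_eq hw hK T v τ).2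
  · exact fun τ _ => prod_nonneg fun t _ =>
      div_nonneg (hw _ _).le (sum_nonneg fun i _ => (hw _ i).le)
  · intro τ _ τ' _ h
    exact Set.disjoint_left.2 fun ω h₁ h₂ => h (h₁.symm.trans h₂)
  · exact fun τ _ => (measure_randomChoices_eq hw hK T v τ).1

end Adaptive

/-! ## The exponential mechanism -/

/-- Average `exp y ≤ 1 + y + y²`, valid for `|y| ≤ 1`, and then use `1 + x ≤ exp x`. -/
theorem sum_mul_exp_le {K : ℕ} {p u : ℕ → ℝ} {b : ℝ} (hp : ∀ r ∈ range K, 0 ≤ p r)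
    (h1 : ∑ r ∈ range K, p r = 1) (hu : ∀ r ∈ range K, |u r| ≤ 1) (hb : |b| ≤ 1) :
    ∑ r ∈ range K, p r * Real.exp (b * u r)
      ≤ Real.exp (b * ∑ r ∈ range K, p r * u r + b ^ 2) := by
  have hterm : ∀ r ∈ range K, p r * Real.exp (b * u r)
      ≤ p r + b * (p r * u r) + b ^ 2 * p r := fun r hr => by
    have hbu : |b * u r| ≤ 1 := by
      rw [abs_mul]
      exact mul_le_one₀ hb (abs_nonneg _) (hu r hr)
    have h2 := (abs_le.1 (Real.abs_exp_sub_one_sub_id_le hbu)).2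
    have h3 : (b * u r) ^ 2 ≤ b ^ 2 := by
      rw [mul_pow]
      exact mul_le_of_le_one_right (sq_nonneg b) ((sq_le_one_iff_abs_le_one _).2 (hu r hr))
    nlinarith [mul_le_mul_of_nonneg_left (h2.trans h3) (hp r hr)]
  refine (sum_le_sum hterm).trans ?_
  rw [sum_add_distrib, sum_add_distrib, ← mul_sum, ← mul_sum, h1]
  linarith [Real.add_one_le_exp (b * ∑ r ∈ range K, p r * u r + b ^ 2)]

/-- The privacy loss is `lam (s - s') + log (Z'/Z)`, and `Z'/Z` is the mean of `exp (-lam (s -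
s'))`. Applying `sum_mul_exp_le` to both parts, the first-order terms in the mean `m` of `s - s'`
cancel, and only terms in `lam²` remain. -/
theorem expWeight_moment_le {K : ℕ} (hK : 0 < K) {s s' : ℕ → ℝ} {lam a : ℝ}
    (hs : ∀ r ∈ range K, |s r - s' r| ≤ 1) (hl0 : 0 ≤ lam) (hl1 : lam ≤ 1) (ha : 0 ≤ a)
    (hal : a * lam ≤ 1) :
    ∑ r ∈ range K, Real.exp (lam * s r) / (∑ i ∈ range K, Real.exp (lam * s i)) *
        Real.exp (a * (Real.log (Real.exp (lam * s r) / ∑ i ∈ range K, Real.exp (lam * s i)) -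
          Real.log (Real.exp (lam * s' r) / ∑ i ∈ range K, Real.exp (lam * s' i))))
      ≤ Real.exp (lam ^ 2 * (a ^ 2 + a)) := by
  have hne : (range K).Nonempty := ⟨0, mem_range.2 hK⟩
  set Z := ∑ i ∈ range K, Real.exp (lam * s i) with hZ
  set Z' := ∑ i ∈ range K, Real.exp (lam * s' i) with hZ'
  have hZ0 : 0 < Z := sum_pos (fun i _ => Real.exp_pos _) hne
  have hZ0' : 0 < Z' := sum_pos (fun i _ => Real.exp_pos _) hne
  set p : ℕ → ℝ := fun r => Real.exp (lam * s r) / Z with hp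
  set m := ∑ r ∈ range K, p r * (s r - s' r) with hm
  have hp0 : ∀ r ∈ range K, 0 ≤ p r := fun r _ => div_nonneg (Real.exp_pos _).le hZ0.le
  have hp1 : ∑ r ∈ range K, p r = 1 := by
    rw [hp, ← sum_div, ← hZ, div_self hZ0.ne']
  have h1 := sum_mul_exp_le hp0 hp1 hs (b := a * lam)
    (abs_le.2 ⟨by linarith [mul_nonneg ha hl0], hal⟩)
  have h2 := sum_mul_exp_le hp0 hp1 hs (b := -lam) (abs_le.2 ⟨by linarith, by linarith⟩)
  have hratio : ∑ r ∈ range K, p r * Real.exp (-lam * (s r - s' r)) = Z' / Z := by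
    rw [hZ', sum_div]
    refine sum_congr rfl fun r _ => ?_
    rw [hp]
    simp only
    rw [div_mul_eq_mul_div, ← Real.exp_add]
    ring_nf
  rw [hratio] at h2
  have h3 : Real.log (Z' / Z) ≤ -lam * m + lam ^ 2 := by
    have := Real.log_le_log (div_pos hZ0' hZ0) h2
    rwa [Real.log_exp, neg_sq] at this
  have hterm : ∀ r ∈ range K, p r * Real.exp (a * (Real.log (p r) -
      Real.log (Real.exp (lam * s' r) / Z')))
      = Real.exp (a * Real.log (Z' / Z)) * (p r * Real.exp (a * lam * (s r - s' r))) := by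
    intro r _
    rw [mul_left_comm, ← Real.exp_add, hp]
    simp only
    rw [Real.log_div (Real.exp_pos _).ne' hZ0.ne', Real.log_div (Real.exp_pos _).ne' hZ0'.ne',
      Real.log_div hZ0'.ne' hZ0.ne', Real.log_exp, Real.log_exp]
    ring_nf
  rw [sum_congr rfl hterm, ← mul_sum]
  calc _ ≤ Real.exp (a * (-lam * m + lam ^ 2)) * Real.exp (a * lam * m + (a * lam) ^ 2) :=
        mul_le_mul (Real.exp_le_exp.2 (mul_le_mul_of_nonneg_left h3 ha)) h1
          (sum_nonneg fun r hr => mul_nonneg (hp0 r hr) (Real.exp_pos _).le) (Real.exp_pos _).le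
    _ = _ := by
        rw [← Real.exp_add]
        ring_nf

section Mechanism

variable {V : Type*} {step : V → ℕ → V} {K : ℕ}

theorem choiceProb_pos {w : V → ℕ → ℝ} (hw : ∀ v r, 0 < w v r) (hK : 0 < K) (v : V) (r : ℕ) :
    0 < choiceProb w K v r :=
  div_pos (hw v r) (sum_pos (fun i _ => hw v i) ⟨0, mem_range.2 hK⟩)

theorem sum_choiceProb {w : V → ℕ → ℝ} (hw : ∀ v r, 0 < w v r) (hK : 0 < K) (v : V) :
    ∑ r ∈ range K, choiceProb w K v r = 1 := by
  unfold choiceProb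
  rw [← sum_div, div_self (sum_pos (fun i _ => hw v i) ⟨0, mem_range.2 hK⟩).ne']

theorem pathProd_mul_exp (f g : V → ℕ → ℝ) (v : V) (τ : ℕ → ℕ) (T : ℕ) :
    pathProd step (fun v r => f v r * Real.exp (g v r)) v τ T
      = pathProd step f v τ T * Real.exp (∑ t ∈ range T, g (path step v τ t) (τ t)) := by
  unfold pathProd
  rw [prod_mul_distrib, Real.exp_sum]

/-- The weights of the exponential mechanism. -/
def expWeight (lam : ℝ) (s : V → ℕ → ℝ) (v : V) (r : ℕ) : ℝ := Real.exp (lam * s v r)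

theorem expWeight_pos (lam : ℝ) (s : V → ℕ → ℝ) (v : V) (r : ℕ) : 0 < expWeight lam s v r :=
  Real.exp_pos _

/-- Privacy of an adaptive sequence of exponential mechanisms. -/
theorem measure_expWeight_le (hK : 0 < K) {s s' : V → ℕ → ℝ} {lam a ε : ℝ}
    (hs : ∀ v, ∀ r ∈ range K, |s v r - s' v r| ≤ 1) (hl0 : 0 ≤ lam) (hl1 : lam ≤ 1) (ha : 0 ≤ a)
    (hal : a * lam ≤ 1) (T : ℕ) (v : V) (E : Set (Fin T → Fin K)) :
    coinMeasure {ω | randomChoices step (expWeight lam s) hK T v ω ∈ E}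
      ≤ ENNReal.ofReal (Real.exp ε) *
          coinMeasure {ω | randomChoices step (expWeight lam s') hK T v ω ∈ E}
        + ENNReal.ofReal (Real.exp (T * (lam ^ 2 * (a ^ 2 + a)) - a * ε)) := by
  classical
  rw [measure_randomChoices_mem (expWeight_pos _ _), measure_randomChoices_mem (expWeight_pos _ _),
    ← ENNReal.ofReal_mul (Real.exp_pos _).le, ← ENNReal.ofReal_add
      (mul_nonneg (Real.exp_pos _).le (sum_nonneg fun τ _ =>
        pathProd_nonneg step (fun v r => (choiceProb_pos (expWeight_pos _ _) hK v r).le) _ _ _))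
      (Real.exp_pos _).le]
  apply ENNReal.ofReal_le_ofReal
  set p := choiceProb (expWeight lam s) K with hp
  set p' := choiceProb (expWeight lam s') K with hp'
  have hp0 : ∀ v r, 0 < p v r := choiceProb_pos (expWeight_pos _ _) hK
  have hp0' : ∀ v r, 0 < p' v r := choiceProb_pos (expWeight_pos _ _) hK
  set g : V → ℕ → ℝ := fun v r => a * (Real.log (p v r) - Real.log (p' v r)) with hg
  have hmom := sum_pathProd_le step (K := K) (f := fun v r => p v r * Real.exp (g v r))
    (fun v r => mul_nonneg (hp0 v r).le (Real.exp_pos _).le) (Real.exp_pos _).le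
    (fun v => expWeight_moment_le hK (hs v) hl0 hl1 ha hal) T v
  rw [← Real.exp_nat_mul] at hmom
  -- Chernoff bound, transcript by transcript: if the log-likelihood ratio is at most `ε` the first
  -- term suffices; otherwise the exponential factor of the second term is at least 1.
  have hterm : ∀ τ : Fin T → Fin K, pathProd step p v (extend τ) T
      ≤ Real.exp ε * pathProd step p' v (extend τ) T + Real.exp (-(a * ε)) *
          pathProd step (fun v r => p v r * Real.exp (g v r)) v (extend τ) T := by
    intro τ
    have hP : 0 < pathProd step p v (extend τ) T := prod_pos fun _ _ => hp0 _ _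
    have hP' : 0 < pathProd step p' v (extend τ) T := prod_pos fun _ _ => hp0' _ _
    have hsum : ∑ t ∈ range T, g (path step v (extend τ) t) (extend τ t)
        = a * (Real.log (pathProd step p v (extend τ) T)
          - Real.log (pathProd step p' v (extend τ) T)) := by
      unfold pathProd
      rw [Real.log_prod fun _ _ => (hp0 _ _).ne', Real.log_prod fun _ _ => (hp0' _ _).ne',
        ← sum_sub_distrib, mul_sum]
    rw [pathProd_mul_exp, hsum]
    set P := pathProd step p v (extend τ) T
    set P' := pathProd step p' v (extend τ) T
    rw [mul_left_comm, ← Real.exp_add]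
    rcases le_total (Real.log P - Real.log P') ε with h | h
    · have : P ≤ Real.exp ε * P' := by
        calc P = Real.exp (Real.log P) := (Real.exp_log hP).symm
          _ ≤ Real.exp (ε + Real.log P') := Real.exp_le_exp.2 (by linarith)
          _ = Real.exp ε * P' := by rw [Real.exp_add, Real.exp_log hP']
      linarith [mul_nonneg hP.le (Real.exp_pos (-(a * ε) + a * (Real.log P - Real.log P'))).le]
    · have : 1 ≤ Real.exp (-(a * ε) + a * (Real.log P - Real.log P')) :=
        Real.one_le_exp (by nlinarith)
      nlinarith [mul_pos (Real.exp_pos ε) hP']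
  calc _ ≤ ∑ τ with τ ∈ E, (Real.exp ε * pathProd step p' v (extend τ) T + Real.exp (-(a * ε)) *
          pathProd step (fun v r => p v r * Real.exp (g v r)) v (extend τ) T) :=
        sum_le_sum fun τ _ => hterm τ
    _ = Real.exp ε * ∑ τ with τ ∈ E, pathProd step p' v (extend τ) T + Real.exp (-(a * ε)) *
          ∑ τ with τ ∈ E, pathProd step (fun v r => p v r * Real.exp (g v r)) v (extend τ) T := by
        rw [sum_add_distrib, ← mul_sum, ← mul_sum]
    _ ≤ _ := by
        have hle : ∑ τ with τ ∈ E, pathProd step (fun v r => p v r * Real.exp (g v r)) v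
            (extend τ) T ≤ Real.exp (T * (lam ^ 2 * (a ^ 2 + a))) :=
          (sum_le_sum_of_subset_of_nonneg (filter_subset _ _) fun τ _ _ => pathProd_nonneg step
            (fun v r => mul_nonneg (hp0 v r).le (Real.exp_pos _).le) _ _ _).trans hmom
        have := mul_le_mul_of_nonneg_left hle (Real.exp_pos (-(a * ε))).le
        rw [← Real.exp_add] at this
        rw [sub_eq_neg_add]
        linarith

/-- Utility of an adaptive sequence of exponential mechanisms. -/
theorem le_measure_expWeight (hK : 0 < K) {s : V → ℕ → ℝ} {top : V → ℝ} {lam β : ℝ}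
    (hl0 : 0 ≤ lam) (hβ : 0 < β) (htop : ∀ v, ∃ r < K, top v ≤ s v r) (T : ℕ) (v : V) :
    ENNReal.ofReal (1 - β) ≤ coinMeasure {ω | randomChoices step (expWeight lam s) hK T v ω ∈
      {τ | lam * ∑ t ∈ range T, (top (path step v (extend τ) t)
        - s (path step v (extend τ) t) (extend τ t)) ≤ T * Real.log K + Real.log (1 / β)}} := by
  classical
  rw [measure_randomChoices_mem (expWeight_pos _ _)]
  apply ENNReal.ofReal_le_ofReal
  set p := choiceProb (expWeight lam s) K with hp
  have hp0 : ∀ v r, 0 < p v r := choiceProb_pos (expWeight_pos _ _) hK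
  set g : V → ℕ → ℝ := fun v r => lam * (top v - s v r) with hg
  have hone := sum_pathProd_eq_one step (K := K) (sum_choiceProb (expWeight_pos lam s) hK) T v
  have hK0 : (0 : ℝ) < K := by exact_mod_cast hK
  -- The factor `exp (lam (top - s))` cancels the dependence of the probability on the candidate:
  -- each contributes `exp (lam top) / Z ≤ 1`, so the moment per round is at most `K`.
  have hmom := sum_pathProd_le step (K := K) (f := fun v r => p v r * Real.exp (g v r)) (B := K)
    (fun v r => mul_nonneg (hp0 v r).le (Real.exp_pos _).le) hK0.le
    (fun v => by
      have hZ : 0 < ∑ i ∈ range K, expWeight lam s v i :=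
        sum_pos (fun i _ => expWeight_pos lam s v i) ⟨0, mem_range.2 hK⟩
      obtain ⟨r₀, hr₀, hle⟩ := htop v
      have hZle : Real.exp (lam * top v) ≤ ∑ i ∈ range K, expWeight lam s v i :=
        (Real.exp_le_exp.2 (mul_le_mul_of_nonneg_left hle hl0)).trans
          (single_le_sum (f := fun i => expWeight lam s v i)
            (fun i _ => (expWeight_pos lam s v i).le) (mem_range.2 hr₀))
      have hterm : ∀ r ∈ range K, p v r * Real.exp (g v r)
          = Real.exp (lam * top v) / ∑ i ∈ range K, expWeight lam s v i := fun r _ => by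
        rw [hp, hg, choiceProb, div_mul_eq_mul_div, expWeight, ← Real.exp_add]
        ring_nf
      rw [sum_congr rfl hterm, sum_const, card_range, nsmul_eq_mul]
      exact mul_le_of_le_one_right hK0.le ((div_le_one hZ).2 hZle)) T v
  set E : Set (Fin T → Fin K) := {τ | lam * ∑ t ∈ range T, (top (path step v (extend τ) t)
        - s (path step v (extend τ) t) (extend τ t)) ≤ T * Real.log K + Real.log (1 / β)} with hE
  rw [← sum_filter_add_sum_filter_not univ (fun τ => τ ∈ E)] at hone
  -- Markov's inequality; one moment for all rounds avoids a union bound over them.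
  have hbad : ∑ τ with τ ∉ E, pathProd step p v (extend τ) T ≤ β := by
    have hterm : ∀ τ ∈ univ.filter (· ∉ E), pathProd step p v (extend τ) T
        ≤ Real.exp (-(T * Real.log K + Real.log (1 / β))) *
          pathProd step (fun v r => p v r * Real.exp (g v r)) v (extend τ) T := by
      intro τ hτ
      have hτ' := (mem_filter.1 hτ).2
      rw [hE, Set.mem_ofPred_eq, not_le, mul_sum] at hτ'
      rw [pathProd_mul_exp, mul_left_comm, ← Real.exp_add]
      exact le_mul_of_one_le_right
        (pathProd_nonneg step (fun v r => (hp0 v r).le) _ _ _) (Real.one_le_exp (by linarith))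
    calc _ ≤ Real.exp (-(T * Real.log K + Real.log (1 / β))) * ∑ τ with τ ∉ E,
            pathProd step (fun v r => p v r * Real.exp (g v r)) v (extend τ) T := by
          rw [mul_sum]
          exact sum_le_sum hterm
      _ ≤ Real.exp (-(T * Real.log K + Real.log (1 / β))) * (K : ℝ) ^ T :=
          mul_le_mul_of_nonneg_left ((sum_le_sum_of_subset_of_nonneg (filter_subset _ _)
            fun τ _ _ => pathProd_nonneg step
              (fun v r => mul_nonneg (hp0 v r).le (Real.exp_pos _).le) _ _ _).trans hmom)
            (Real.exp_pos _).le
      _ = β := by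
          have : (K : ℝ) ^ T = Real.exp (T * Real.log K) := by
            rw [mul_comm, ← Real.rpow_def_of_pos hK0, Real.rpow_natCast]
          rw [this, ← Real.exp_add, one_div, Real.log_inv]
          ring_nf
          exact Real.exp_log hβ
  linarith

end Mechanism

/-! ## Multiplicative weights with an offset -/

/-- Nonnegative weights, indexed by the codes of the records. -/
abbrev Weights : Type := {v : ℕ → ℝ // ∀ c, 0 ≤ v c}

/-- The weight of the `q`-th block. -/
def blockSum (m : ℕ) (blk : ℕ → ℕ → ℕ) (v : ℕ → ℝ) (q : ℕ) : ℝ := ∑ e ∈ range m, v (blk q e)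

/-- The current estimate of the answer to the `q`-th query. -/
def estimate (m : ℕ) (blk : ℕ → ℕ → ℕ) (v : ℕ → ℝ) (q : ℕ) : ℝ := min 1 (blockSum m blk v q)

/-- The query of the candidate `r < 2N`: candidate `q` stands for "the estimate of the `q`-th query
is too small", candidate `N + q` for "it is too large". -/
def candQuery (N r : ℕ) : ℕ := if r < N then r else r - N

/-- The sign of the candidate `r < 2N`. -/
def candSign (N r : ℕ) : ℝ := if r < N then 1 else -1

/-- The logarithm of the factor by which the weights of the block of a candidate change. -/
def logFactor (N m : ℕ) (blk : ℕ → ℕ → ℕ) (η : ℝ) (v : ℕ → ℝ) (r : ℕ) : ℝ :=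
  if r < N then (if 1 < blockSum m blk v r then 0 else η) else -η

/-- One update of the weights. -/
def mwStep (N m : ℕ) (blk : ℕ → ℕ → ℕ) (η w₀ : ℝ) (v : Weights) (r : ℕ) : Weights :=
  ⟨fun c => if c ∈ (range m).image (blk (candQuery N r)) then
      max 0 ((v.1 c + w₀) * Real.exp (logFactor N m blk η v.1 r) - w₀) else v.1 c, fun c => by
    dsimp only
    split_ifs
    · exact le_max_left _ _
    · exact v.2 c⟩

/-- All weights are zero. -/
def zeroWeights : Weights := ⟨fun _ => 0, fun _ => le_rfl⟩

/-- The Bregman divergence of the weights `v` from `p`. -/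
def potential (C : ℕ) (p : ℕ → ℝ) (w₀ : ℝ) (v : ℕ → ℝ) : ℝ :=
  ∑ c ∈ range C, ((p c + w₀) * Real.log ((p c + w₀) / (v c + w₀)) - p c + v c)

/-- Without truncation this is an equality. Truncation raises the new weight to `w₀ ≤ P`, hence
moves it towards `P` and does not increase the divergence; `log t ≤ t - 1` makes this quantitative.
-/
theorem mul_log_div_max_le {P W w₀ x : ℝ} (h0 : 0 < w₀) (hP : w₀ ≤ P) (hW : 0 < W) :
    P * Real.log (P / (max 0 (W * Real.exp x - w₀) + w₀)) + max 0 (W * Real.exp x - w₀)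
      ≤ P * Real.log (P / W) + (W - w₀) - x * P + (Real.exp x - 1) * W := by
  have hP0 : 0 < P := h0.trans_le hP
  have hWx : 0 < W * Real.exp x := mul_pos hW (Real.exp_pos _)
  rw [Real.log_div hP0.ne' hW.ne']
  rcases le_total 0 (W * Real.exp x - w₀) with h | h
  · rw [max_eq_right h, sub_add_cancel, Real.log_div hP0.ne' hWx.ne',
      Real.log_mul hW.ne' (Real.exp_pos _).ne', Real.log_exp]
    linarith
  · rw [max_eq_left h, zero_add, Real.log_div hP0.ne' h0.ne']
    have h1 : 1 - W * Real.exp x / w₀ ≤ Real.log w₀ - Real.log W - x := by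
      have := Real.log_le_sub_one_of_pos (div_pos hWx h0)
      rw [Real.log_div hWx.ne' h0.ne', Real.log_mul hW.ne' (Real.exp_pos _).ne',
        Real.log_exp] at this
      linarith
    have h2 : 0 ≤ 1 - W * Real.exp x / w₀ := by
      rw [sub_nonneg, div_le_one h0]
      linarith
    have h3 : w₀ - W * Real.exp x = w₀ * (1 - W * Real.exp x / w₀) := by
      field_simp
    nlinarith [mul_le_mul hP h1 h2 hP0.le]

theorem potential_nonneg {C : ℕ} {p v : ℕ → ℝ} {w₀ : ℝ} (h0 : 0 < w₀) (hp : ∀ c, 0 ≤ p c)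
    (hv : ∀ c, 0 ≤ v c) : 0 ≤ potential C p w₀ v := by
  refine sum_nonneg fun c _ => ?_
  have hP : 0 < p c + w₀ := add_pos_of_nonneg_of_pos (hp c) h0
  have hW : 0 < v c + w₀ := add_pos_of_nonneg_of_pos (hv c) h0
  have h1 := Real.one_sub_inv_le_log_of_pos (div_pos hP hW)
  have h2 := mul_le_mul_of_nonneg_left h1 hP.le
  rw [inv_div, mul_sub, mul_one, mul_div_cancel₀ _ hP.ne'] at h2
  linarith

/-- Since `w₀ log (1 + p c / w₀) ≤ p c`, the offset part of each term is paid for by `- p c`. What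
remains is weighted by `p c`, so the number `C` of records does not enter. -/
theorem potential_zero_le {C : ℕ} {p : ℕ → ℝ} {w₀ : ℝ} (h0 : 0 < w₀) (hp : ∀ c, 0 ≤ p c)
    (hp1 : ∑ c ∈ range C, p c = 1) :
    potential C p w₀ zeroWeights.1 ≤ Real.log (1 + 1 / w₀) := by
  have hle : ∀ c ∈ range C, p c ≤ 1 := fun c hc =>
    hp1 ▸ single_le_sum (fun i _ => hp i) hc
  calc potential C p w₀ zeroWeights.1 ≤ ∑ c ∈ range C, p c * Real.log (1 + 1 / w₀) := by
        refine sum_le_sum fun c hc => ?_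
        simp only [zeroWeights, zero_add, add_zero]
        have hP : 0 < p c + w₀ := add_pos_of_nonneg_of_pos (hp c) h0
        have h1 := Real.log_le_sub_one_of_pos (div_pos hP h0)
        have h2 : (p c + w₀) / w₀ ≤ 1 + 1 / w₀ := by
          rw [add_div, div_self h0.ne', add_comm]
          gcongr
          exact hle c hc
        have h3 := mul_le_mul_of_nonneg_left (Real.log_le_log (div_pos hP h0) h2) (hp c)
        have h4 := mul_le_mul_of_nonneg_left h1 h0.le
        rw [mul_sub, mul_div_cancel₀ _ h0.ne'] at h4
        linarith
    _ = Real.log (1 + 1 / w₀) := by rw [← sum_mul, hp1, one_mul]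

section Regret

variable {N m C : ℕ} {blk : ℕ → ℕ → ℕ} {η : ℝ} {p : ℕ → ℝ}

/-- With `B` and `Q` the block sums of `p` and `v`, the change is at most `-x (B + 1) + (exp x - 1)
(Q + 1)`. Expanding `exp x` to second order leaves the gap and an error `η² (Q + 1)`, which is at
most `2η²` for `Q ≤ 1`; blocks with `Q > 1` are treated through the cap on the estimate. -/
theorem potential_step_le (hm : 0 < m) (hη : 0 < η) (hη1 : η ≤ 1) (hp : ∀ c, 0 ≤ p c)
    (hp1 : ∑ c ∈ range C, p c = 1)
    (hinj : ∀ q < N, Set.InjOn (blk q) (range m)) (hC : ∀ q < N, ∀ e < m, blk q e < C)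
    (v : Weights) {r : ℕ} (hr : r < 2 * N) :
    potential C p (1 / m) (mwStep N m blk η (1 / m) v r).1 ≤ potential C p (1 / m) v.1
      - η * (candSign N r * (blockSum m blk p (candQuery N r)
        - estimate m blk v.1 (candQuery N r))) + 2 * η ^ 2 := by
  have hm0 : (0 : ℝ) < m := by exact_mod_cast hm
  have hw : (0 : ℝ) < 1 / m := by positivity
  set q := candQuery N r with hq
  have hqN : q < N := by
    rw [hq, candQuery]
    split_ifs <;> omega
  set x := logFactor N m blk η v.1 r with hx
  set S := (range m).image (blk q) with hS
  have hSC : S ⊆ range C := by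
    intro c hc
    obtain ⟨e, he, rfl⟩ := mem_image.1 hc
    exact mem_range.2 (hC q hqN e (mem_range.1 he))
  have hsumS : ∀ f : ℕ → ℝ, ∑ c ∈ S, f c = ∑ e ∈ range m, f (blk q e) := fun f =>
    sum_image (hinj q hqN)
  have hdiff : potential C p (1 / m) (mwStep N m blk η (1 / m) v r).1 - potential C p (1 / m) v.1
      ≤ ∑ c ∈ S, (-x * (p c + 1 / m) + (Real.exp x - 1) * (v.1 c + 1 / m)) := by
    unfold potential
    rw [← sum_sub_distrib, ← sum_sdiff hSC]
    have hz : ∀ c ∈ range C \ S, ((p c + 1 / m) * Real.log ((p c + 1 / m) /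
        ((mwStep N m blk η (1 / m) v r).1 c + 1 / m)) - p c + (mwStep N m blk η (1 / m) v r).1 c
        - ((p c + 1 / m) * Real.log ((p c + 1 / m) / (v.1 c + 1 / m)) - p c + v.1 c)) = 0 := by
      intro c hc
      have : (mwStep N m blk η (1 / m) v r).1 c = v.1 c := if_neg (mem_sdiff.1 hc).2
      rw [this]
      ring
    rw [sum_eq_zero hz, zero_add]
    refine sum_le_sum fun c hc => ?_
    have hstep : (mwStep N m blk η (1 / m) v r).1 c
        = max 0 ((v.1 c + 1 / m) * Real.exp x - 1 / m) := if_pos hc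
    rw [hstep]
    have := mul_log_div_max_le (x := x) hw (le_add_of_nonneg_left (hp c))
      (add_pos_of_nonneg_of_pos (v.2 c) hw)
    linarith
  -- The `m` offsets `1 / m` of a block sum to 1; this is the reason for that choice of offset.
  rw [hsumS, sum_add_distrib, ← mul_sum, ← mul_sum, sum_add_distrib, sum_add_distrib, sum_const,
    card_range, nsmul_eq_mul, mul_one_div_cancel hm0.ne'] at hdiff
  change _ ≤ -x * (blockSum m blk p q + 1) + (Real.exp x - 1) * (blockSum m blk v.1 q + 1) at hdiff
  have hQ0 : 0 ≤ blockSum m blk v.1 q := sum_nonneg fun e _ => v.2 _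
  have hP1 : blockSum m blk p q ≤ 1 := by
    rw [← hp1]
    unfold blockSum
    rw [← hsumS]
    exact sum_le_sum_of_subset_of_nonneg hSC fun c _ _ => hp c
  have hexp : ∀ y : ℝ, |y| ≤ 1 → Real.exp y - 1 - y ≤ y ^ 2 := fun y hy =>
    (abs_le.1 (Real.abs_exp_sub_one_sub_id_le hy)).2
  have hη2 : |η| ≤ 1 := abs_le.2 ⟨by linarith, hη1⟩
  have hη3 : |-η| ≤ 1 := by rwa [abs_neg]
  have e1 := hexp η hη2
  have e2 := hexp (-η) hη3
  rw [neg_sq] at e2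
  set Q := blockSum m blk v.1 q with hQ
  set B := blockSum m blk p q with hB
  unfold estimate
  rw [← hQ]
  by_cases hrN : r < N
  · have hqr : q = r := if_pos hrN
    have hsign : candSign N r = 1 := if_pos hrN
    rw [hsign]
    -- For `Q > 1` the capped estimate 1 is not below `B ≤ 1`, so the gap is nonpositive and leaving
    -- the weights alone is enough.
    by_cases h1 : 1 < Q
    · have hx0 : x = 0 := by
        rw [hx, logFactor, if_pos hrN, ← hqr, if_pos h1]
      rw [hx0, Real.exp_zero] at hdiff
      rw [min_eq_left h1.le]
      nlinarith
    · have hxη : x = η := by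
        rw [hx, logFactor, if_pos hrN, ← hqr, if_neg h1]
      rw [hxη] at hdiff
      rw [min_eq_right (not_lt.1 h1)]
      nlinarith [mul_le_mul_of_nonneg_right e1 (by linarith : 0 ≤ Q + 1), sq_nonneg η]
  · have hsign : candSign N r = -1 := if_neg hrN
    have hxη : x = -η := if_neg hrN
    rw [hsign]
    rw [hxη] at hdiff
    have e3 := mul_le_mul_of_nonneg_right e2 (by linarith : 0 ≤ Q + 1)
    rcases le_total Q 1 with h1 | h1
    · rw [min_eq_right h1]
      nlinarith [sq_nonneg η]
    -- The excess `Q - 1` lies outside the capped gap; it lowers the potential by `η (Q - 1)`, which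
    -- pays for the extra `η² (Q - 1)` because `η ≤ 1`.
    · rw [min_eq_left h1]
      nlinarith [mul_nonneg (mul_nonneg hη.le (by linarith : 0 ≤ 1 - η)) (by linarith : 0 ≤ Q - 1)]

/-- Regret bound: on average the chosen candidates reveal small errors only. -/
theorem sum_gap_le (hm : 0 < m) (hη : 0 < η) (hη1 : η ≤ 1) (hp : ∀ c, 0 ≤ p c)
    (hp1 : ∑ c ∈ range C, p c = 1)
    (hinj : ∀ q < N, Set.InjOn (blk q) (range m)) (hC : ∀ q < N, ∀ e < m, blk q e < C)
    {τ : ℕ → ℕ} {T : ℕ} (hτ : ∀ t < T, τ t < 2 * N) :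
    η * ∑ t ∈ range T, candSign N (τ t) * (blockSum m blk p (candQuery N (τ t))
        - estimate m blk (path (mwStep N m blk η (1 / m)) zeroWeights τ t).1 (candQuery N (τ t)))
      ≤ Real.log (1 + m) + 2 * η ^ 2 * T := by
  have hm0 : (0 : ℝ) < m := by exact_mod_cast hm
  have hw : (0 : ℝ) < 1 / m := by positivity
  have key : ∀ T' ≤ T, potential C p (1 / m)
      (path (mwStep N m blk η (1 / m)) zeroWeights τ T').1
      + η * ∑ t ∈ range T', candSign N (τ t) * (blockSum m blk p (candQuery N (τ t))
        - estimate m blk (path (mwStep N m blk η (1 / m)) zeroWeights τ t).1 (candQuery N (τ t)))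
      ≤ Real.log (1 + m) + 2 * η ^ 2 * T' := by
    intro T'
    induction T' with
    | zero =>
      intro _
      have := potential_zero_le hw hp hp1
      rw [one_div_one_div] at this
      simpa [path] using this
    | succ T' ih =>
      intro hT
      have h1 := ih (by omega)
      have h2 := potential_step_le hm hη hη1 hp hp1 hinj hC
        (path (mwStep N m blk η (1 / m)) zeroWeights τ T') (hτ T' hT)
      rw [sum_range_succ, path, mul_add]
      push_cast
      linarith
  have h1 := key T le_rfl
  have h2 := potential_nonneg (C := C) hw hp (path (mwStep N m blk η (1 / m)) zeroWeights τ T).2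
  linarith

end Regret

/-! ## Sets as binary numbers -/

/-- A finite set of natural numbers, read as a binary number. -/
def code (B : Finset ℕ) : ℕ := ∑ i ∈ B, 2 ^ i

theorem code_injective : Function.Injective code := geomSum_injective le_rfl

theorem code_lt {d : ℕ} {B : Finset ℕ} (h : B ⊆ range d) : code B < 2 ^ d :=
  Nat.geomSum_lt le_rfl fun _ hk => mem_range.1 (h hk)

theorem code_insert {B : Finset ℕ} {i : ℕ} (h : i ∉ B) : code (insert i B) = 2 ^ i + code B :=
  sum_insert h

theorem code_range (d : ℕ) : code (range d) = 2 ^ d - 1 := by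
  rw [code, Nat.geomSum_eq le_rfl]
  simp

/-- The variables that are false in a record. -/
def zeroSet {d : ℕ} (x : Fin d → Bool) : Finset ℕ :=
  (univ.filter fun i => x i = false).map Fin.valEmbedding

/-- The variables outside of `S`. -/
def outside {d : ℕ} (S : Finset (Fin d)) : Finset ℕ := Sᶜ.map Fin.valEmbedding

theorem outside_subset {d : ℕ} (S : Finset (Fin d)) : outside S ⊆ range d := by
  intro i hi
  obtain ⟨j, -, rfl⟩ := mem_map.1 hi
  exact mem_range.2 j.2

/-- Complementing bits is a subtraction from `2^d - 1`, an operation the machine has. -/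
theorem recordCode_add {d : ℕ} (x : Fin d → Bool) :
    recordCode x + code (zeroSet x) = 2 ^ d - 1 := by
  rw [← code_range, code, code, zeroSet, sum_map, sum_filter, recordCode, ← sum_add_distrib,
    sum_range]
  refine sum_congr rfl fun i _ => ?_
  cases x i <;> simp

theorem setCode_add {d : ℕ} (S : Finset (Fin d)) :
    setCode S + code (outside S) = 2 ^ d - 1 := by
  rw [← code_range, code, code, outside, sum_map, setCode, sum_range]
  exact sum_add_sum_compl S fun i : Fin d => 2 ^ (i : ℕ)

/-- The source of sparsity: only records whose zeros avoid `S` satisfy the query, one for each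
subset of the complement of `S`. -/
theorem conjunction_eq {d : ℕ} (S : Finset (Fin d)) (x : Fin d → Bool) :
    conjunction S x = if zeroSet x ⊆ outside S then 1 else 0 := by
  rw [conjunction, prod_boole]
  congr 1
  rw [eq_iff_iff, zeroSet, outside, map_subset_map]
  constructor
  · intro h i hi
    rw [mem_compl]
    intro hiS
    have := h i hiS
    simp_all
  · intro h i hi
    by_contra hx
    have : i ∈ univ.filter fun i => x i = false := by simpa using hx
    exact (mem_compl.1 (h this)) hi

/-! ## Layouts of the queries in the memory -/

/-- An enumeration `A 0, …, A (N-1)` of the `k`-element sets of variables, together with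
enumerations `blk q 0, …, blk q (2^k-1)` of the codes of the subsets of `A q`. -/
structure IsLayout (d k N : ℕ) (A : ℕ → Finset ℕ) (blk : ℕ → ℕ → ℕ) : Prop where
  subset : ∀ q < N, A q ⊆ range d
  card : ∀ q < N, (A q).card = k
  inj : ∀ q < N, ∀ q' < N, A q = A q' → q = q'
  surj : ∀ B ⊆ range d, B.card = k → ∃ q < N, A q = B
  image : ∀ q < N, (range (2 ^ k)).image (blk q) = (A q).powerset.image code
  last : ∀ q < N, blk q (2 ^ k - 1) = code (A q)

namespace IsLayout

variable {d k N : ℕ} {A : ℕ → Finset ℕ} {blk : ℕ → ℕ → ℕ} (L : IsLayout d k N A blk)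
include L

theorem injOn {q : ℕ} (hq : q < N) : Set.InjOn (blk q) (range (2 ^ k)) := by
  rw [← card_image_iff, L.image q hq, card_image_of_injective _ code_injective, card_powerset,
    L.card q hq, card_range]

theorem blk_lt {q : ℕ} (hq : q < N) {e : ℕ} (he : e < 2 ^ k) : blk q e < 2 ^ d := by
  have : blk q e ∈ (range (2 ^ k)).image (blk q) := mem_image_of_mem _ (mem_range.2 he)
  rw [L.image q hq] at this
  obtain ⟨B, hB, h⟩ := mem_image.1 this
  rw [← h]
  exact code_lt ((mem_powerset.1 hB).trans (L.subset q hq))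

theorem card_eq : N = d.choose k := by
  have h : (range N).image A = (range d).powersetCard k := by
    ext B
    rw [mem_image, mem_powersetCard]
    constructor
    · rintro ⟨q, hq, rfl⟩
      exact ⟨L.subset q (mem_range.1 hq), L.card q (mem_range.1 hq)⟩
    · rintro ⟨h₁, h₂⟩
      obtain ⟨q, hq, rfl⟩ := L.surj B h₁ h₂
      exact ⟨q, mem_range.2 hq, rfl⟩
  have h' := congrArg Finset.card h
  rwa [card_powersetCard, card_range, card_image_of_injOn fun q hq q' hq' =>
    L.inj q (mem_range.1 hq) q' (mem_range.1 hq'), card_range] at h'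

/-- A block lists the codes of the possible zero sets, and complementation turns them into record
codes. As the block is injective, each matching record is counted once. -/
theorem sum_histogram (D : Multiset (Fin d → Bool)) {q : ℕ} (hq : q < N) :
    ∑ e ∈ range (2 ^ k), histogram D (2 ^ d - 1 - blk q e)
      = D.countP fun x => zeroSet x ⊆ A q := by
  induction D using Multiset.induction_on with
  | empty => simp [histogram]
  | cons x D ih =>
    have hcons : ∀ a, histogram (x ::ₘ D) a = histogram D a + if a = recordCode x then 1 else 0 :=
      fun a => by simp only [histogram, Multiset.map_cons, Multiset.count_cons]
    simp only [hcons, sum_add_distrib, ih, Multiset.countP_cons]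
    congr 1
    have hx := recordCode_add x
    calc ∑ e ∈ range (2 ^ k), (if 2 ^ d - 1 - blk q e = recordCode x then 1 else 0)
        = ∑ e ∈ range (2 ^ k), (if blk q e = code (zeroSet x) then 1 else 0) := by
          refine sum_congr rfl fun e he => ?_
          have := L.blk_lt hq (mem_range.1 he)
          congr 1
          rw [eq_iff_iff]
          omega
      _ = ∑ c ∈ (A q).powerset.image code, (if c = code (zeroSet x) then 1 else 0) := by
          rw [← L.image q hq, sum_image (L.injOn hq)]
      _ = _ := by
          rw [sum_ite_eq']
          congr 1
          rw [eq_iff_iff, mem_image]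
          constructor
          · rintro ⟨B, hB, h⟩
            rw [← code_injective h]
            exact mem_powerset.1 hB
          · exact fun h => ⟨_, mem_powerset.2 h, rfl⟩

end IsLayout

theorem queryValue_conjunction {d : ℕ} (S : Finset (Fin d)) (D : Multiset (Fin d → Bool)) :
    queryValue (conjunction S) D
      = (D.countP fun x => zeroSet x ⊆ outside S : ℕ) / (Multiset.card D : ℝ) := by
  rw [queryValue]
  congr 1
  induction D using Multiset.induction_on with
  | empty => simp
  | cons x D ih =>
    rw [Multiset.map_cons, Multiset.sum_cons, ih, Multiset.countP_cons, conjunction_eq]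
    push_cast
    ring

theorem sum_histogram_univ {d : ℕ} (D : Multiset (Fin d → Bool)) :
    ∑ c ∈ range (2 ^ d), histogram D (2 ^ d - 1 - c) = Multiset.card D := by
  rw [sum_range_reflect (histogram D)]
  unfold histogram
  rw [Multiset.sum_count_eq_card, Multiset.card_map]
  intro a ha
  obtain ⟨x, -, rfl⟩ := Multiset.mem_map.1 ha
  have := recordCode_add x
  have : 0 < 2 ^ d := by positivity
  rw [mem_range]
  omega

theorem Neighbors.cases {X : Type*} [DecidableEq X] {D D' : Multiset X} (h : Neighbors D D') :
    D = D' ∨ (∃ x, D = x ::ₘ D') ∨ ∃ x, D' = x ::ₘ D := by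
  unfold Neighbors at h
  have key : ∀ E E' : Multiset X, Multiset.card (E - E') = 0 → Multiset.card (E' - E) ≤ 1 →
      E = E' ∨ ∃ x, E' = x ::ₘ E := by
    intro E E' h0 h1
    have hle : E ≤ E' := tsub_eq_zero_iff_le.1 (Multiset.card_eq_zero.1 h0)
    have hadd := Multiset.sub_add_cancel hle
    rcases Nat.le_one_iff_eq_zero_or_eq_one.1 h1 with h | h
    · left
      rw [Multiset.card_eq_zero.1 h, zero_add] at hadd
      exact hadd
    · right
      obtain ⟨x, hx⟩ := Multiset.card_eq_one.1 h
      rw [hx, Multiset.singleton_add] at hadd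
      exact ⟨x, hadd.symm⟩
  rcases Nat.eq_zero_or_pos (Multiset.card (D - D')) with h0 | h0
  · rcases key D D' h0 (by omega) with h | h
    · exact Or.inl h
    · exact Or.inr (Or.inr h)
  · rcases key D' D (by omega) (by omega) with h | h
    · exact Or.inl h.symm
    · exact Or.inr (Or.inl h)

/-! ## The mechanism -/

/-- The score of a candidate on a database with multiplicities `h` and size `n`. -/
def mwScore (d N m : ℕ) (blk : ℕ → ℕ → ℕ) (h : ℕ → ℕ) (n : ℕ) (v : Weights) (r : ℕ) : ℝ :=
  candSign N r * (((∑ e ∈ range m, h (2 ^ d - 1 - blk (candQuery N r) e) : ℕ) : ℝ)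
    - n * estimate m blk v.1 (candQuery N r))

/-- The sum of the estimates of the answer to the `q`-th query in the first `T` rounds. -/
def sumEstimates (N m : ℕ) (blk : ℕ → ℕ → ℕ) (η w₀ : ℝ) (τ : ℕ → ℕ) (T q : ℕ) : ℝ :=
  ∑ t ∈ range T, estimate m blk (path (mwStep N m blk η w₀) zeroWeights τ t).1 q

/-- The array with the entries `val q` at the pairwise distinct indices `idx q`, `q < N`, and with
all other entries zero. -/
def writeArray (idx : ℕ → ℕ) (val : ℕ → ℝ) : ℕ → ℕ → ℝ
  | 0 => fun _ => 0
  | q + 1 => Function.update (writeArray idx val q) (idx q) (val q)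

theorem writeArray_apply {idx : ℕ → ℕ} {val : ℕ → ℝ} {N q : ℕ}
    (hinj : ∀ q < N, ∀ q' < N, idx q = idx q' → q = q') (hq : q < N) :
    writeArray idx val N (idx q) = val q := by
  induction N with
  | zero => omega
  | succ N ih =>
    rw [writeArray]
    rcases Nat.lt_succ_iff_lt_or_eq.1 hq with h | rfl
    · rw [Function.update_of_ne, ih (fun a ha b hb => hinj a (by omega) b (by omega)) h]
      intro he
      have := hinj q hq N (by omega) he
      omega
    · rw [Function.update_self]

/-- The released array, as a function of the choices made. -/
def releaseOf (d N m : ℕ) (blk : ℕ → ℕ → ℕ) (η w₀ : ℝ) (T : ℕ) (τ : ℕ → ℕ) : ℕ → ℝ :=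
  writeArray (fun q => 2 ^ d - 1 - blk q (m - 1))
    (fun q => sumEstimates N m blk η w₀ τ T q / T) N

/-- The mechanism. -/
def mechanism (d N m : ℕ) (blk : ℕ → ℕ → ℕ) (η lam : ℝ) (T : ℕ) (D : Multiset (Fin d → Bool))
    (ω : Coins) : ℕ → ℝ :=
  releaseOf d N m blk η (1 / m) T (randomChoice (mwStep N m blk η (1 / m))
    (expWeight lam (mwScore d N m blk (histogram D) (Multiset.card D))) (2 * N) zeroWeights ω)

theorem releaseOf_congr {d N m : ℕ} {blk : ℕ → ℕ → ℕ} {η w₀ : ℝ} {T : ℕ} {τ τ' : ℕ → ℕ}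
    (h : ∀ t < T, τ t = τ' t) : releaseOf d N m blk η w₀ T τ = releaseOf d N m blk η w₀ T τ' := by
  have : sumEstimates N m blk η w₀ τ T = sumEstimates N m blk η w₀ τ' T := by
    funext q
    refine sum_congr rfl fun t ht => ?_
    rw [path_congr _ fun s hs => h s (hs.trans (mem_range.1 ht))]
  rw [releaseOf, releaseOf, this]

theorem mechanism_eq {d N m : ℕ} {blk : ℕ → ℕ → ℕ} {η lam : ℝ} {T : ℕ} (hN : 0 < 2 * N)
    (D : Multiset (Fin d → Bool)) (ω : Coins) :
    mechanism d N m blk η lam T D ω = releaseOf d N m blk η (1 / m) T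
      (extend (randomChoices (mwStep N m blk η (1 / m)) (expWeight lam
        (mwScore d N m blk (histogram D) (Multiset.card D))) hN T zeroWeights ω)) :=
  releaseOf_congr fun _ ht => (extend_randomChoices _ _ hN _ _ ht).symm

theorem measurable_mechanism {d N m : ℕ} {blk : ℕ → ℕ → ℕ} {η lam : ℝ} {T : ℕ} (hN : 0 < 2 * N)
    (D : Multiset (Fin d → Bool)) : Measurable (mechanism d N m blk η lam T D) := by
  have h : mechanism d N m blk η lam T D
      = (fun τ : Fin T → Fin (2 * N) => releaseOf d N m blk η (1 / m) T (extend τ)) ∘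
        randomChoices (mwStep N m blk η (1 / m)) (expWeight lam
          (mwScore d N m blk (histogram D) (Multiset.card D))) hN T zeroWeights := by
    funext ω
    exact mechanism_eq hN D ω
  rw [h]
  exact (measurable_of_countable _).comp (measurable_randomChoices (expWeight_pos _ _) hN T _)

theorem abs_candSign (N r : ℕ) : |candSign N r| = 1 := by
  unfold candSign
  split_ifs <;> simp

theorem candQuery_lt {N r : ℕ} (hr : r < 2 * N) : candQuery N r < N := by
  unfold candQuery
  split_ifs <;> omega

/-! ### Privacy and accuracy of the mechanism. -/

section Properties

variable {d k N : ℕ} {A : ℕ → Finset ℕ} {blk : ℕ → ℕ → ℕ}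

/-- The score is not divided by the size of the database. One more record changes it, up to sign, by
an indicator minus the estimate, which lies in `[-1, 1]` because estimates are capped at 1. -/
theorem IsLayout.abs_mwScore_sub_le (L : IsLayout d k N A blk) {D D' : Multiset (Fin d → Bool)}
    (h : Neighbors D D') (v : Weights) {r : ℕ} (hr : r < 2 * N) :
    |mwScore d N (2 ^ k) blk (histogram D) (Multiset.card D) v r
      - mwScore d N (2 ^ k) blk (histogram D') (Multiset.card D') v r| ≤ 1 := by
  have hq := candQuery_lt hr
  simp only [mwScore, L.sum_histogram _ hq]
  rw [← mul_sub, abs_mul, abs_candSign, one_mul]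
  set y := estimate (2 ^ k) blk v.1 (candQuery N r) with hy
  have hy0 : 0 ≤ y := le_min zero_le_one (sum_nonneg fun e _ => v.2 _)
  have hy1 : y ≤ 1 := min_le_left _ _
  have hx : ∀ x : Fin d → Bool,
      |((if zeroSet x ⊆ A (candQuery N r) then 1 else 0 : ℕ) : ℝ) - y| ≤ 1 := fun x => by
    rw [abs_le]
    split_ifs <;> push_cast <;> constructor <;> linarith
  rcases h.cases with rfl | ⟨x, rfl⟩ | ⟨x, rfl⟩
  · simp
  · rw [Multiset.countP_cons, Multiset.card_cons]
    refine le_trans (le_of_eq ?_) (hx x)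
    push_cast
    congr 1
    ring
  · rw [Multiset.countP_cons, Multiset.card_cons, abs_sub_comm]
    refine le_trans (le_of_eq ?_) (hx x)
    push_cast
    congr 1
    ring

/-- `mwStep` does not read the database, so on neighbors only the scores differ, and the released
array is a function of the choices alone. -/
theorem IsLayout.isDifferentiallyPrivate (L : IsLayout d k N A blk) (hN : 0 < N)
    {η lam a ε δ : ℝ} {T : ℕ} (hl0 : 0 ≤ lam) (hl1 : lam ≤ 1) (ha : 0 ≤ a) (hal : a * lam ≤ 1)
    (hδ : Real.exp (T * (lam ^ 2 * (a ^ 2 + a)) - a * ε) ≤ δ) :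
    IsDifferentiallyPrivate coinMeasure ε δ (mechanism d N (2 ^ k) blk η lam T) := by
  intro D D' h S _
  have hN' : 0 < 2 * N := by omega
  have key := measure_expWeight_le hN' (step := mwStep N (2 ^ k) blk η (1 / (2 ^ k : ℕ)))
    (s := mwScore d N (2 ^ k) blk (histogram D) (Multiset.card D))
    (s' := mwScore d N (2 ^ k) blk (histogram D') (Multiset.card D')) (ε := ε)
    (fun v r hr => L.abs_mwScore_sub_le h v (mem_range.1 hr)) hl0 hl1 ha hal T zeroWeights
    {τ | releaseOf d N (2 ^ k) blk η (1 / (2 ^ k : ℕ)) T (extend τ) ∈ S}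
  have hset : ∀ D : Multiset (Fin d → Bool),
      {ω | mechanism d N (2 ^ k) blk η lam T D ω ∈ S} = {ω | randomChoices
        (mwStep N (2 ^ k) blk η (1 / (2 ^ k : ℕ))) (expWeight lam
          (mwScore d N (2 ^ k) blk (histogram D) (Multiset.card D))) hN' T zeroWeights ω ∈
        {τ | releaseOf d N (2 ^ k) blk η (1 / (2 ^ k : ℕ)) T (extend τ) ∈ S}} := fun D => by
    ext ω
    simp only [Set.mem_ofPred_eq, mechanism_eq hN']
  rw [hset D, hset D']
  exact key.trans (add_le_add le_rfl (ENNReal.ofReal_le_ofReal hδ))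

theorem log_one_add_two_pow_le (hk : 1 ≤ k) : Real.log (1 + (2 ^ k : ℕ)) ≤ 2 * k := by
  have h1 : (1 + (2 ^ k : ℕ) : ℝ) ≤ 2 ^ (k + 1) := by
    push_cast
    rw [pow_succ]
    linarith [one_le_pow₀ (one_le_two (α := ℝ)) (n := k)]
  have h2 := Real.log_le_log (by positivity) h1
  rw [Real.log_pow] at h2
  have h3 := Real.log_two_lt_d9
  have hk' : (1 : ℝ) ≤ k := by exact_mod_cast hk
  push_cast at h2 ⊢
  nlinarith [Real.log_two_gt_d9]

/-- Any fixed candidate scores in total at most the sum of the best scores. That exceeds the total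
of the selected ones by at most `α/2 · n T` (exponential mechanism), and the selected total is at
most `α/2 · n T` (regret). -/
theorem IsLayout.accurate (L : IsLayout d k N A blk) (hN : 0 < N) (hk : 1 ≤ k) (hkd : k ≤ d)
    {lam α β : ℝ} {T : ℕ} (hl : 0 < lam) (hα : 0 < α) (hα1 : α ≤ 1) (hβ : 0 < β)
    (hT : 64 * k ≤ T * α ^ 2) {D : Multiset (Fin d → Bool)} (hD : 0 < Multiset.card D)
    (hn : T * Real.log (2 * N : ℕ) + Real.log (1 / β)
      ≤ α / 2 * (T * lam * (Multiset.card D : ℝ))) :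
    ENNReal.ofReal (1 - β) ≤ coinMeasure {ω | ∀ S : Conj d (d - k),
      |queryValue (conjunction S.1) D
        - mechanism d N (2 ^ k) blk (α / 8) lam T D ω (setCode S.1)| ≤ α} := by
  have hN' : 0 < 2 * N := by omega
  set n := Multiset.card D with hn_def
  have hn0 : (0 : ℝ) < n := by exact_mod_cast hD
  set m := 2 ^ k with hm_def
  have hm : 0 < m := by positivity
  set stp := mwStep N m blk (α / 8) (1 / m) with hstp
  set s := mwScore d N m blk (histogram D) n with hs
  have hne : (range (2 * N)).Nonempty := ⟨0, mem_range.2 hN'⟩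
  set top : Weights → ℝ := fun v => (range (2 * N)).sup' hne (s v) with htop_def
  have htop : ∀ v, ∃ r < 2 * N, top v ≤ s v r := fun v => by
    obtain ⟨r, hr, h⟩ := exists_mem_eq_sup' hne (s v)
    exact ⟨r, mem_range.1 hr, h.le⟩
  have hle_top : ∀ v, ∀ r < 2 * N, s v r ≤ top v := fun v r hr =>
    le_sup' (s v) (mem_range.2 hr)
  refine (le_measure_expWeight (step := stp) hN' hl.le hβ htop T zeroWeights).trans
    (measure_mono fun ω hω S => ?_)
  set τ := extend (randomChoices stp (expWeight lam s) hN' T zeroWeights ω) with hτ_def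
  have hω' : lam * ∑ t ∈ range T, (top (path stp zeroWeights τ t)
      - s (path stp zeroWeights τ t) (τ t)) ≤ T * Real.log (2 * N : ℕ) + Real.log (1 / β) := hω
  have hτ : ∀ t < T, τ t < 2 * N := fun t ht => by
    simp [hτ_def, extend, ht]
  have hT0 : (0 : ℝ) < T := by
    have : (1 : ℝ) ≤ k := by exact_mod_cast hk
    by_contra hneg
    have : (T : ℝ) * α ^ 2 ≤ 0 := mul_nonpos_of_nonpos_of_nonneg (not_lt.1 hneg) (sq_nonneg α)
    linarith
  -- the empirical distribution
  set p : ℕ → ℝ := fun c => (histogram D (2 ^ d - 1 - c) : ℝ) / n with hp_def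
  have hp : ∀ c, 0 ≤ p c := fun c => by positivity
  have hp1 : ∑ c ∈ range (2 ^ d), p c = 1 := by
    rw [hp_def, ← sum_div, ← Nat.cast_sum, sum_histogram_univ, ← hn_def, div_self hn0.ne']
  have hscore : ∀ v r, s v r = n * (candSign N r * (blockSum m blk p (candQuery N r)
      - estimate m blk v.1 (candQuery N r))) := fun v r => by
    rw [hs, mwScore, blockSum, hp_def, ← sum_div, ← Nat.cast_sum]
    field_simp
  have hregret := sum_gap_le (N := N) (blk := blk) (η := α / 8) hm (by positivity) (by linarith)
    hp hp1 (fun q hq => L.injOn hq) (fun q hq e he => L.blk_lt hq he) hτ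
  rw [← hstp] at hregret
  have hlog : Real.log (1 + m) ≤ 2 * k := log_one_add_two_pow_le hk
  -- After division by `η = α/8` the regret bound reads `16k/α + αT/4`, and `64k ≤ Tα²` bounds the
  -- first summand by `αT/4` too.
  have hsel : ∑ t ∈ range T, s (path stp zeroWeights τ t) (τ t) ≤ n * (α / 2 * T) := by
    simp only [hscore, ← mul_sum]
    refine mul_le_mul_of_nonneg_left ?_ hn0.le
    have h8 : (0 : ℝ) < α / 8 := by positivity
    rw [← mul_le_mul_iff_right₀ h8]
    refine hregret.trans ?_
    nlinarith
  have hall : ∀ r < 2 * N, candSign N r * (blockSum m blk p (candQuery N r) * T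
      - sumEstimates N m blk (α / 8) (1 / m) τ T (candQuery N r)) ≤ α * T := by
    intro r hr
    have h1 : ∑ t ∈ range T, s (path stp zeroWeights τ t) r
        ≤ ∑ t ∈ range T, top (path stp zeroWeights τ t) := sum_le_sum fun t _ => hle_top _ r hr
    have h2 : ∑ t ∈ range T, s (path stp zeroWeights τ t) r = n * (candSign N r *
        (blockSum m blk p (candQuery N r) * T
          - sumEstimates N m blk (α / 8) (1 / m) τ T (candQuery N r))) := by
      simp only [hscore, ← mul_sum, sumEstimates, sum_sub_distrib, sum_const, card_range,
        nsmul_eq_mul]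
      rw [mul_comm (T : ℝ)]
    rw [sum_sub_distrib] at hω'
    have h3 : ∑ t ∈ range T, top (path stp zeroWeights τ t)
        - ∑ t ∈ range T, s (path stp zeroWeights τ t) (τ t) ≤ n * (α / 2 * T) := by
      rw [← mul_le_mul_iff_right₀ hl]
      refine (hω'.trans hn).trans (le_of_eq ?_)
      ring
    rw [h2] at h1
    rw [← mul_le_mul_iff_right₀ hn0]
    linarith
  -- the query
  have hcard : (outside S.1).card = k := by
    rw [outside, card_map, card_compl, S.2, Fintype.card_fin]
    omega
  obtain ⟨q, hq, hAq⟩ := L.surj _ (outside_subset S.1) hcard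
  have hvalue : queryValue (conjunction S.1) D = blockSum m blk p q := by
    rw [queryValue_conjunction, blockSum, hp_def, ← sum_div, ← Nat.cast_sum,
      L.sum_histogram D hq, hAq]
  have hidx : setCode S.1 = 2 ^ d - 1 - blk q (m - 1) := by
    have := setCode_add S.1
    rw [L.last q hq, hAq]
    omega
  have hanswer : mechanism d N m blk (α / 8) lam T D ω (setCode S.1)
      = sumEstimates N m blk (α / 8) (1 / m) τ T q / T := by
    rw [mechanism_eq hN', hidx, releaseOf]
    refine writeArray_apply (fun a ha b hb hab => L.inj a ha b hb (code_injective ?_)) hq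
    rw [← L.last a ha, ← L.last b hb]
    have h1 := L.blk_lt ha (Nat.sub_lt hm one_pos)
    have h2 := L.blk_lt hb (Nat.sub_lt hm one_pos)
    simp only [← hm_def] at h1 h2 ⊢
    omega
  rw [hanswer, hvalue, abs_le]
  -- The candidates `q` and `N + q` bound the two signs of the error of the same query.
  have hplus := hall q (by omega)
  have hminus := hall (N + q) (by omega)
  rw [candSign, if_pos hq, candQuery, if_pos hq, one_mul] at hplus
  rw [candSign, if_neg (by omega), candQuery, if_neg (by omega), Nat.add_sub_cancel_left,
    neg_one_mul] at hminus
  constructor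
  · have : sumEstimates N m blk (α / 8) (1 / m) τ T q / T ≤ α + blockSum m blk p q := by
      rw [div_le_iff₀ hT0]
      linarith
    linarith
  · have : blockSum m blk p q - α ≤ sumEstimates N m blk (α / 8) (1 / m) τ T q / T := by
      rw [le_div_iff₀ hT0]
      linarith
    linarith

end Properties

/-! ## The parameters -/

/-- The parameter of the exponential mechanisms. -/
def expParam (k : ℕ) (ε δ α : ℝ) : ℝ :=
  ε * α / (25 * Real.exp (Real.log k / 2) * Real.log (4 / δ))

/-- The number of rounds. -/
def rounds (k : ℕ) (α : ℝ) : ℕ := ⌈64 * k / α ^ 2⌉₊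

section

variable {k : ℕ} {ε δ α : ℝ}

/-- The machine has no square root; `√k` is computed as `exp (log k / 2)`. -/
theorem sq_exp_half_log (hk : 1 ≤ k) : Real.exp (Real.log k / 2) ^ 2 = k := by
  have hk0 : (0 : ℝ) < k := by exact_mod_cast hk
  rw [← Real.exp_nat_mul]
  push_cast
  rw [mul_div_cancel₀ _ two_ne_zero, Real.exp_log hk0]

theorem one_le_exp_half_log (hk : 1 ≤ k) : 1 ≤ Real.exp (Real.log k / 2) :=
  Real.one_le_exp (div_nonneg (Real.log_nonneg (by exact_mod_cast hk)) zero_le_two)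

theorem one_le_log_four_div (hδ : 0 < δ) (hδ1 : δ < 1) : 1 ≤ Real.log (4 / δ) := by
  have h4 : Real.log 4 = 2 * Real.log 2 := by
    rw [show (4 : ℝ) = 2 ^ 2 by norm_num, Real.log_pow]
    norm_num
  have h : Real.log 4 ≤ Real.log (4 / δ) :=
    Real.log_le_log (by norm_num) ((le_div_iff₀ hδ).2 (by linarith))
  linarith [Real.log_two_gt_d9]

theorem le_rounds_mul (hα : 0 < α) : 64 * k ≤ rounds k α * α ^ 2 := by
  rw [← div_le_iff₀ (by positivity)]
  exact Nat.le_ceil _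

theorem rounds_le (hk : 1 ≤ k) (hα : 0 < α) (hα1 : α ≤ 1) : (rounds k α : ℝ) ≤ 65 * k / α ^ 2 := by
  have hk' : (1 : ℝ) ≤ k := by exact_mod_cast hk
  have h1 : (rounds k α : ℝ) < 64 * k / α ^ 2 + 1 := Nat.ceil_lt_add_one (by positivity)
  have h2 : 1 ≤ k / α ^ 2 := by
    rw [le_div_iff₀ (by positivity)]
    nlinarith
  have h3 : 65 * k / α ^ 2 = 64 * k / α ^ 2 + k / α ^ 2 := by ring
  linarith

theorem rounds_pos (hk : 1 ≤ k) (hα : 0 < α) : 0 < rounds k α := by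
  have hk' : (1 : ℝ) ≤ k := by exact_mod_cast hk
  exact Nat.ceil_pos.2 (by positivity)

theorem expParam_pos (hε : 0 < ε) (hδ : 0 < δ) (hδ1 : δ < 1) (hα : 0 < α) :
    0 < expParam k ε δ α := by
  have := one_le_log_four_div hδ hδ1
  unfold expParam
  positivity

/-- The order of the moment in the Chernoff bound is `a = 2 log (4/δ) / ε`; in the product with the
parameter, `ε` and the logarithm cancel. -/
theorem two_log_div_mul_expParam (hε : 0 < ε) (hδ : 0 < δ) (hδ1 : δ < 1) :
    2 * Real.log (4 / δ) / ε * expParam k ε δ α = 2 * α / (25 * Real.exp (Real.log k / 2)) := by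
  have hL := one_le_log_four_div hδ hδ1
  unfold expParam
  field_simp

theorem two_log_div_mul_expParam_le (hk : 1 ≤ k) (hε : 0 < ε) (hδ : 0 < δ) (hδ1 : δ < 1)
    (hα1 : α ≤ 1) : 2 * Real.log (4 / δ) / ε * expParam k ε δ α ≤ 1 := by
  have hr := one_le_exp_half_log hk
  rw [two_log_div_mul_expParam hε hδ hδ1, div_le_one (by positivity)]
  linarith

theorem expParam_le_one (hk : 1 ≤ k) (hε : 0 < ε) (hε1 : ε < 1) (hδ : 0 < δ) (hδ1 : δ < 1)
    (hα : 0 < α) (hα1 : α ≤ 1) : expParam k ε δ α ≤ 1 := by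
  have hL := one_le_log_four_div hδ hδ1
  have hpos := expParam_pos (k := k) hε hδ hδ1 hα
  have h := two_log_div_mul_expParam_le hk hε hδ hδ1 hα1
  have h1 : 1 ≤ 2 * Real.log (4 / δ) / ε := by
    rw [le_div_iff₀ hε]
    linarith
  nlinarith

/-- As `a ≥ 1`, `a² + a ≤ 2a²`, so the positive part of the exponent is at most `65k/α² · 8α²/(625k)
< 1 ≤ log (4/δ)`, while `aε = 2 log (4/δ)`. The difference is at most `-log (4/δ)`. -/
theorem exp_privacy_le (hk : 1 ≤ k) (hε : 0 < ε) (hε1 : ε < 1) (hδ : 0 < δ) (hδ1 : δ < 1)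
    (hα : 0 < α) (hα1 : α ≤ 1) :
    Real.exp (rounds k α * (expParam k ε δ α ^ 2 * ((2 * Real.log (4 / δ) / ε) ^ 2
      + 2 * Real.log (4 / δ) / ε)) - 2 * Real.log (4 / δ) / ε * ε) ≤ δ := by
  have hL := one_le_log_four_div hδ hδ1
  have hk0 : (0 : ℝ) < k := by exact_mod_cast hk
  have hr0 := Real.exp_pos (Real.log k / 2)
  have h1 : 1 ≤ 2 * Real.log (4 / δ) / ε := by
    rw [le_div_iff₀ hε]
    linarith
  have h2 : expParam k ε δ α ^ 2 * ((2 * Real.log (4 / δ) / ε) ^ 2 + 2 * Real.log (4 / δ) / ε)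
      ≤ 8 / 625 * (α ^ 2 / k) := by
    calc _ ≤ expParam k ε δ α ^ 2 * (2 * (2 * Real.log (4 / δ) / ε) ^ 2) :=
          mul_le_mul_of_nonneg_left (by nlinarith) (sq_nonneg _)
      _ = 2 * (2 * Real.log (4 / δ) / ε * expParam k ε δ α) ^ 2 := by ring
      _ = 8 / 625 * (α ^ 2 / k) := by
          rw [two_log_div_mul_expParam hε hδ hδ1, div_pow, mul_pow, mul_pow, sq_exp_half_log hk]
          field_simp
          norm_num
  have h3 : rounds k α * (expParam k ε δ α ^ 2 * ((2 * Real.log (4 / δ) / ε) ^ 2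
      + 2 * Real.log (4 / δ) / ε)) ≤ 1 := by
    calc _ ≤ 65 * k / α ^ 2 * (8 / 625 * (α ^ 2 / k)) :=
          mul_le_mul (rounds_le hk hα hα1) h2 (mul_nonneg (sq_nonneg _) (by positivity))
            (by positivity)
      _ = 520 / 625 := by
          field_simp
          norm_num
      _ ≤ 1 := by norm_num
  rw [div_mul_cancel₀ _ hε.ne']
  calc _ ≤ Real.exp (-Real.log (4 / δ)) := Real.exp_le_exp.2 (by linarith)
    _ = δ / 4 := by rw [Real.exp_neg, Real.exp_log (by positivity), inv_div]
    _ ≤ δ := by linarith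

theorem rpow_one_and_half (hk : 1 ≤ k) :
    (k : ℝ) ^ (1.5 : ℝ) = k * Real.exp (Real.log k / 2) := by
  have hk0 : (0 : ℝ) < k := by exact_mod_cast hk
  rw [Real.rpow_def_of_pos hk0]
  nth_rewrite 2 [← Real.exp_log hk0]
  rw [← Real.exp_add]
  ring_nf

/-- The 25 in `expParam` and the factor `1/2` turn the constant 100 into 2, that is `2k log (d/β)`
per round. This covers `log (2 C(d,k)) ≤ log 2 + k log d`, where `d ≥ 2` absorbs `log 2`, and also
`log (1/β)`. -/
theorem accuracy_size_le {d n : ℕ} {β : ℝ} (hk : 1 ≤ k) (hd : 2 ≤ d) (hε : 0 < ε)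
    (hδ : 0 < δ) (hδ1 : δ < 1) (hα : 0 < α) (hβ : 0 < β) (hβ1 : β < 1)
    (hn : 100 * ((k : ℝ) ^ (1.5 : ℝ) * Real.log (4 / δ) * Real.log ((d : ℝ) / β)
      / (ε * α ^ 2)) ≤ n) :
    rounds k α * Real.log (2 * d.choose k : ℕ) + Real.log (1 / β)
      ≤ α / 2 * (rounds k α * expParam k ε δ α * n) := by
  have hL := one_le_log_four_div hδ hδ1
  have hk' : (1 : ℝ) ≤ k := by exact_mod_cast hk
  have hd' : (2 : ℝ) ≤ d := by exact_mod_cast hd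
  have hr0 := Real.exp_pos (Real.log k / 2)
  have hT : (1 : ℝ) ≤ rounds k α := by exact_mod_cast rounds_pos hk hα
  have hlog2 : Real.log 2 ≤ Real.log d := Real.log_le_log (by norm_num) hd'
  have hlogd : 0 ≤ Real.log d := Real.log_nonneg (by linarith)
  have hlogβ : 0 ≤ Real.log (1 / β) := Real.log_nonneg ((one_le_div hβ).2 hβ1.le)
  have hsplit : Real.log (d / β) = Real.log d + Real.log (1 / β) := by
    rw [div_eq_mul_one_div, Real.log_mul (by positivity) (by positivity)]
  have hbound : 2 * k * Real.log (d / β) ≤ α / 2 * (expParam k ε δ α * n) := by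
    have hl := expParam_pos (k := k) hε hδ hδ1 hα
    refine le_trans (le_of_eq ?_) (mul_le_mul_of_nonneg_left
      (mul_le_mul_of_nonneg_left hn hl.le) (by positivity : 0 ≤ α / 2))
    rw [rpow_one_and_half hk, expParam]
    field_simp
    ring
  have hN : Real.log (2 * d.choose k : ℕ) ≤ 2 * k * Real.log d := by
    by_cases hc : d.choose k = 0
    · rw [hc]
      simpa using mul_nonneg (by positivity : (0 : ℝ) ≤ 2 * k) hlogd
    have hc0 : (0 : ℝ) < d.choose k := by exact_mod_cast Nat.pos_of_ne_zero hc
    have hpow : (d.choose k : ℝ) ≤ (d : ℝ) ^ k := by exact_mod_cast Nat.choose_le_pow d k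
    push_cast
    rw [Real.log_mul two_ne_zero hc0.ne']
    have := Real.log_le_log hc0 hpow
    rw [Real.log_pow] at this
    nlinarith
  calc _ ≤ rounds k α * (2 * k * Real.log d) + rounds k α * (2 * k * Real.log (1 / β)) := by
        refine add_le_add (mul_le_mul_of_nonneg_left hN (by positivity)) ?_
        have h1 : (1 : ℝ) ≤ rounds k α * (2 * k) := by nlinarith
        nlinarith
    _ = rounds k α * (2 * k * Real.log (d / β)) := by
        rw [hsplit]
        ring
    _ ≤ rounds k α * (α / 2 * (expParam k ε δ α * n)) :=
        mul_le_mul_of_nonneg_left hbound (by positivity)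
    _ = _ := by ring

end

/-! ## Enumeration of the small sets of variables, breadth first -/

/-- The right side counts pairs of a `k`-set and one of its subsets, and every set of at most `k ≤
d` elements occurs in such a pair. -/
theorem sum_choose_le {d k : ℕ} (hk : k ≤ d) :
    ∑ j ∈ range (k + 1), d.choose j ≤ d.choose k * 2 ^ k := by
  rw [← Nat.sum_range_choose k, mul_sum]
  refine sum_le_sum fun j hj => ?_
  have hj' : j ≤ k := Nat.lt_succ_iff.1 (mem_range.1 hj)
  rw [Nat.choose_mul hj']
  exact Nat.le_mul_of_pos_right _ (Nat.choose_pos (by omega))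

/-- The nodes `0, …, tail - 1` of the search tree stand for the distinct sets `A x` of at most `k`
variables. All children of the nodes below `h`, and the children of `h` by the elements below `i`,
have been generated. Node `x > 0` arises from its parent `par x` by adding the element
`start x - 1`, which is larger than all elements of `A (par x)`, and `elt x` is the code of that
element. The nodes of size `k` are `leaf 0, …, leaf (N - 1)`. -/
structure Nodes (d k h i tail N : ℕ) (start size par elt leaf : ℕ → ℕ) (A : ℕ → Finset ℕ) :
    Prop where
  tail_pos : 0 < tail
  root : A 0 = ∅
  start_root : start 0 = 0
  le_tail : h ≤ tail
  size_eq : ∀ x < tail, size x = (A x).card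
  card_le : ∀ x < tail, (A x).card ≤ k
  subset : ∀ x < tail, A x ⊆ range (start x)
  start_le : ∀ x < tail, start x ≤ d
  par_lt : ∀ x < tail, 0 < x → par x < x
  child : ∀ x < tail, 0 < x → ∃ j, start x = j + 1 ∧ elt x = 2 ^ j ∧
    A x = insert j (A (par x)) ∧ start (par x) ≤ j
  fresh : ∀ x < tail, 0 < x → par x < h ∨ par x = h ∧ start x ≤ i
  inj : ∀ x < tail, ∀ y < tail, A x = A y → x = y
  complete : ∀ x < h, (A x).card < k → ∀ j < d, start x ≤ j → ∃ z < tail, A z = insert j (A x)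
  complete_cur : h < tail → ∀ j < i, start h ≤ j → ∃ z < tail, A z = insert j (A h)
  start_cur : h < tail → start h ≤ i
  leaf_lt : ∀ q < N, leaf q < tail
  leaf_card : ∀ q < N, (A (leaf q)).card = k
  leaf_inj : ∀ q < N, ∀ q' < N, leaf q = leaf q' → q = q'
  leaf_surj : ∀ x < tail, (A x).card = k → ∃ q < N, leaf q = x

namespace Nodes

variable {d k h i tail N : ℕ} {start size par elt leaf : ℕ → ℕ} {A : ℕ → Finset ℕ}

theorem init (hk : 1 ≤ k) (h1 : start 0 = 0) (h2 : size 0 = 0) :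
    Nodes d k 0 0 1 0 start size par elt leaf fun _ => ∅ where
  tail_pos := one_pos
  root := rfl
  start_root := h1
  le_tail := zero_le_one
  size_eq x hx := by
    obtain rfl : x = 0 := by omega
    simpa using h2
  card_le x _ := by simp
  subset x _ := empty_subset _
  start_le x hx := by
    obtain rfl : x = 0 := by omega
    omega
  par_lt x hx hx' := by omega
  child x hx hx' := by omega
  fresh x hx hx' := by omega
  inj x hx y hy _ := by omega
  complete x hx := by omega
  complete_cur _ j hj := by omega
  start_cur _ := h1.le
  leaf_lt q hq := by omega
  leaf_card q hq := by omega
  leaf_inj q hq := by omega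
  leaf_surj x hx hc := by
    rw [card_empty] at hc
    omega

theorem tail_le (H : Nodes d k h i tail N start size par elt leaf A) :
    tail ≤ ∑ j ∈ range (k + 1), d.choose j := by
  have hcard : ((range tail).image A).card = tail := by
    rw [card_image_of_injOn fun x hx y hy => H.inj x (mem_range.1 hx) y (mem_range.1 hy),
      card_range]
  have hsub : (range tail).image A
      ⊆ (range (k + 1)).biUnion fun j => (range d).powersetCard j := by
    intro B hB
    obtain ⟨x, hx, rfl⟩ := mem_image.1 hB
    have hx' := mem_range.1 hx
    exact mem_biUnion.2 ⟨(A x).card, mem_range.2 (Nat.lt_succ_iff.2 (H.card_le x hx')),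
      mem_powersetCard.2 ⟨(H.subset x hx').trans (range_mono (H.start_le x hx')), rfl⟩⟩
  calc tail = ((range tail).image A).card := hcard.symm
    _ ≤ _ := card_le_card hsub
    _ ≤ ∑ j ∈ range (k + 1), ((range d).powersetCard j).card := card_biUnion_le
    _ = _ := sum_congr rfl fun j _ => by rw [card_powersetCard, card_range]

/-- If `h + 1 = tail`, the entry `start (h + 1)` has not been written yet; hence the fields about
the current node assume `h < tail`. -/
theorem advance (H : Nodes d k h i tail N start size par elt leaf A) (hh : h < tail)
    (hend : ¬ (size h < k ∧ i < d)) :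
    Nodes d k (h + 1) (start (h + 1)) tail N start size par elt leaf A where
  __ := H
  le_tail := hh
  fresh x hx hx' := by
    rcases H.fresh x hx hx' with h | h
    · exact Or.inl (by omega)
    · exact Or.inl (by omega)
  complete x hx hc j hj hs := by
    rcases Nat.lt_succ_iff_lt_or_eq.1 hx with hlt | rfl
    · exact H.complete x hlt hc j hj hs
    · refine H.complete_cur hh j ?_ hs
      rw [H.size_eq x hh] at hend
      omega
  complete_cur _ j hj hs := by omega
  start_cur _ := le_rfl

theorem push (H : Nodes d k h i tail N start size par elt leaf A) (hh : h < tail)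
    (hsize : size h < k) (hi : i < d) {N' : ℕ} {leaf' : ℕ → ℕ}
    (hleaf : size h + 1 < k ∧ N' = N ∧ leaf' = leaf ∨
      ¬ size h + 1 < k ∧ N' = N + 1 ∧ leaf' = Function.update leaf N tail) :
    Nodes d k h (i + 1) (tail + 1) N' (Function.update start tail (i + 1))
      (Function.update size tail (size h + 1)) (Function.update par tail h)
      (Function.update elt tail (2 ^ i)) leaf'
      (Function.update A tail (insert i (A h))) := by
  have hsz := H.size_eq h hh
  have hsc := H.start_cur hh
  have hiA : i ∉ A h := fun hm => by
    have := mem_range.1 (H.subset h hh hm)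
    omega
  have hcard : (insert i (A h)).card = size h + 1 := by rw [card_insert_of_notMem hiA, hsz]
  have hcases : ∀ x < tail + 1, x < tail ∨ x = tail := fun x hx => Nat.lt_succ_iff_lt_or_eq.1 hx
  have hA : ∀ x < tail, Function.update A tail (insert i (A h)) x = A x := fun x hx =>
    Function.update_of_ne (by omega) _ _
  have hAt : Function.update A tail (insert i (A h)) tail = insert i (A h) :=
    Function.update_self _ _ _
  have hS : ∀ x < tail, Function.update start tail (i + 1) x = start x := fun x hx =>
    Function.update_of_ne (by omega) _ _
  -- The element added last is the largest, so a node with the same set would have added `i` to `A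
  -- h` as well; by `inj` its parent is `h`, and `fresh` excludes that the child by `i` already
  -- exists.
  have hnew : ∀ x < tail, A x ≠ insert i (A h) := by
    intro x hx heq
    rcases Nat.eq_zero_or_pos x with rfl | hx0
    · rw [H.root] at heq
      exact (insert_ne_empty _ _ heq.symm).elim
    obtain ⟨j, hj1, -, hj3, hj4⟩ := H.child x hx hx0
    have hpx := H.par_lt x hx hx0
    have hsubp := H.subset (par x) (by omega)
    have hij : j = i := by
      rw [hj3] at heq
      have h1 : j ∈ insert i (A h) := heq ▸ mem_insert_self _ _
      have h2 : i ∈ insert j (A (par x)) := heq.symm ▸ mem_insert_self _ _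
      rcases mem_insert.1 h1 with h1 | h1
      · exact h1
      rcases mem_insert.1 h2 with h2 | h2
      · exact h2.symm
      have e1 := mem_range.1 (H.subset h hh h1)
      have e2 := mem_range.1 (hsubp h2)
      omega
    subst hij
    have hjp : j ∉ A (par x) := fun hm => by
      have := mem_range.1 (hsubp hm)
      omega
    have hpar : A (par x) = A h := by
      rw [← erase_insert hjp, ← hj3, heq, erase_insert hiA]
    have := H.inj _ (by omega) _ hh hpar
    rcases H.fresh x hx hx0 with hf | hf
    · omega
    · omega
  refine ⟨by omega, ?_, ?_, by omega, ?_, ?_, ?_, ?_, ?_, ?_, ?_, ?_, ?_, ?_, ?_, ?_, ?_, ?_, ?_⟩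
  · rw [hA 0 H.tail_pos, H.root]
  · rw [hS 0 H.tail_pos, H.start_root]
  · intro x hx
    rcases hcases x hx with hx | rfl
    · rw [Function.update_of_ne (by omega), hA x hx, H.size_eq x hx]
    · rw [Function.update_self, hAt, hcard]
  · intro x hx
    rcases hcases x hx with hx | rfl
    · rw [hA x hx]
      exact H.card_le x hx
    · rw [hAt, hcard]
      omega
  · intro x hx
    rcases hcases x hx with hx | rfl
    · rw [hA x hx, hS x hx]
      exact H.subset x hx
    · rw [hAt, Function.update_self]
      refine insert_subset (mem_range.2 (by omega)) ((H.subset h hh).trans (range_mono ?_))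
      change start h ≤ i + 1
      omega
  · intro x hx
    rcases hcases x hx with hx | rfl
    · rw [hS x hx]
      exact H.start_le x hx
    · rw [Function.update_self]
      omega
  · intro x hx hx0
    rcases hcases x hx with hx | rfl
    · rw [Function.update_of_ne (by omega)]
      exact H.par_lt x hx hx0
    · rw [Function.update_self]
      exact hh
  · intro x hx hx0
    rcases hcases x hx with hx | rfl
    · have hpx := H.par_lt x hx hx0
      have hpar : Function.update par tail h x = par x := Function.update_of_ne (by omega) _ _
      have helt : Function.update elt tail (2 ^ i) x = elt x :=
        Function.update_of_ne (by omega) _ _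
      rw [hS x hx, hA x hx, hpar, helt, hA _ (by omega), hS _ (by omega)]
      exact H.child x hx hx0
    · refine ⟨i, ?_⟩
      simp only [Function.update_self]
      rw [hA h hh, hS h hh]
      exact ⟨trivial, trivial, rfl, hsc⟩
  · intro x hx hx0
    rcases hcases x hx with hx | rfl
    · rw [hS x hx, Function.update_of_ne (by omega)]
      rcases H.fresh x hx hx0 with hf | hf
      · exact Or.inl hf
      · exact Or.inr ⟨hf.1, by omega⟩
    · simp only [Function.update_self]
      exact Or.inr ⟨trivial, le_rfl⟩
  · intro x hx y hy hxy
    rcases hcases x hx with hx | rfl <;> rcases hcases y hy with hy | rfl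
    · rw [hA x hx, hA y hy] at hxy
      exact H.inj x hx y hy hxy
    · rw [hA x hx, hAt] at hxy
      exact (hnew x hx hxy).elim
    · rw [hA y hy, hAt] at hxy
      exact (hnew y hy hxy.symm).elim
    · rfl
  · intro x hx hc j hj hs
    have hx' : x < tail := by omega
    rw [hA x hx'] at hc ⊢
    rw [hS x hx'] at hs
    obtain ⟨z, hz, hAz⟩ := H.complete x hx hc j hj hs
    exact ⟨z, by omega, by rw [hA z hz, hAz]⟩
  · intro _ j hj hs
    rw [hS h hh] at hs
    rw [hA h hh]
    rcases Nat.lt_succ_iff_lt_or_eq.1 hj with hj | rfl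
    · obtain ⟨z, hz, hAz⟩ := H.complete_cur hh j hj hs
      exact ⟨z, by omega, by rw [hA z hz, hAz]⟩
    · exact ⟨tail, by omega, hAt⟩
  · intro _
    rw [hS h hh]
    omega
  · intro q hq
    rcases hleaf with ⟨-, rfl, rfl⟩ | ⟨-, rfl, rfl⟩
    · exact (H.leaf_lt q hq).trans (by omega)
    · rcases Nat.lt_succ_iff_lt_or_eq.1 hq with hq | rfl
      · rw [Function.update_of_ne (by omega)]
        exact (H.leaf_lt q hq).trans (by omega)
      · rw [Function.update_self]
        omega
  · intro q hq
    rcases hleaf with ⟨-, rfl, rfl⟩ | ⟨hk, rfl, rfl⟩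
    · rw [hA _ (H.leaf_lt q hq)]
      exact H.leaf_card q hq
    · rcases Nat.lt_succ_iff_lt_or_eq.1 hq with hq | rfl
      · rw [Function.update_of_ne (by omega) tail leaf, hA _ (H.leaf_lt q hq)]
        exact H.leaf_card q hq
      · rw [Function.update_self, hAt, hcard]
        omega
  · intro q hq q' hq' hqq
    rcases hleaf with ⟨-, rfl, rfl⟩ | ⟨-, rfl, rfl⟩
    · exact H.leaf_inj q hq q' hq' hqq
    · rcases Nat.lt_succ_iff_lt_or_eq.1 hq with hq | rfl <;>
        rcases Nat.lt_succ_iff_lt_or_eq.1 hq' with hq' | rfl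
      · rw [Function.update_of_ne (by omega), Function.update_of_ne (by omega)] at hqq
        exact H.leaf_inj q hq q' hq' hqq
      · rw [Function.update_of_ne (by omega), Function.update_self] at hqq
        have := H.leaf_lt q hq
        omega
      · rw [Function.update_self, Function.update_of_ne (by omega)] at hqq
        have := H.leaf_lt q' hq'
        omega
      · rfl
  · intro x hx hc
    rcases hleaf with ⟨hk, rfl, rfl⟩ | ⟨-, rfl, rfl⟩
    · rcases hcases x hx with hx | rfl
      · rw [hA x hx] at hc
        exact H.leaf_surj x hx hc
      · rw [hAt, hcard] at hc
        omega
    · rcases hcases x hx with hx | rfl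
      · rw [hA x hx] at hc
        obtain ⟨q, hq, hqx⟩ := H.leaf_surj x hx hc
        exact ⟨q, by omega, by rw [Function.update_of_ne (by omega), hqx]⟩
      · exact ⟨N, by omega, Function.update_self _ _ _⟩

/-- Build the set in increasing order: the next element is at least the `start` of the node reached,
so the corresponding child has been generated. -/
theorem exists_node (H : Nodes d k tail i tail N start size par elt leaf A) (B : Finset ℕ)
    (hB : B ⊆ range d) (hc : B.card ≤ k) : ∃ x < tail, A x = B := by
  induction B using Finset.induction_on_max with
  | empty => exact ⟨0, H.tail_pos, H.root⟩
  | insert j B hj ih =>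
    have hjB : j ∉ B := fun h => lt_irrefl j (hj j h)
    rw [card_insert_of_notMem hjB] at hc
    obtain ⟨x, hx, hxB⟩ := ih ((subset_insert _ _).trans hB) (by omega)
    rw [← hxB]
    refine H.complete x hx (by rw [hxB]; omega) j
      (mem_range.1 (hB (mem_insert_self _ _))) ?_
    rcases Nat.eq_zero_or_pos x with rfl | hx0
    · rw [H.start_root]
      exact Nat.zero_le _
    · obtain ⟨j', h1, -, h3, -⟩ := H.child x hx hx0
      have : j' ∈ B := by
        rw [← hxB, h3]
        exact mem_insert_self _ _
      have := hj j' this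
      omega

end Nodes

/-! ## Loops with a frame -/

theorem Frame.refl (p : Prog) (s : State) : Frame p s s :=
  ⟨fun _ _ => rfl, fun _ _ => rfl, fun _ => rfl, fun _ => rfl⟩

theorem Frame.trans {p : Prog} {s s' s'' : State} (h : Frame p s s') (h' : Frame p s' s'') :
    Frame p s s'' :=
  ⟨fun a ha => (h'.nat a ha).trans (h.nat a ha), fun a ha => (h'.real a ha).trans (h.real a ha),
    fun ho => (h'.out ho).trans (h.out ho), fun hu => (h'.used hu).trans (h.used hu)⟩

theorem reach_loop {db : ℕ → ℕ} {ω : Coins} {s₀ : State} {Q : ℕ → State → Prop} {b : BExp}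
    {p : Prog} (n c : ℕ) (I : ℕ → State → Prop) (h0 : I 0 s₀)
    (hstep : ∀ i s, I i s → Frame (.while b p) s₀ s → b.holds db s →
      i < n ∧ Reach db ω p s fun t s' => t ≤ c ∧ I (i + 1) s')
    (hQ : ∀ i t s', I i s' → Frame (.while b p) s₀ s' → ¬ b.holds db s' →
      t ≤ n * (b.cost + c) + b.cost → Q t s') :
    Reach db ω (.while b p) s₀ Q := by
  refine reach_while n c (fun i s => I i s ∧ Frame (.while b p) s₀ s) ⟨h0, Frame.refl _ _⟩ ?_ ?_
  · rintro i s ⟨hI, hf⟩ hb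
    obtain ⟨hi, hr⟩ := hstep i s hI hf hb
    refine ⟨hi, hr.withFrame.mono ?_⟩
    rintro t s' ⟨⟨ht, hI'⟩, hf'⟩
    exact ⟨ht, hI', hf.trans ⟨hf'.nat, hf'.real, hf'.out, hf'.used⟩⟩
  · rintro i t s' ⟨hI, hf⟩ hb ht
    exact hQ i t s' hI hf hb ht

theorem setEntry_self {V : Type*} (m : ℕ → ℕ → V) (a i : ℕ) (v : V) :
    setEntry m a i v a = Function.update (m a) i v := by
  simp [setEntry]

/-! ## The program, first part: the layout of the queries

Arrays of natural numbers: `1` number of variables, `2` size of the sets, `3` powers of two,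
`4` next element, `5` current node, `6` number of nodes, `7`-`10` data of the nodes (start, size,
parent, code of the added element), `11` blocks, `12` addresses of the blocks, `13` number of
queries, `14`-`17` current node, length, offset and address in the construction of a block,
`18` size of a block, `19` the code of the record of ones, `20` current query, `24` leaves. -/

/-- A variable of type natural number: the entry `0` of an array. -/
abbrev NExp.var (a : ℕ) : NExp := .get a (.const 0)

/-- The tabulation of the powers of two. -/
def powersProg : Prog :=
  .seq (.setNat 3 (.const 0) (.const 1)) <|
  .seq (.setNat 4 (.const 0) (.const 0)) <|
  .while (.ltNat (.var 4) (.var 1)) <|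
    .seq (.setNat 3 (.add (.var 4) (.const 1))
      (.add (.get 3 (.var 4)) (.get 3 (.var 4)))) <|
    .setNat 4 (.const 0) (.add (.var 4) (.const 1))

theorem reach_powersProg {db : ℕ → ℕ} {ω : Coins} {s : State} {d : ℕ} (hd : s.nat 1 0 = d) :
    Reach db ω powersProg s fun t s' => t ≤ 50 * (d + 1) ∧ ∀ i ≤ d, s'.nat 3 i = 2 ^ i := by
  simp +decide only [powersProg, reach_seq, reach_setNat, NExp.eval, NExp.cost]
  refine reach_loop d 20 (fun i s => s.nat 4 0 = i ∧ i ≤ d ∧ ∀ j ≤ i, s.nat 3 j = 2 ^ j) ?_ ?_ ?_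
  · simp +decide [setEntry_self, setEntry_ne]
  · rintro i s' ⟨hi, hid, hp⟩ hf hb
    have h1 : s'.nat 1 0 = d := by
      rw [hf.nat 1 (by simp [Prog.KeepsNat])]
      simpa +decide [setEntry_ne] using hd
    simp only [BExp.holds, NExp.eval, hi, h1] at hb
    refine ⟨hb, ?_⟩
    simp +decide only [reach_seq, reach_setNat, NExp.eval, NExp.cost, setEntry_self,
      setEntry_ne, ne_eq, hi, Function.update_self]
    refine ⟨trivial, trivial, by omega, fun j hj => ?_⟩
    rcases Nat.lt_succ_iff_lt_or_eq.1 (Nat.lt_succ_of_le hj) with h | rfl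
    · rw [Function.update_of_ne (by omega), hp j (by omega)]
    · rw [Function.update_self, hp i le_rfl, pow_succ]
      omega
  · rintro i t s' ⟨hi, hid, hp⟩ hf hb ht
    have h1 : s'.nat 1 0 = d := by
      rw [hf.nat 1 (by simp [Prog.KeepsNat])]
      simpa +decide [setEntry_ne] using hd
    simp only [BExp.holds, NExp.eval, hi, h1, BExp.cost, NExp.cost] at hb ht
    obtain rfl : i = d := by omega
    exact ⟨by omega, hp⟩

/-- The enumeration of the nodes. -/
def nodesProg : Prog :=
  .seq (.setNat 7 (.const 0) (.const 0)) <|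
  .seq (.setNat 8 (.const 0) (.const 0)) <|
  .seq (.setNat 4 (.const 0) (.const 0)) <|
  .seq (.setNat 5 (.const 0) (.const 0)) <|
  .seq (.setNat 6 (.const 0) (.const 1)) <|
  .seq (.setNat 13 (.const 0) (.const 0)) <|
  .while (.ltNat (.var 5) (.var 6)) <|
    .ite (.and (.ltNat (.get 8 (.var 5)) (.var 2)) (.ltNat (.var 4) (.var 1)))
      (.seq (.setNat 7 (.var 6) (.add (.var 4) (.const 1))) <|
        .seq (.setNat 9 (.var 6) (.var 5)) <|
        .seq (.setNat 10 (.var 6) (.get 3 (.var 4))) <|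
        .seq (.ite (.ltNat (.add (.get 8 (.var 5)) (.const 1)) (.var 2)) .skip
          (.seq (.setNat 24 (.var 13) (.var 6))
            (.setNat 13 (.const 0) (.add (.var 13) (.const 1))))) <|
        .seq (.setNat 8 (.var 6) (.add (.get 8 (.var 5)) (.const 1))) <|
        .seq (.setNat 4 (.const 0) (.add (.var 4) (.const 1)))
          (.setNat 6 (.const 0) (.add (.var 6) (.const 1))))
      (.seq (.setNat 5 (.const 0) (.add (.var 5) (.const 1)))
        (.setNat 4 (.const 0) (.get 7 (.var 5))))

theorem reach_nodesProg {db : ℕ → ℕ} {ω : Coins} {s : State} {d k : ℕ} (hk : 1 ≤ k)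
    (hd : s.nat 1 0 = d) (hk' : s.nat 2 0 = k) (hp : ∀ i ≤ d, s.nat 3 i = 2 ^ i) :
    Reach db ω nodesProg s fun t s' => t ≤ 400 * ∑ j ∈ range (k + 1), d.choose j ∧
      ∃ i tail A, Nodes d k tail i tail (s'.nat 13 0) (s'.nat 7) (s'.nat 8) (s'.nat 9)
        (s'.nat 10) (s'.nat 24) A := by
  set R := ∑ j ∈ range (k + 1), d.choose j with hR
  simp +decide only [nodesProg, reach_seq, reach_setNat, NExp.eval, NExp.cost]
  have hR0 : 0 < R := lt_of_lt_of_le (by simp)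
    (single_le_sum (f := fun j => d.choose j) (fun j _ => Nat.zero_le _)
      (mem_range.2 (Nat.succ_pos k)) : d.choose 0 ≤ R)
  -- Each iteration either advances the current node or appends a node. Both counters are at most
  -- `R`, and their sum counts the iterations.
  refine reach_loop (2 * R) 80 (fun n s => n + 1 = s.nat 5 0 + s.nat 6 0 ∧
    ∃ A, Nodes d k (s.nat 5 0) (s.nat 4 0) (s.nat 6 0) (s.nat 13 0) (s.nat 7) (s.nat 8) (s.nat 9)
        (s.nat 10) (s.nat 24) A) ?_ ?_ ?_
  · simp +decide only [setEntry_self, setEntry_ne, ne_eq, Function.update_self]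
    exact ⟨trivial, _, Nodes.init hk (Function.update_self _ _ _) (Function.update_self _ _ _)⟩
  · rintro n s' ⟨hn, A, H⟩ hf hb
    have h1 : s'.nat 1 0 = d := by
      rw [hf.nat 1 (by simp [Prog.KeepsNat])]
      simpa +decide [setEntry_ne] using hd
    have h2 : s'.nat 2 0 = k := by
      rw [hf.nat 2 (by simp [Prog.KeepsNat])]
      simpa +decide [setEntry_ne] using hk'
    have h3 : ∀ i ≤ d, s'.nat 3 i = 2 ^ i := by
      rw [hf.nat 3 (by simp [Prog.KeepsNat])]
      simpa +decide [setEntry_ne] using hp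
    simp only [BExp.holds, NExp.eval] at hb
    have htail := H.tail_le
    refine ⟨by omega, ?_⟩
    rw [reach_ite]
    constructor
    · rintro ⟨hb1, hb2⟩
      simp only [BExp.holds, NExp.eval, h1, h2] at hb1 hb2
      simp +decide only [reach_seq, reach_setNat, reach_ite, reach_skip, BExp.holds, BExp.cost,
        NExp.eval, NExp.cost, setEntry_self, setEntry_ne, ne_eq, Function.update_self, h2,
        h3 _ hb2.le]
      refine ⟨fun hlt => ⟨trivial, by omega, _, H.push hb hb1 hb2 (Or.inl ⟨hlt, rfl, rfl⟩)⟩,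
        fun hlt => ⟨trivial, by omega, _, H.push hb hb1 hb2 (Or.inr ⟨hlt, rfl, rfl⟩)⟩⟩
    · intro hb'
      simp only [BExp.holds, NExp.eval, h1, h2] at hb'
      simp +decide only [reach_seq, reach_setNat, BExp.cost,
        NExp.eval, NExp.cost, setEntry_self, setEntry_ne, ne_eq, Function.update_self]
      exact ⟨trivial, by omega, _, H.advance hb hb'⟩
  · rintro n t s' ⟨hn, A, H⟩ hf hb ht
    simp only [BExp.holds, NExp.eval, not_lt, BExp.cost, NExp.cost] at hb ht
    have heq : s'.nat 5 0 = s'.nat 6 0 := le_antisymm H.le_tail hb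
    refine ⟨by omega, s'.nat 4 0, s'.nat 6 0, A, ?_⟩
    rwa [heq] at H

/-! ### Listing the subsets of a set by doubling. -/

/-- The first `len` entries of `f` are the codes of the subsets of `S \ U`, with the code of
`S \ U` last, and the next `off` entries arise from them by adding `y`. -/
structure PartialBlock (S U : Finset ℕ) (len off y : ℕ) (f : ℕ → ℕ) : Prop where
  subset : U ⊆ S
  len_eq : len = 2 ^ (S \ U).card
  off_lt : off < len
  image : (range len).image f = (S \ U).powerset.image code
  last : f (len - 1) = code (S \ U)
  shifted : ∀ e < off, f (len + e) = f e + y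

namespace PartialBlock

variable {S U : Finset ℕ} {len off y : ℕ} {f : ℕ → ℕ}

theorem init (y : ℕ) (h : f 0 = 0) : PartialBlock S S 1 0 y f where
  subset := Subset.rfl
  len_eq := by simp
  off_lt := one_pos
  image := by simp [h, code]
  last := by simp [h, code]
  shifted e he := by omega

theorem push (H : PartialBlock S U len off y f) :
    (∀ e < off + 1, Function.update f (len + off) (f off + y) (len + e)
        = Function.update f (len + off) (f off + y) e + y) ∧
      ∀ e < len, Function.update f (len + off) (f off + y) e = f e := by
  have h2 : ∀ e < len, Function.update f (len + off) (f off + y) e = f e := fun e he =>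
    Function.update_of_ne (by omega) _ _
  have hoff := H.off_lt
  refine ⟨fun e he => ?_, h2⟩
  rw [h2 e (by omega)]
  rcases Nat.lt_succ_iff_lt_or_eq.1 he with h | rfl
  · rw [Function.update_of_ne (by omega), H.shifted e h]
  · rw [Function.update_self]

theorem push_of_lt (H : PartialBlock S U len off y f) (h : off + 1 < len) :
    PartialBlock S U len (off + 1) y (Function.update f (len + off) (f off + y)) where
  subset := H.subset
  len_eq := H.len_eq
  off_lt := h
  image := by
    rw [← H.image]
    exact image_congr fun e he => H.push.2 e (mem_range.1 (mem_coe.1 he))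
  last := by rw [H.push.2 _ (by omega), H.last]
  shifted := H.push.1

/-- The finished second half consists of the subsets containing `j`, coded by adding `2^j`. Climbing
from a leaf to the root supplies the elements `j` one at a time, and the full set stays last. -/
theorem push_of_not_lt {U' : Finset ℕ} {j : ℕ} (H : PartialBlock S U len off (2 ^ j) f)
    (h : ¬ off + 1 < len) (hU : U = insert j U') (hj : j ∉ U') (y' : ℕ) :
    PartialBlock S U' (len + len) 0 y' (Function.update f (len + off) (f off + 2 ^ j)) := by
  have hlen : off + 1 = len := by
    have := H.off_lt
    omega
  have hjS : j ∈ S := H.subset (hU ▸ mem_insert_self _ _)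
  have hjn : j ∉ S \ U := fun hm => (mem_sdiff.1 hm).2 (hU ▸ mem_insert_self _ _)
  have hins : S \ U' = insert j (S \ U) := by
    ext x
    simp only [mem_sdiff, mem_insert, hU, not_or]
    constructor
    · rintro ⟨hx, hx'⟩
      by_cases hxj : x = j
      · exact Or.inl hxj
      · exact Or.inr ⟨hx, hxj, hx'⟩
    · rintro (rfl | ⟨hx, -, hx'⟩)
      · exact ⟨hjS, hj⟩
      · exact ⟨hx, hx'⟩
  obtain ⟨h1, h2⟩ := H.push
  rw [hlen] at h1
  set g := Function.update f (len + off) (f off + 2 ^ j) with hg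
  have hsplit : (range (len + len)).image g
      = (range len).image g ∪ (range len).image fun e => g (len + e) := by
    rw [range_add, image_union]
    congr 1
    ext c
    simp
  have hfirst : (range len).image g = (S \ U).powerset.image code := by
    rw [← H.image]
    exact image_congr fun e he => h2 e (mem_range.1 (mem_coe.1 he))
  have hcode : ∀ B ∈ (S \ U).powerset, code (insert j B) = 2 ^ j + code B := fun B hB =>
    code_insert fun hm => hjn (mem_powerset.1 hB hm)
  refine ⟨(subset_insert _ _).trans (hU ▸ H.subset), ?_, by omega, ?_, ?_, fun e he => by omega⟩
  · rw [hins, card_insert_of_notMem hjn, pow_succ, ← H.len_eq]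
    omega
  · rw [hsplit, hins, powerset_insert, image_union, ← hfirst, image_image]
    congr 1
    have hsecond : (range len).image (fun e => g (len + e))
        = ((range len).image g).image (· + 2 ^ j) := by
      rw [image_image]
      exact image_congr fun e he => h1 e (mem_range.1 (mem_coe.1 he))
    rw [hsecond, hfirst, image_image]
    refine image_congr fun B hB => ?_
    simp only [Function.comp_apply]
    rw [hcode B hB, add_comm]
  · have e1 : len + len - 1 = len + off := by omega
    have e2 : off = len - 1 := by omega
    rw [e1, hg, Function.update_self, hins, code_insert hjn, ← H.last, e2, add_comm]

theorem eq_empty (H : PartialBlock S U len off y f) (h : 2 ^ S.card ≤ len) : U = ∅ := by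
  rw [H.len_eq, Nat.pow_le_pow_iff_right (by norm_num), card_sdiff_of_subset H.subset] at h
  have := card_le_card H.subset
  exact card_eq_zero.1 (by omega)

theorem ne_empty (H : PartialBlock S U len off y f) (h : len < 2 ^ S.card) : U ≠ ∅ := by
  rintro rfl
  rw [H.len_eq, sdiff_empty] at h
  exact lt_irrefl _ h

theorem two_mul_len_le (H : PartialBlock S U len off y f) (h : len < 2 ^ S.card) :
    2 * len ≤ 2 ^ S.card := by
  rw [H.len_eq] at h ⊢
  rw [← pow_succ']
  exact Nat.pow_le_pow_right (by norm_num) ((Nat.pow_lt_pow_iff_right (by norm_num)).1 h)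

end PartialBlock

/-- The construction of one block. -/
def blockProg : Prog :=
  .while (.ltNat (.var 15) (.var 18)) <|
    .seq (.setNat 11 (.add (.var 17) (.add (.var 15) (.var 16)))
      (.add (.get 11 (.add (.var 17) (.var 16))) (.get 10 (.var 14)))) <|
    .seq (.setNat 16 (.const 0) (.add (.var 16) (.const 1))) <|
    .ite (.ltNat (.var 16) (.var 15)) .skip <|
      .seq (.setNat 15 (.const 0) (.add (.var 15) (.var 15))) <|
      .seq (.setNat 16 (.const 0) (.const 0))
        (.setNat 14 (.const 0) (.get 9 (.var 14)))

theorem update_shift (g : ℕ → ℕ) (p a v : ℕ) :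
    (fun e => Function.update g (p + a) v (p + e)) = Function.update (fun e => g (p + e)) a v := by
  funext e
  by_cases h : e = a
  · subst h
    simp
  · rw [Function.update_of_ne (by omega), Function.update_of_ne h]

theorem reach_blockProg {db : ℕ → ℕ} {ω : Coins} {s : State} {d k h i tail N ptr : ℕ}
    {start size leaf : ℕ → ℕ} {A : ℕ → Finset ℕ} {S : Finset ℕ}
    (H : Nodes d k h i tail N start size (s.nat 9) (s.nat 10) leaf A) (hS : S.card = k)
    (hm : s.nat 18 0 = 2 ^ k) (hp : s.nat 17 0 = ptr) (hx : s.nat 14 0 < tail)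
    (hB : PartialBlock S (A (s.nat 14 0)) (s.nat 15 0) (s.nat 16 0) (s.nat 10 (s.nat 14 0))
      fun e => s.nat 11 (ptr + e)) (h0 : s.nat 16 0 = 0) (h1 : s.nat 15 0 = 1) :
    Reach db ω blockProg s fun t s' => t ≤ 90 * 2 ^ k ∧
      (∀ a < ptr, s'.nat 11 a = s.nat 11 a) ∧
      (range (2 ^ k)).image (fun e => s'.nat 11 (ptr + e)) = S.powerset.image code ∧
      s'.nat 11 (ptr + (2 ^ k - 1)) = code S := by
  -- `len + off` grows by one per iteration, also at a doubling, where `off + 1 = len`.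
  refine reach_loop (2 ^ k) 70 (fun n s' => n + 1 = s'.nat 15 0 + s'.nat 16 0 ∧
    s'.nat 14 0 < tail ∧ (∀ a < ptr, s'.nat 11 a = s.nat 11 a) ∧
    PartialBlock S (A (s'.nat 14 0)) (s'.nat 15 0) (s'.nat 16 0) (s.nat 10 (s'.nat 14 0))
      fun e => s'.nat 11 (ptr + e)) ?_ ?_ ?_
  · exact ⟨by omega, hx, fun a _ => rfl, hB⟩
  · rintro n s' ⟨hn, hx', hold, hB'⟩ hf hb
    have e9 : s'.nat 9 = s.nat 9 := hf.nat 9 (by simp [Prog.KeepsNat])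
    have e10 : s'.nat 10 = s.nat 10 := hf.nat 10 (by simp [Prog.KeepsNat])
    have e17 : s'.nat 17 0 = ptr := by rw [hf.nat 17 (by simp [Prog.KeepsNat]), hp]
    have e18 : s'.nat 18 0 = 2 ^ k := by rw [hf.nat 18 (by simp [Prog.KeepsNat]), hm]
    simp only [BExp.holds, NExp.eval, e18] at hb
    rw [← hS] at hb
    have h2 := hB'.two_mul_len_le hb
    have hoff := hB'.off_lt
    rw [hS] at h2
    refine ⟨by omega, ?_⟩
    -- While the block is incomplete some element remains, so the current node is not the root and
    -- has a parent.
    have hx0 : 0 < s'.nat 14 0 := Nat.pos_of_ne_zero fun h => hB'.ne_empty hb (by rw [h, H.root])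
    obtain ⟨j, hj1, hj2, hj3, hj4⟩ := H.child _ hx' hx0
    have hpar := H.par_lt _ hx' hx0
    have hjn : j ∉ A (s.nat 9 (s'.nat 14 0)) := fun hmem => by
      have := mem_range.1 (H.subset _ (by omega) hmem)
      omega
    simp +decide only [reach_seq, reach_setNat, reach_ite, reach_skip, BExp.holds, BExp.cost,
        NExp.eval, NExp.cost, setEntry_self, setEntry_ne, ne_eq, Function.update_self, e9, e10,
        e17]
    have hold' : ∀ v, ∀ a < ptr, Function.update (s'.nat 11)
        (ptr + (s'.nat 15 0 + s'.nat 16 0)) v a = s.nat 11 a := fun v a ha => by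
      rw [Function.update_of_ne (by omega), hold a ha]
    refine ⟨fun hlt => ⟨trivial, by omega, hx', hold' _, ?_⟩,
      fun hlt => ⟨trivial, by omega, by omega, hold' _, ?_⟩⟩
    · rw [update_shift]
      exact hB'.push_of_lt hlt
    · rw [update_shift]
      rw [hj2] at hB' ⊢
      exact hB'.push_of_not_lt hlt hj3 hjn _
  · rintro n t s' ⟨hn, hx', hold, hB'⟩ hf hb ht
    have e18 : s'.nat 18 0 = 2 ^ k := by rw [hf.nat 18 (by simp [Prog.KeepsNat]), hm]
    simp only [BExp.holds, NExp.eval, e18, not_lt, BExp.cost, NExp.cost] at hb ht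
    have h2 : 1 ≤ 2 ^ k := Nat.one_le_two_pow
    have hU := hB'.eq_empty (by rw [hS]; exact hb)
    have hlen := hB'.len_eq
    have himage := hB'.image
    have hlast := hB'.last
    rw [hU, sdiff_empty] at hlen himage hlast
    rw [hS] at hlen
    rw [hlen] at himage hlast
    exact ⟨by omega, hold, himage, hlast⟩

/-- The construction of all blocks. -/
def blocksProg : Prog :=
  .seq (.setNat 20 (.const 0) (.const 0)) <|
  .seq (.setNat 17 (.const 0) (.const 0)) <|
  .while (.ltNat (.var 20) (.var 13)) <|
    .seq (.setNat 12 (.var 20) (.var 17)) <|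
    .seq (.setNat 11 (.var 17) (.const 0)) <|
    .seq (.setNat 14 (.const 0) (.get 24 (.var 20))) <|
    .seq (.setNat 15 (.const 0) (.const 1)) <|
    .seq (.setNat 16 (.const 0) (.const 0)) <|
    .seq blockProg <|
    .seq (.setNat 17 (.const 0) (.add (.var 17) (.var 18)))
      (.setNat 20 (.const 0) (.add (.var 20) (.const 1)))

theorem reach_blocksProg {db : ℕ → ℕ} {ω : Coins} {s : State} {d k i tail : ℕ}
    {A : ℕ → Finset ℕ}
    (H : Nodes d k tail i tail (s.nat 13 0) (s.nat 7) (s.nat 8) (s.nat 9) (s.nat 10) (s.nat 24) A)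
    (hm : s.nat 18 0 = 2 ^ k) :
    Reach db ω blocksProg s fun t s' => t ≤ 150 * (s'.nat 13 0 * 2 ^ k) + 20 ∧
      ∃ A', IsLayout d k (s'.nat 13 0) A' (fun q e => s'.nat 11 (s'.nat 12 q + e)) := by
  have h2 : 1 ≤ 2 ^ k := Nat.one_le_two_pow
  simp +decide only [blocksProg, reach_seq, reach_setNat, NExp.eval, NExp.cost]
  refine reach_loop (s.nat 13 0) (90 * 2 ^ k + 40) (fun n s' => s'.nat 20 0 = n ∧
    n ≤ s.nat 13 0 ∧ s'.nat 17 0 = n * 2 ^ k ∧ ∀ q < n, s'.nat 12 q = q * 2 ^ k ∧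
      (range (2 ^ k)).image (fun e => s'.nat 11 (q * 2 ^ k + e))
        = (A (s.nat 24 q)).powerset.image code ∧
      s'.nat 11 (q * 2 ^ k + (2 ^ k - 1)) = code (A (s.nat 24 q))) ?_ ?_ ?_
  · simp +decide only [setEntry_self, setEntry_ne, ne_eq, Function.update_self]
    exact ⟨trivial, Nat.zero_le _, by omega, fun q hq => absurd hq (Nat.not_lt_zero q)⟩
  · rintro n s' ⟨hn, hnN, hptr, hq⟩ hf hb
    have e : ∀ a ∈ [9, 10, 13, 18, 24], s'.nat a = s.nat a := fun a ha => by
      rw [hf.nat a (by fin_cases ha <;> simp [Prog.KeepsNat, blockProg])]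
      fin_cases ha <;> simp +decide [setEntry_ne]
    have e9 := e 9 (by simp)
    have e10 := e 10 (by simp)
    have e13 := e 13 (by simp)
    have e18 := e 18 (by simp)
    have e24 := e 24 (by simp)
    simp only [BExp.holds, NExp.eval, hn, e13] at hb
    refine ⟨hb, ?_⟩
    simp +decide only [reach_seq, reach_setNat, NExp.eval, NExp.cost, setEntry_self, setEntry_ne,
      ne_eq, Function.update_self, hn, hptr, e24]
    refine (reach_blockProg (d := d) (k := k) (h := tail) (i := i) (tail := tail)
      (N := s.nat 13 0) (ptr := n * 2 ^ k) (start := s.nat 7) (size := s.nat 8) (leaf := s.nat 24)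
      (A := A) (S := A (s.nat 24 n)) ?_ (H.leaf_card n hb) ?_ ?_ ?_ ?_ ?_ ?_).withFrame.mono ?_
    · simp +decide only [setEntry_ne, ne_eq, e9, e10]
      exact H
    · simp +decide only [setEntry_ne, ne_eq, e18, hm]
    · simp +decide only [setEntry_ne, ne_eq, hptr]
    · simp +decide only [setEntry_self, setEntry_ne, ne_eq, Function.update_self]
      exact H.leaf_lt n hb
    · simp +decide only [setEntry_self, setEntry_ne, ne_eq, Function.update_self]
      exact PartialBlock.init _ (by simp)
    · simp +decide only [setEntry_self, Function.update_self]
    · simp +decide only [setEntry_self, setEntry_ne, ne_eq, Function.update_self]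
    · rintro t s'' ⟨⟨ht, hold, himage, hlast⟩, hf'⟩
      have f20 : s''.nat 20 0 = n := by
        rw [hf'.nat 20 (by simp [Prog.KeepsNat, blockProg])]
        simpa +decide only [setEntry_ne, ne_eq] using hn
      have f17 : s''.nat 17 0 = n * 2 ^ k := by
        rw [hf'.nat 17 (by simp [Prog.KeepsNat, blockProg])]
        simpa +decide only [setEntry_ne, ne_eq] using hptr
      have f18 : s''.nat 18 0 = 2 ^ k := by
        rw [hf'.nat 18 (by simp [Prog.KeepsNat, blockProg])]
        simp +decide only [setEntry_ne, ne_eq, e18, hm]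
      have f12 : s''.nat 12 = Function.update (s'.nat 12) n (n * 2 ^ k) := by
        rw [hf'.nat 12 (by simp [Prog.KeepsNat, blockProg])]
        simp +decide only [setEntry_self, setEntry_ne, ne_eq]
      simp +decide only [setEntry_self, setEntry_ne, ne_eq] at hold
      simp only [f20, f17, f18, f12]
      refine ⟨by omega, trivial, by omega, by ring, fun q hqn => ?_⟩
      rcases Nat.lt_succ_iff_lt_or_eq.1 hqn with hlt | rfl
      · obtain ⟨g1, g2, g3⟩ := hq q hlt
        -- Earlier blocks end before `n * 2 ^ k`, where the current one begins, so they are not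
        -- overwritten.
        have hle : (q + 1) * 2 ^ k ≤ n * 2 ^ k := Nat.mul_le_mul_right _ hlt
        have hsame : ∀ e < 2 ^ k, s''.nat 11 (q * 2 ^ k + e) = s'.nat 11 (q * 2 ^ k + e) := by
          intro e he
          have : q * 2 ^ k + e < n * 2 ^ k := by
            rw [add_mul] at hle
            omega
          rw [hold _ this, Function.update_of_ne (by omega)]
        refine ⟨by rw [Function.update_of_ne (by omega), g1], ?_, ?_⟩
        · rw [← g2]
          exact image_congr fun e he => hsame e (mem_range.1 (mem_coe.1 he))
        · rw [hsame _ (by omega), g3]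
      · exact ⟨Function.update_self _ _ _, himage, hlast⟩
  · rintro n t s' ⟨hn, hnN, hptr, hq⟩ hf hb ht
    have e13 : s'.nat 13 = s.nat 13 := by
      rw [hf.nat 13 (by simp [Prog.KeepsNat, blockProg])]
      simp +decide [setEntry_ne]
    simp only [BExp.holds, NExp.eval, hn, e13, BExp.cost, NExp.cost] at hb ht
    obtain rfl : n = s.nat 13 0 := by omega
    rw [e13]
    refine ⟨?_, fun q => A (s.nat 24 q), ?_, ?_, ?_, ?_, ?_, ?_⟩
    · have : s.nat 13 0 ≤ s.nat 13 0 * 2 ^ k := Nat.le_mul_of_pos_right _ h2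
      nlinarith
    · exact fun q hqN => (H.subset _ (H.leaf_lt q hqN)).trans
        (range_mono (H.start_le _ (H.leaf_lt q hqN)))
    · exact fun q hqN => H.leaf_card q hqN
    · exact fun q hqN q' hqN' h =>
        H.leaf_inj q hqN q' hqN' (H.inj _ (H.leaf_lt q hqN) _ (H.leaf_lt q' hqN') h)
    · intro B hB hBk
      obtain ⟨x, hx, rfl⟩ := H.exists_node B hB hBk.le
      obtain ⟨q, hqN, rfl⟩ := H.leaf_surj x hx hBk
      exact ⟨q, hqN, rfl⟩
    · intro q hqN
      rw [(hq q hqN).1]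
      exact (hq q hqN).2.1
    · intro q hqN
      rw [(hq q hqN).1]
      exact (hq q hqN).2.2

/-- The construction of the layout from the dimensions in the arrays `1` and `2`. -/
def layoutProg : Prog :=
  .seq powersProg <|
  .seq (.setNat 18 (.const 0) (.get 3 (.var 2))) <|
  .seq (.setNat 19 (.const 0) (.sub (.get 3 (.var 1)) (.const 1))) <|
  .seq nodesProg blocksProg

theorem reach_layoutProg {db : ℕ → ℕ} {ω : Coins} {s : State} {d k : ℕ} (hk : 1 ≤ k) (hkd : k ≤ d)
    (hd : s.nat 1 0 = d) (hk' : s.nat 2 0 = k) :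
    Reach db ω layoutProg s fun t s' => t ≤ 800 * (d.choose k * 2 ^ k) ∧
      s'.nat 18 0 = 2 ^ k ∧ s'.nat 19 0 = 2 ^ d - 1 ∧
      ∃ A, IsLayout d k (s'.nat 13 0) A (fun q e => s'.nat 11 (s'.nat 12 q + e)) := by
  rw [layoutProg, reach_seq]
  refine (reach_powersProg hd).withFrame.mono ?_
  rintro t₁ s₁ ⟨⟨ht₁, hp⟩, hf₁⟩
  have a1 : s₁.nat 1 0 = d := by
    rw [hf₁.nat 1 (by simp [Prog.KeepsNat, powersProg]), hd]
  have a2 : s₁.nat 2 0 = k := by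
    rw [hf₁.nat 2 (by simp [Prog.KeepsNat, powersProg]), hk']
  simp +decide only [reach_seq, reach_setNat, NExp.eval, NExp.cost, setEntry_ne, ne_eq, a1, a2,
    hp k hkd, hp d le_rfl]
  refine (reach_nodesProg (d := d) hk ?_ ?_ ?_).withFrame.mono ?_
  · simpa +decide only [setEntry_ne, ne_eq] using a1
  · simpa +decide only [setEntry_ne, ne_eq] using a2
  · simpa +decide only [setEntry_ne, ne_eq] using hp
  rintro t₂ s₂ ⟨⟨ht₂, i, tail, A, H⟩, hf₂⟩
  have b18 : s₂.nat 18 0 = 2 ^ k := by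
    rw [hf₂.nat 18 (by simp [Prog.KeepsNat, nodesProg])]
    simp +decide only [setEntry_self, setEntry_ne, ne_eq, Function.update_self]
  have b19 : s₂.nat 19 0 = 2 ^ d - 1 := by
    rw [hf₂.nat 19 (by simp [Prog.KeepsNat, nodesProg])]
    simp +decide only [setEntry_self, Function.update_self]
  refine (reach_blocksProg H b18).withFrame.mono ?_
  rintro t₃ s₃ ⟨⟨ht₃, A', L⟩, hf₃⟩
  have c18 : s₃.nat 18 0 = 2 ^ k := by
    rw [hf₃.nat 18 (by simp [Prog.KeepsNat, blocksProg, blockProg]), b18]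
  have c19 : s₃.nat 19 0 = 2 ^ d - 1 := by
    rw [hf₃.nat 19 (by simp [Prog.KeepsNat, blocksProg, blockProg]), b19]
  refine ⟨?_, c18, c19, A', L⟩
  have hsum := sum_choose_le hkd
  -- The steps spent on powers of two are charged to the one-element sets, which are among the nodes
  -- because `k ≥ 1`.
  have hd1 : d.choose 1 ≤ ∑ j ∈ range (k + 1), d.choose j :=
    single_le_sum (f := fun j => d.choose j) (fun j _ => Nat.zero_le _)
      (mem_range.2 (by omega))
  rw [Nat.choose_one_right] at hd1
  rw [L.card_eq] at ht₃
  omega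

/-! ## The program, second part: multiplicative weights

Arrays of natural numbers, in addition to those of the layout: `16` position in a block,
`21` a count, `22` the choice, `23` the round. Arrays of real numbers: `1` weights, `2` sums of the
estimates, `3` weights of the exponential mechanism, `4` block sums, `5` normalization, `6` the
sample, `7` the factor of the update, `8`-`10` parameters, `11` an estimate. -/

/-- A variable of type real number: the entry `0` of an array. -/
abbrev RExp.var (a : ℕ) : RExp := .get a (.const 0)

/-- A natural number, as a real number. -/
abbrev RExp.const (n : ℕ) : RExp := .ofNat (.const n)

/-- The current entry of the current block. -/
abbrev entryExp : NExp := .get 11 (.add (.get 12 (.var 20)) (.var 16))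

/-- The part of the state that the main loop reads and does not change. -/
structure Static (d k N m n : ℕ) (blk : ℕ → ℕ → ℕ) (η lam α : ℝ) (s : State) : Prop where
  size : s.nat 0 2 = n
  num : s.nat 2 0 = k
  block : ∀ q e, s.nat 11 (s.nat 12 q + e) = blk q e
  queries : s.nat 13 0 = N
  blockSize : s.nat 18 0 = m
  ones : s.nat 19 0 = 2 ^ d - 1
  acc : s.real 0 2 = α
  param : s.real 8 0 = lam
  rate : s.real 9 0 = η
  offset : s.real 10 0 = 1 / m

/-- The program does not write to the static part of the state. -/
def Prog.KeepsStatic (p : Prog) : Prop :=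
  (p.KeepsNat 0 ∧ p.KeepsNat 2 ∧ p.KeepsNat 11 ∧ p.KeepsNat 12 ∧ p.KeepsNat 13 ∧ p.KeepsNat 18 ∧
    p.KeepsNat 19) ∧ p.KeepsReal 0 ∧ p.KeepsReal 8 ∧ p.KeepsReal 9 ∧ p.KeepsReal 10

section

variable {db : ℕ → ℕ} {ω : Coins} {d k N m n : ℕ} {blk : ℕ → ℕ → ℕ} {η lam α : ℝ} {s : State}

theorem Static.frame {p : Prog} {s' : State} (H : Static d k N m n blk η lam α s)
    (hf : Frame p s s') (hp : p.KeepsStatic) : Static d k N m n blk η lam α s' := by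
  obtain ⟨⟨h0, h2, h11, h12, h13, h18, h19⟩, r0, r8, r9, r10⟩ := hp
  constructor
  · rw [hf.nat _ h0, H.size]
  · rw [hf.nat _ h2, H.num]
  · rw [hf.nat _ h11, hf.nat _ h12]
    exact H.block
  · rw [hf.nat _ h13, H.queries]
  · rw [hf.nat _ h18, H.blockSize]
  · rw [hf.nat _ h19, H.ones]
  · rw [hf.real _ r0, H.acc]
  · rw [hf.real _ r8, H.param]
  · rw [hf.real _ r9, H.rate]
  · rw [hf.real _ r10, H.offset]

/-- The weight and the count of the current query. -/
def sumProg : Prog :=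
  .seq (.setReal 4 (.var 20) (.const 0)) <|
  .seq (.setNat 21 (.const 0) (.const 0)) <|
  .seq (.setNat 16 (.const 0) (.const 0)) <|
  .while (.ltNat (.var 16) (.var 18)) <|
    .seq (.setReal 4 (.var 20) (.add (.get 4 (.var 20)) (.get 1 entryExp))) <|
    .seq (.setNat 21 (.const 0) (.add (.var 21) (.count (.sub (.var 19) entryExp))))
      (.setNat 16 (.const 0) (.add (.var 16) (.const 1)))

theorem reach_sumProg (H : Static d k N m n blk η lam α s) :
    Reach db ω sumProg s fun t s' => t ≤ 60 * m + 20 ∧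
      s'.real 4 = Function.update (s.real 4) (s.nat 20 0)
        (blockSum m blk (s.real 1) (s.nat 20 0)) ∧
      s'.nat 21 0 = ∑ e ∈ range m, db (2 ^ d - 1 - blk (s.nat 20 0) e) := by
  simp +decide only [sumProg, reach_seq, reach_setNat, reach_setReal, NExp.eval, NExp.cost,
    RExp.eval, RExp.cost]
  refine reach_loop m 50 (fun i s' => s'.nat 16 0 = i ∧ i ≤ m ∧
    s'.real 4 = Function.update (s.real 4) (s.nat 20 0)
        (∑ e ∈ range i, s.real 1 (blk (s.nat 20 0) e)) ∧
      s'.nat 21 0 = ∑ e ∈ range i, db (2 ^ d - 1 - blk (s.nat 20 0) e)) ?_ ?_ ?_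
  · simp +decide only [setEntry_self, setEntry_ne, ne_eq, Function.update_self]
    simp
  · rintro i s' ⟨hi, him, h4, h21⟩ hf hb
    have e20 : s'.nat 20 0 = s.nat 20 0 := by
      rw [hf.nat 20 (by simp [Prog.KeepsNat])]
      simp +decide only [setEntry_ne, ne_eq]
    have e12 : s'.nat 12 = s.nat 12 := by
      rw [hf.nat 12 (by simp [Prog.KeepsNat])]
      simp +decide only [setEntry_ne, ne_eq]
    have e11 : s'.nat 11 = s.nat 11 := by
      rw [hf.nat 11 (by simp [Prog.KeepsNat])]
      simp +decide only [setEntry_ne, ne_eq]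
    have e18 : s'.nat 18 0 = m := by
      rw [hf.nat 18 (by simp [Prog.KeepsNat])]
      simp +decide only [setEntry_ne, ne_eq, H.blockSize]
    have e19 : s'.nat 19 0 = 2 ^ d - 1 := by
      rw [hf.nat 19 (by simp [Prog.KeepsNat])]
      simp +decide only [setEntry_ne, ne_eq, H.ones]
    have e1 : s'.real 1 = s.real 1 := by
      rw [hf.real 1 (by simp [Prog.KeepsReal])]
      simp +decide only [setEntry_ne, ne_eq]
    simp only [BExp.holds, NExp.eval, hi, e18] at hb
    refine ⟨hb, ?_⟩
    simp +decide only [reach_seq, reach_setNat, reach_setReal, NExp.eval, NExp.cost, RExp.eval,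
      setEntry_self, setEntry_ne, ne_eq, Function.update_self, hi, e20, e12, e11, e19,
      e1, H.block, h4, h21, Function.update_idem]
    exact ⟨trivial, trivial, hb, by rw [sum_range_succ], by rw [sum_range_succ]⟩
  · rintro i t s' ⟨hi, him, h4, h21⟩ hf hb ht
    have e18 : s'.nat 18 0 = m := by
      rw [hf.nat 18 (by simp [Prog.KeepsNat])]
      simp +decide only [setEntry_ne, ne_eq, H.blockSize]
    simp only [BExp.holds, NExp.eval, hi, e18, BExp.cost, NExp.cost] at hb ht
    obtain rfl : i = m := by omega
    exact ⟨by omega, h4, h21⟩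

/-- The weights of the exponential mechanism, the normalization and the estimates. -/
def scoresProg : Prog :=
  .seq (.setNat 20 (.const 0) (.const 0)) <|
  .seq (.setReal 5 (.const 0) (.const 0)) <|
  .while (.ltNat (.var 20) (.var 13)) <|
    .seq sumProg <|
    .seq (.setReal 11 (.const 0) (.get 4 (.var 20))) <|
    .seq (.ite (.ltReal (.const 1) (.var 11)) (.setReal 11 (.const 0) (.const 1)) .skip) <|
    .seq (.setReal 2 (.var 20) (.add (.get 2 (.var 20)) (.var 11))) <|
    .seq (.setReal 3 (.var 20) (.exp (.mul (.var 8)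
      (.sub (.ofNat (.var 21)) (.mul (.ofNat (.get 0 (.const 2))) (.var 11)))))) <|
    .seq (.setReal 3 (.add (.var 13) (.var 20)) (.exp (.mul (.var 8)
      (.sub (.mul (.ofNat (.get 0 (.const 2))) (.var 11)) (.ofNat (.var 21)))))) <|
    .seq (.setReal 5 (.const 0) (.add (.var 5)
      (.add (.get 3 (.var 20)) (.get 3 (.add (.var 13) (.var 20))))))
      (.setNat 20 (.const 0) (.add (.var 20) (.const 1)))

theorem keepsStatic_sumProg : sumProg.KeepsStatic := by
  simp [Prog.KeepsStatic, sumProg, Prog.KeepsNat, Prog.KeepsReal]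

theorem sum_range_two_mul (f : ℕ → ℝ) (N : ℕ) :
    ∑ r ∈ range (2 * N), f r = ∑ q ∈ range N, (f q + f (N + q)) := by
  rw [two_mul, sum_range_add, sum_add_distrib]

theorem reach_scoresProg (H : Static d k N m n blk η lam α s) (hm : 1 ≤ m) (v : Weights)
    (hv : s.real 1 = v.1) :
    Reach db ω scoresProg s fun t s' => t ≤ 200 * (N * m) + 20 ∧
      (∀ q < N, s'.real 4 q = blockSum m blk v.1 q) ∧
      (∀ q < N, s'.real 2 q = s.real 2 q + estimate m blk v.1 q) ∧
      (∀ r < 2 * N, s'.real 3 r = expWeight lam (mwScore d N m blk db n) v r) ∧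
      s'.real 5 0 = ∑ r ∈ range (2 * N), expWeight lam (mwScore d N m blk db n) v r := by
  set w := expWeight lam (mwScore d N m blk db n) v with hw
  simp +decide only [scoresProg, reach_seq, reach_setNat, reach_setReal, NExp.eval, NExp.cost,
    RExp.eval, RExp.cost]
  refine reach_loop N (60 * m + 110) (fun i s' => s'.nat 20 0 = i ∧ i ≤ N ∧
    (∀ q < i, s'.real 4 q = blockSum m blk v.1 q) ∧
    (∀ q < i, s'.real 2 q = s.real 2 q + estimate m blk v.1 q) ∧
    (∀ q, i ≤ q → s'.real 2 q = s.real 2 q) ∧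
    (∀ q < i, s'.real 3 q = w q ∧ s'.real 3 (N + q) = w (N + q)) ∧
    s'.real 5 0 = ∑ q ∈ range i, (w q + w (N + q))) ?_ ?_ ?_
  · simp +decide only [setEntry_self, setEntry_ne, ne_eq, Function.update_self]
    simp
  · rintro i s' ⟨hi, hiN, h4, h2, h2', h3, h5⟩ hf hb
    have Hs' : Static d k N m n blk η lam α s' := by
      refine Static.frame (s := { s with
        nat := setEntry s.nat 20 0 0, real := setEntry s.real 5 0 ((0 : ℕ) : ℝ) }) ?_ hf ?_
      · constructor <;> simp +decide only [setEntry_ne, ne_eq]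
        exacts [H.size, H.num, H.block, H.queries, H.blockSize, H.ones, H.acc, H.param, H.rate,
          H.offset]
      · simp [Prog.KeepsStatic, sumProg, Prog.KeepsNat, Prog.KeepsReal]
    have e1 : s'.real 1 = v.1 := by
      rw [hf.real 1 (by simp [sumProg, Prog.KeepsReal])]
      simp +decide only [setEntry_ne, ne_eq, hv]
    simp only [BExp.holds, NExp.eval, hi, Hs'.queries] at hb
    refine ⟨hb, ?_⟩
    rw [reach_seq]
    refine (reach_sumProg Hs').withFrame.mono ?_
    rintro t s'' ⟨⟨ht, g4, g21⟩, hf'⟩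
    rw [hi, e1] at g4
    rw [hi] at g21
    have Hs'' := Hs'.frame hf' keepsStatic_sumProg
    have g20 : s''.nat 20 0 = i := by
      rw [hf'.nat 20 (by simp [sumProg, Prog.KeepsNat]), hi]
    have g2 : s''.real 2 = s'.real 2 := hf'.real 2 (by simp [sumProg, Prog.KeepsReal])
    have g3 : s''.real 3 = s'.real 3 := hf'.real 3 (by simp [sumProg, Prog.KeepsReal])
    have g5 : s''.real 5 = s'.real 5 := hf'.real 5 (by simp [sumProg, Prog.KeepsReal])
    have hwi : w i = Real.exp (lam * ((∑ e ∈ range m, db (2 ^ d - 1 - blk i e) : ℕ)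
        - n * estimate m blk v.1 i)) := by
      rw [hw, expWeight, mwScore, candSign, if_pos hb, candQuery, if_pos hb, one_mul]
    have hwi' : w (N + i) = Real.exp (lam * (n * estimate m blk v.1 i
        - (∑ e ∈ range m, db (2 ^ d - 1 - blk i e) : ℕ))) := by
      rw [hw, expWeight, mwScore, candSign, if_neg (by omega), candQuery, if_neg (by omega),
        Nat.add_sub_cancel_left, neg_one_mul, neg_sub]
    have hiNi : i ≠ N + i := by omega
    -- Both branches of the cap lead to the same assertions, proved once for any `est` equal to the
    -- estimate.
    have key : ∀ est : ℝ, est = estimate m blk v.1 i → ∀ c : ℕ, c ≤ 60 * m + 110 →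
        c ≤ 60 * m + 110 ∧ True ∧ i + 1 ≤ N ∧
        (∀ q < i + 1, Function.update (s'.real 4) i (blockSum m blk v.1 i) q
          = blockSum m blk v.1 q) ∧
        (∀ q < i + 1, Function.update (s'.real 2) i (s'.real 2 i + est) q
          = s.real 2 q + estimate m blk v.1 q) ∧
        (∀ q, i + 1 ≤ q → Function.update (s'.real 2) i (s'.real 2 i + est) q = s.real 2 q) ∧
        (∀ q < i + 1,
          Function.update (Function.update (s'.real 3) i (Real.exp (lam *
            ((∑ e ∈ range m, db (2 ^ d - 1 - blk i e) : ℕ) - n * est)))) (N + i)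
            (Real.exp (lam * (n * est - (∑ e ∈ range m, db (2 ^ d - 1 - blk i e) : ℕ)))) q = w q ∧
          Function.update (Function.update (s'.real 3) i (Real.exp (lam *
            ((∑ e ∈ range m, db (2 ^ d - 1 - blk i e) : ℕ) - n * est)))) (N + i)
            (Real.exp (lam * (n * est - (∑ e ∈ range m, db (2 ^ d - 1 - blk i e) : ℕ)))) (N + q)
              = w (N + q)) ∧
        s'.real 5 0 + (Function.update (Function.update (s'.real 3) i (Real.exp (lam *
            ((∑ e ∈ range m, db (2 ^ d - 1 - blk i e) : ℕ) - n * est)))) (N + i)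
            (Real.exp (lam * (n * est - (∑ e ∈ range m, db (2 ^ d - 1 - blk i e) : ℕ)))) i
          + Real.exp (lam * (n * est - (∑ e ∈ range m, db (2 ^ d - 1 - blk i e) : ℕ))))
          = ∑ q ∈ range (i + 1), (w q + w (N + q)) := by
      rintro est rfl c hc
      rw [← hwi, ← hwi']
      refine ⟨hc, trivial, hb, fun q hq => ?_, fun q hq => ?_, fun q hq => ?_, fun q hq => ?_, ?_⟩
      · rcases Nat.lt_succ_iff_lt_or_eq.1 hq with h | rfl
        · rw [Function.update_of_ne (by omega), h4 q h]
        · rw [Function.update_self]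
      · rcases Nat.lt_succ_iff_lt_or_eq.1 hq with h | rfl
        · rw [Function.update_of_ne (by omega), h2 q h]
        · rw [Function.update_self, h2' q le_rfl]
      · rw [Function.update_of_ne (by omega), h2' q (by omega)]
      · rcases Nat.lt_succ_iff_lt_or_eq.1 hq with h | rfl
        · rw [Function.update_of_ne (by omega), Function.update_of_ne (by omega),
            Function.update_of_ne (by omega), Function.update_of_ne (by omega)]
          exact h3 q h
        · rw [Function.update_of_ne (by omega), Function.update_self, Function.update_self]
          exact ⟨rfl, rfl⟩
      · rw [Function.update_of_ne hiNi, Function.update_self, h5, sum_range_succ]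
    simp +decide only [reach_seq, reach_setNat, reach_setReal, reach_ite, reach_skip, BExp.holds,
      BExp.cost, NExp.eval, NExp.cost, RExp.eval, RExp.cost, setEntry_self, setEntry_ne, ne_eq,
      Function.update_self, g20, g4, g21, Hs''.queries, Hs''.size, Hs''.param, g2, g3, g5]
    refine ⟨fun h1 => key _ ?_ _ ?_, fun h1 => key _ ?_ _ ?_⟩
    · rw [estimate, min_eq_left (by simpa using h1.le)]
      simp
    · omega
    · rw [estimate, min_eq_right (by simpa using h1)]
    · omega
  · rintro i t s' ⟨hi, hiN, h4, h2, h2', h3, h5⟩ hf hb ht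
    have e13 : s'.nat 13 0 = N := by
      rw [hf.nat 13 (by simp [sumProg, Prog.KeepsNat])]
      simp +decide only [setEntry_ne, ne_eq, H.queries]
    simp only [BExp.holds, NExp.eval, hi, e13, BExp.cost, NExp.cost] at hb ht
    obtain rfl : i = N := by omega
    refine ⟨?_, h4, h2, fun r hr => ?_, by rw [h5, sum_range_two_mul]⟩
    · have : i ≤ i * m := Nat.le_mul_of_pos_right _ hm
      nlinarith
    · rcases lt_or_ge r i with h | h
      · exact (h3 r h).1
      · have := (h3 (r - i) (by omega)).2
        rwa [Nat.add_sub_cancel' h] at this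

/-- The choice of a candidate. -/
def pickProg : Prog :=
  .seq (.sample 6 (.const 0)) <|
  .seq (.setReal 6 (.const 0) (.mul (.var 6) (.var 5))) <|
  .seq (.setNat 22 (.const 0) (.const 0)) <|
  .while (.and (.ltNat (.add (.var 22) (.const 1)) (.add (.var 13) (.var 13)))
      (.not (.ltReal (.var 6) (.get 3 (.var 22))))) <|
    .seq (.setReal 6 (.const 0) (.sub (.var 6) (.get 3 (.var 22))))
      (.setNat 22 (.const 0) (.add (.var 22) (.const 1)))

/-- The scaled sample is diminished by the successive weights until it falls below the next one. The
bound on the index stops the scan at the last candidate when the sample is 1. -/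
theorem reach_pickProg {w : ℕ → ℝ} (hw : ∀ r, 0 < w r) (hN : 0 < N) (h13 : s.nat 13 0 = N)
    (h3 : ∀ r < 2 * N, s.real 3 r = w r) (h5 : s.real 5 0 = ∑ r ∈ range (2 * N), w r) :
    Reach db ω pickProg s fun t s' => t ≤ 100 * N + 20 ∧
      s'.nat 22 0 = pick w (2 * N) (ω s.used) ∧ s'.used = s.used + 1 := by
  simp +decide only [pickProg, reach_seq, reach_setNat, reach_setReal, reach_sample, NExp.eval,
    NExp.cost, RExp.eval, RExp.cost]
  have hu0 : (0 : ℝ) ≤ ω s.used := (ω s.used).2.1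
  have hZ : 0 ≤ ∑ r ∈ range (2 * N), w r := sum_nonneg fun r _ => (hw r).le
  refine reach_loop (2 * N) 20 (fun i s' => s'.nat 22 0 = i ∧ i < 2 * N ∧
    s'.used = s.used + 1 ∧
    s'.real 6 0 + ∑ r ∈ range i, w r = ω s.used * ∑ r ∈ range (2 * N), w r ∧
    ∑ r ∈ range i, w r ≤ ω s.used * ∑ r ∈ range (2 * N), w r) ?_ ?_ ?_
  · simp +decide only [setEntry_self, setEntry_ne, ne_eq, Function.update_self, h5]
    simp only [range_zero, sum_empty, add_zero]
    exact ⟨trivial, by omega, trivial, trivial, mul_nonneg hu0 hZ⟩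
  · rintro i s' ⟨hi, hiN, hus, h6, hle⟩ hf hb
    have e13 : s'.nat 13 0 = N := by
      rw [hf.nat 13 (by simp [Prog.KeepsNat])]
      simp +decide only [setEntry_ne, ne_eq, h13]
    have e3 : s'.real 3 = s.real 3 := by
      rw [hf.real 3 (by simp [Prog.KeepsReal])]
      simp +decide only [setEntry_ne, ne_eq]
    simp only [BExp.holds, NExp.eval, RExp.eval, hi, e13, e3, h3 i hiN, not_lt] at hb
    refine ⟨hiN, ?_⟩
    simp +decide only [reach_seq, reach_setNat, reach_setReal, NExp.eval, NExp.cost, RExp.eval,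
      setEntry_self, Function.update_self, hi, e3, h3 i hiN]
    refine ⟨trivial, trivial, by omega, hus, ?_, ?_⟩
    · rw [sum_range_succ, ← h6]
      ring
    · rw [sum_range_succ]
      linarith
  · rintro i t s' ⟨hi, hiN, hus, h6, hle⟩ hf hb ht
    have e13 : s'.nat 13 0 = N := by
      rw [hf.nat 13 (by simp [Prog.KeepsNat])]
      simp +decide only [setEntry_ne, ne_eq, h13]
    have e3 : s'.real 3 = s.real 3 := by
      rw [hf.real 3 (by simp [Prog.KeepsReal])]
      simp +decide only [setEntry_ne, ne_eq]
    simp only [BExp.holds, NExp.eval, RExp.eval, hi, e13, e3, h3 i hiN, not_and, not_not,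
      BExp.cost, NExp.cost, RExp.cost] at hb ht
    refine ⟨by omega, ?_, hus⟩
    rw [hi, eq_comm, pick_eq_iff hw hiN hu0]
    refine ⟨hle, ?_⟩
    by_cases h : i + 1 = 2 * N
    · exact Or.inl h
    · right
      have := hb (by omega)
      rw [sum_range_succ]
      linarith

/-- The update of the weights. -/
def updateProg : Prog :=
  .seq (.ite (.ltNat (.var 22) (.var 13))
    (.seq (.setNat 20 (.const 0) (.var 22)) <|
      .ite (.ltReal (.const 1) (.get 4 (.var 20))) (.setReal 7 (.const 0) (.exp (.const 0)))
        (.setReal 7 (.const 0) (.exp (.var 9))))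
    (.seq (.setNat 20 (.const 0) (.sub (.var 22) (.var 13)))
      (.setReal 7 (.const 0) (.exp (.sub (.const 0) (.var 9)))))) <|
  .seq (.setNat 16 (.const 0) (.const 0)) <|
  .while (.ltNat (.var 16) (.var 18)) <|
    .seq (.setReal 1 entryExp
      (.sub (.mul (.add (.get 1 entryExp) (.var 10)) (.var 7)) (.var 10))) <|
    .seq (.ite (.ltReal (.get 1 entryExp) (.const 0)) (.setReal 1 entryExp (.const 0)) .skip)
      (.setNat 16 (.const 0) (.add (.var 16) (.const 1)))

theorem reach_updateLoop {f : ℝ} {q : ℕ} {v : ℕ → ℝ} (H : Static d k N m n blk η lam α s)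
    (hinj : Set.InjOn (blk q) (range m)) (h20 : s.nat 20 0 = q) (h7 : s.real 7 0 = f)
    (hv : s.real 1 = v) (h16 : s.nat 16 0 = 0) :
    Reach db ω (.while (.ltNat (.var 16) (.var 18)) <|
      .seq (.setReal 1 entryExp
        (.sub (.mul (.add (.get 1 entryExp) (.var 10)) (.var 7)) (.var 10))) <|
      .seq (.ite (.ltReal (.get 1 entryExp) (.const 0)) (.setReal 1 entryExp (.const 0)) .skip)
        (.setNat 16 (.const 0) (.add (.var 16) (.const 1)))) s fun t s' =>
      t ≤ 80 * m + 20 ∧ s'.real 1 = fun c => if c ∈ (range m).image (blk q) then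
        max 0 ((v c + 1 / m) * f - 1 / m) else v c := by
  refine reach_loop m 70 (fun i s' => s'.nat 16 0 = i ∧ i ≤ m ∧
    ∀ c, s'.real 1 c = if c ∈ (range i).image (blk q) then
        max 0 ((v c + 1 / m) * f - 1 / m) else v c) ?_ ?_ ?_
  · exact ⟨h16, Nat.zero_le _, fun c => by simp [hv]⟩
  · rintro i s' ⟨hi, him, h1⟩ hf hb
    have Hs' := H.frame hf (by simp [Prog.KeepsStatic, Prog.KeepsNat, Prog.KeepsReal])
    have e20 : s'.nat 20 0 = q := by rw [hf.nat 20 (by simp [Prog.KeepsNat]), h20]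
    have e7 : s'.real 7 0 = f := by rw [hf.real 7 (by simp [Prog.KeepsReal]), h7]
    simp only [BExp.holds, NExp.eval, hi, Hs'.blockSize] at hb
    refine ⟨hb, ?_⟩
    -- By injectivity of the block, the entry about to be read still has its old value.
    have hnot : blk q i ∉ (range i).image (blk q) := by
      intro hmem
      obtain ⟨e, he, heq⟩ := mem_image.1 hmem
      have he' := mem_range.1 he
      have := hinj (by simpa using (by omega : e < m)) (by simpa using hb) heq
      omega
    have hvi : s'.real 1 (blk q i) = v (blk q i) := by rw [h1, if_neg hnot]
    have key : ∀ y, y = max 0 ((v (blk q i) + 1 / m) * f - 1 / m) → ∀ c,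
        Function.update (s'.real 1) (blk q i) y c = if c ∈ (range (i + 1)).image (blk q) then
          max 0 ((v c + 1 / m) * f - 1 / m) else v c := by
      rintro y rfl c
      simp only [range_add_one, image_insert, mem_insert]
      by_cases hc : c = blk q i
      · subst hc
        simp
      · rw [Function.update_of_ne hc, h1]
        simp [hc]
    simp +decide only [reach_seq, reach_setNat, reach_setReal, reach_ite, reach_skip, BExp.holds,
      BExp.cost, NExp.eval, NExp.cost, RExp.eval, RExp.cost, setEntry_self,
      Function.update_self, hi, e20, e7, Hs'.block, Hs'.offset, hvi, Function.update_idem]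
    refine ⟨fun h => ⟨trivial, trivial, hb, key _ ?_⟩, fun h => ⟨trivial, trivial, hb, key _ ?_⟩⟩
    · rw [max_eq_left (by simpa using h.le)]
      simp
    · rw [max_eq_right (by simpa using h)]
  · rintro i t s' ⟨hi, him, h1⟩ hf hb ht
    have Hs' := H.frame hf (by simp [Prog.KeepsStatic, Prog.KeepsNat, Prog.KeepsReal])
    simp only [BExp.holds, NExp.eval, hi, Hs'.blockSize, BExp.cost, NExp.cost] at hb ht
    obtain rfl : i = m := by omega
    exact ⟨by omega, funext h1⟩

theorem reach_updateProg (H : Static d k N m n blk η lam α s) (v : Weights)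
    (hinj : ∀ q < N, Set.InjOn (blk q) (range m)) {r : ℕ} (hr : r < 2 * N) (h22 : s.nat 22 0 = r)
    (hv : s.real 1 = v.1) (h4 : ∀ q < N, s.real 4 q = blockSum m blk v.1 q) :
    Reach db ω updateProg s fun t s' => t ≤ 80 * m + 80 ∧
      s'.real 1 = (mwStep N m blk η (1 / m) v r).1 := by
  have hq := candQuery_lt hr
  rw [updateProg, reach_seq, reach_ite]
  simp +decide only [reach_seq, reach_setNat, reach_setReal, reach_ite, BExp.holds,
      BExp.cost, NExp.eval, NExp.cost, RExp.eval, RExp.cost, setEntry_self,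
      Function.update_self, h22, H.queries, H.rate]
  have stat : ∀ a b : ℕ, ∀ f : ℝ, Static d k N m n blk η lam α { s with
      nat := setEntry (setEntry s.nat 20 0 a) 16 0 b, real := setEntry s.real 7 0 f } := by
    intro a b f
    constructor <;> simp +decide only [setEntry_ne, ne_eq]
    exacts [H.size, H.num, H.block, H.queries, H.blockSize, H.ones, H.acc, H.param, H.rate,
      H.offset]
  have key : ∀ (f : ℝ) (c : ℕ), c ≤ 40 → f = Real.exp (logFactor N m blk η v.1 r) →
      Reach db ω (.while (.ltNat (.var 16) (.var 18)) <|
        .seq (.setReal 1 entryExp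
          (.sub (.mul (.add (.get 1 entryExp) (.var 10)) (.var 7)) (.var 10))) <|
        .seq (.ite (.ltReal (.get 1 entryExp) (.const 0)) (.setReal 1 entryExp (.const 0)) .skip)
          (.setNat 16 (.const 0) (.add (.var 16) (.const 1)))) { s with
      nat := setEntry (setEntry s.nat 20 0 (candQuery N r)) 16 0 0,
      real := setEntry s.real 7 0 f } fun t s' => c + t ≤ 80 * m + 80 ∧
        s'.real 1 = (mwStep N m blk η (1 / m) v r).1 := by
    rintro f c hc rfl
    refine (reach_updateLoop (f := Real.exp (logFactor N m blk η v.1 r))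
      (q := candQuery N r) (v := v.1) (stat _ _ _) (hinj _ hq)
      ?_ ?_ ?_ ?_).mono ?_
    · simp +decide only [setEntry_self, setEntry_ne, ne_eq, Function.update_self]
    · simp +decide only [setEntry_self, Function.update_self]
    · simpa +decide only [setEntry_ne, ne_eq] using hv
    · simp +decide only [setEntry_self, Function.update_self]
    · rintro t s' ⟨ht, h1⟩
      exact ⟨by omega, h1⟩
  refine ⟨fun hrN => ⟨fun h1 => ?_, fun h1 => ?_⟩, fun hrN => ?_⟩
  · have hqr : candQuery N r = r := if_pos hrN
    rw [h4 r hrN] at h1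
    rw [hqr] at key
    refine (key _ 40 le_rfl ?_).mono fun t s' h => ⟨by omega, h.2⟩
    rw [logFactor, if_pos hrN, if_pos (by simpa using h1)]
    simp
  · have hqr : candQuery N r = r := if_pos hrN
    rw [h4 r hrN] at h1
    rw [hqr] at key
    refine (key _ 40 le_rfl ?_).mono fun t s' h => ⟨by omega, h.2⟩
    rw [logFactor, if_pos hrN, if_neg (by simpa using h1)]
  · have hqr : candQuery N r = r - N := if_neg hrN
    rw [hqr] at key
    refine (key _ 40 le_rfl ?_).mono fun t s' h => ⟨by omega, h.2⟩
    rw [logFactor, if_neg hrN]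
    simp

end

section

variable {db : ℕ → ℕ} {ω : Coins} {d k N m n : ℕ} {blk : ℕ → ℕ → ℕ} {η lam α : ℝ} {s : State}

theorem keepsStatic_scoresProg : scoresProg.KeepsStatic := by
  simp [Prog.KeepsStatic, scoresProg, sumProg, Prog.KeepsNat, Prog.KeepsReal]

theorem keepsStatic_pickProg : pickProg.KeepsStatic := by
  simp [Prog.KeepsStatic, pickProg, Prog.KeepsNat, Prog.KeepsReal]

/-- One round of multiplicative weights. -/
def roundProg : Prog :=
  .seq scoresProg <|
  .seq pickProg <|
  .seq updateProg <|
    .setNat 23 (.const 0) (.add (.var 23) (.const 1))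

theorem reach_roundProg (H : Static d k N m n blk η lam α s) (hN : 0 < N) (hm : 1 ≤ m)
    (hinj : ∀ q < N, Set.InjOn (blk q) (range m)) (v : Weights) (hv : s.real 1 = v.1) :
    Reach db ω roundProg s fun t s' => t ≤ 600 * (N * m) ∧
      s'.nat 23 0 = s.nat 23 0 + 1 ∧ s'.used = s.used + 1 ∧
      s'.real 1 = (mwStep N m blk η (1 / m) v
        (pick (expWeight lam (mwScore d N m blk db n) v) (2 * N) (ω s.used))).1 ∧
      ∀ q < N, s'.real 2 q = s.real 2 q + estimate m blk v.1 q := by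
  rw [roundProg, reach_seq]
  refine (reach_scoresProg H hm v hv).withFrame.mono ?_
  rintro t₁ s₁ ⟨⟨ht₁, h4, h2, h3, h5⟩, hf₁⟩
  have H₁ := H.frame hf₁ keepsStatic_scoresProg
  have hu₁ : s₁.used = s.used := hf₁.used (by simp [Prog.KeepsUsed, scoresProg, sumProg])
  have hv₁ : s₁.real 1 = v.1 := by
    rw [hf₁.real 1 (by simp [Prog.KeepsReal, scoresProg, sumProg]), hv]
  have ht₁' : s₁.nat 23 = s.nat 23 :=
    hf₁.nat 23 (by simp [Prog.KeepsNat, scoresProg, sumProg])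
  rw [reach_seq]
  refine (reach_pickProg (fun r => expWeight_pos lam _ v r) hN H₁.queries h3 h5).withFrame.mono ?_
  rintro t₂ s₂ ⟨⟨ht₂, h22, hu₂⟩, hf₂⟩
  have H₂ := H₁.frame hf₂ keepsStatic_pickProg
  have hv₂ : s₂.real 1 = v.1 := by rw [hf₂.real 1 (by simp [Prog.KeepsReal, pickProg]), hv₁]
  have h4₂ : s₂.real 4 = s₁.real 4 := hf₂.real 4 (by simp [Prog.KeepsReal, pickProg])
  have h2₂ : s₂.real 2 = s₁.real 2 := hf₂.real 2 (by simp [Prog.KeepsReal, pickProg])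
  have ht₂' : s₂.nat 23 = s₁.nat 23 := hf₂.nat 23 (by simp [Prog.KeepsNat, pickProg])
  rw [reach_seq]
  refine (reach_updateProg H₂ v hinj (pick_lt (by omega)) h22 hv₂
    (by rwa [h4₂])).withFrame.mono ?_
  rintro t₃ s₃ ⟨⟨ht₃, h1⟩, hf₃⟩
  have hu₃ : s₃.used = s₂.used := hf₃.used (by simp [Prog.KeepsUsed, updateProg])
  have h2₃ : s₃.real 2 = s₂.real 2 := hf₃.real 2 (by simp [Prog.KeepsReal, updateProg])
  have ht₃' : s₃.nat 23 = s₂.nat 23 := hf₃.nat 23 (by simp [Prog.KeepsNat, updateProg])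
  simp only [reach_setNat, NExp.eval, NExp.cost, setEntry_self, Function.update_self, ht₃', ht₂',
    ht₁', hu₃, hu₂, hu₁, h2₃, h2₂]
  rw [hu₁] at h1
  refine ⟨?_, trivial, trivial, h1, h2⟩
  have h6 : N ≤ N * m := Nat.le_mul_of_pos_right _ hm
  have h7 : m ≤ N * m := Nat.le_mul_of_pos_left _ hN
  omega

/-- All rounds of multiplicative weights. -/
def mainLoop : Prog :=
  .while (.ltReal (.mul (.ofNat (.var 23)) (.mul (.get 0 (.const 2)) (.get 0 (.const 2))))
    (.mul (.const 64) (.ofNat (.var 2)))) roundProg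

theorem keepsStatic_mainLoop : mainLoop.KeepsStatic := by
  simp [Prog.KeepsStatic, mainLoop, roundProg, scoresProg, sumProg, pickProg, updateProg,
    Prog.KeepsNat, Prog.KeepsReal]

/-- Real numbers cannot be converted to natural numbers on the machine, so the loop guard compares
`t α²` with `64 k` instead of computing the ceiling. -/
theorem lt_rounds_iff (hα : 0 < α) (t : ℕ) : (t : ℝ) * (α * α) < 64 * k ↔ t < rounds k α := by
  rw [rounds, Nat.lt_ceil, lt_div_iff₀ (by positivity), sq]

theorem reach_mainLoop (H : Static d k N m n blk η lam α s) (hN : 0 < N) (hm : 1 ≤ m)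
    (hα : 0 < α) (hinj : ∀ q < N, Set.InjOn (blk q) (range m)) (h1 : s.real 1 = fun _ => 0)
    (h2 : s.real 2 = fun _ => 0) (ht : s.nat 23 0 = 0) (hu : s.used = 0) :
    Reach db ω mainLoop s fun t s' => t ≤ rounds k α * (700 * (N * m)) + 20 ∧
      s'.nat 23 0 = rounds k α ∧
      ∀ q < N, s'.real 2 q = sumEstimates N m blk η (1 / m)
        (randomChoice (mwStep N m blk η (1 / m)) (expWeight lam (mwScore d N m blk db n)) (2 * N)
          zeroWeights ω) (rounds k α) q := by
  -- Round `i` consumes sample number `i`; the clause on `used` matches the machine with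
  -- `randomPath`.
  refine reach_loop (rounds k α) (600 * (N * m)) (fun i s' => s'.nat 23 0 = i ∧
    i ≤ rounds k α ∧ s'.used = i ∧
    s'.real 1 = (randomPath (mwStep N m blk η (1 / m)) (expWeight lam (mwScore d N m blk db n))
      (2 * N) zeroWeights ω i).1 ∧
    ∀ q < N, s'.real 2 q = sumEstimates N m blk η (1 / m)
        (randomChoice (mwStep N m blk η (1 / m)) (expWeight lam (mwScore d N m blk db n)) (2 * N)
          zeroWeights ω) i q) ?_ ?_ ?_
  · exact ⟨ht, Nat.zero_le _, hu, h1, fun q _ => by simp [h2, sumEstimates]⟩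
  · rintro i s' ⟨hi, hiT, hu', h1', h2'⟩ hf hb
    have Hs' := H.frame hf keepsStatic_mainLoop
    simp only [BExp.holds, RExp.eval, NExp.eval, hi, Hs'.acc, Hs'.num, Nat.cast_ofNat] at hb
    rw [lt_rounds_iff hα] at hb
    refine ⟨hb, (reach_roundProg Hs' hN hm hinj _ h1').mono ?_⟩
    rintro t s'' ⟨ht'', h23, hu'', h1'', h2''⟩
    rw [hu'] at h1'' hu''
    refine ⟨ht'', by rw [h23, hi], hb, hu'', h1'', fun q hq => ?_⟩
    rw [h2'' q hq, h2' q hq, sumEstimates, sumEstimates, sum_range_succ, randomPath_eq_path]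
  · rintro i t s' ⟨hi, hiT, hu', h1', h2'⟩ hf hb ht'
    have Hs' := H.frame hf keepsStatic_mainLoop
    simp only [BExp.holds, RExp.eval, NExp.eval, hi, Hs'.acc, Hs'.num, Nat.cast_ofNat, BExp.cost,
      RExp.cost, NExp.cost] at hb ht'
    rw [lt_rounds_iff hα] at hb
    obtain rfl : i = rounds k α := by omega
    refine ⟨?_, hi, h2'⟩
    have h6 : 0 < N * m := Nat.mul_pos hN hm
    calc t ≤ _ := ht'
      _ ≤ rounds k α * (700 * (N * m)) + 20 := by
        refine Nat.add_le_add (Nat.mul_le_mul_left _ ?_) ?_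
        · omega
        · omega

/-- The output of the averages. -/
def outputProg : Prog :=
  .seq (.setNat 20 (.const 0) (.const 0)) <|
  .while (.ltNat (.var 20) (.var 13)) <|
    .seq (.output (.sub (.var 19) (.get 11 (.add (.get 12 (.var 20)) (.sub (.var 18) (.const 1)))))
      (.div (.get 2 (.var 20)) (.ofNat (.var 23))))
      (.setNat 20 (.const 0) (.add (.var 20) (.const 1)))

theorem reach_outputProg (H : Static d k N m n blk η lam α s) {T : ℕ} {τ : ℕ → ℕ} {w₀ : ℝ}
    (hT : s.nat 23 0 = T) (h2 : ∀ q < N, s.real 2 q = sumEstimates N m blk η w₀ τ T q)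
    (ho : s.out = fun _ => 0) :
    Reach db ω outputProg s fun t s' => t ≤ 60 * N + 20 ∧
      s'.out = releaseOf d N m blk η w₀ T τ := by
  simp only [outputProg, reach_seq, reach_setNat, NExp.eval, NExp.cost]
  refine reach_loop N 50 (fun i s' => s'.nat 20 0 = i ∧ i ≤ N ∧
    s'.out = writeArray (fun q => 2 ^ d - 1 - blk q (m - 1))
      (fun q => sumEstimates N m blk η w₀ τ T q / T) i) ?_ ?_ ?_
  · simp only [setEntry_self, Function.update_self, ho, writeArray]
    exact ⟨trivial, Nat.zero_le _, trivial⟩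
  · rintro i s' ⟨hi, hiN, hout⟩ hf hb
    have Hs' : Static d k N m n blk η lam α s' := by
      refine Static.frame (s := { s with nat := setEntry s.nat 20 0 0 }) ?_ hf ?_
      · constructor <;> simp +decide only [setEntry_ne, ne_eq]
        exacts [H.size, H.num, H.block, H.queries, H.blockSize, H.ones, H.acc, H.param, H.rate,
          H.offset]
      · simp [Prog.KeepsStatic, Prog.KeepsNat, Prog.KeepsReal]
    have e23 : s'.nat 23 0 = T := by
      rw [hf.nat 23 (by simp [Prog.KeepsNat])]
      simpa +decide only [setEntry_ne, ne_eq] using hT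
    have e2 : s'.real 2 = s.real 2 := hf.real 2 (by simp [Prog.KeepsReal])
    simp only [BExp.holds, NExp.eval, hi, Hs'.queries] at hb
    refine ⟨hb, ?_⟩
    simp only [reach_seq, reach_output, reach_setNat, NExp.eval, NExp.cost, RExp.eval, RExp.cost,
      setEntry_self, Function.update_self, hi, Hs'.ones, Hs'.blockSize, Hs'.block, e23, e2,
      h2 i hb, hout]
    exact ⟨by omega, trivial, hb, rfl⟩
  · rintro i t s' ⟨hi, hiN, hout⟩ hf hb ht
    have e13 : s'.nat 13 0 = N := by
      rw [hf.nat 13 (by simp [Prog.KeepsNat])]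
      simp +decide only [setEntry_ne, ne_eq, H.queries]
    simp only [BExp.holds, NExp.eval, hi, e13, BExp.cost, NExp.cost] at hb ht
    obtain rfl : i = N := by omega
    exact ⟨by omega, hout⟩

end

/-! ### The complete program and its runs. -/

/-- The computation of the parameters of the main loop. -/
def paramProg : Prog :=
  .seq (.setReal 8 (.const 0) (.div (.mul (.get 0 (.const 0)) (.get 0 (.const 2)))
    (.mul (.mul (.const 25) (.exp (.div (.log (.ofNat (.var 2))) (.const 2))))
      (.log (.div (.const 4) (.get 0 (.const 1))))))) <|
  .seq (.setReal 9 (.const 0) (.div (.get 0 (.const 2)) (.const 8)))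
    (.setReal 10 (.const 0) (.div (.const 1) (.ofNat (.var 18))))

/-- The whole program. -/
def releaseProg : Prog :=
  .ite (.ltNat (.get 0 (.const 0)) (.const 2)) (.output (.const 0) (.const 1)) <|
    .seq (.setNat 1 (.const 0) (.get 0 (.const 0))) <|
    .seq (.setNat 2 (.const 0) (.get 0 (.const 1))) <|
    .seq layoutProg <|
    .seq paramProg <|
    .seq mainLoop outputProg

/-- The state from which the layout is constructed. -/
def layoutStart (d k n : ℕ) (ε δ α β : ℝ) : State :=
  { initialState d k n ε δ α β with
    nat := setEntry (setEntry (initialState d k n ε δ α β).nat 1 0 d) 2 0 k }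

theorem readsOnly_layoutProg : layoutProg.ReadsOnly (1 ≤ ·) := by
  simp [layoutProg, powersProg, nodesProg, blocksProg, blockProg, Prog.ReadsOnly, NExp.ReadsOnly,
    BExp.ReadsOnly]

/-- Copying `d` and `k` to the arrays `1` and `2` frees the layout code from array `0`, which also
holds the size of the database. -/
theorem agree_layoutStart (d k n n' : ℕ) (ε δ α β ε' δ' α' β' : ℝ) :
    Agree (1 ≤ ·) (layoutStart d k n ε δ α β) (layoutStart d k n' ε' δ' α' β') := by
  intro a ha
  have h0 : a ≠ 0 := by omega
  have h : ∀ (n : ℕ) (ε δ α β : ℝ), (initialState d k n ε δ α β).nat a = fun _ => 0 := by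
    intros
    simp only [initialState]
    rw [setEntry_ne _ _ _ h0, setEntry_ne _ _ _ h0, setEntry_ne _ _ _ h0]
  have h1 : ∀ (n : ℕ) (ε δ α β : ℝ), (initialState d k n ε δ α β).nat 1 = fun _ => 0 := by
    intros
    simp only [initialState]
    rw [setEntry_ne _ _ _ one_ne_zero, setEntry_ne _ _ _ one_ne_zero,
      setEntry_ne _ _ _ one_ne_zero]
  have h2 : ∀ (n : ℕ) (ε δ α β : ℝ), (initialState d k n ε δ α β).nat 2 = fun _ => 0 := by
    intros
    simp only [initialState]
    rw [setEntry_ne _ _ _ two_ne_zero, setEntry_ne _ _ _ two_ne_zero,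
      setEntry_ne _ _ _ two_ne_zero]
  simp only [layoutStart, setEntry, Function.update_apply, h]
  split_ifs <;> simp [h1, h2]

/-- The layout depends on the dimensions only. -/
theorem exists_layout {d k : ℕ} (hk : 1 ≤ k) (hkd : k ≤ d) :
    ∃ (N : ℕ) (A : ℕ → Finset ℕ) (blk : ℕ → ℕ → ℕ), IsLayout d k N A blk ∧
      ∀ (db : ℕ → ℕ) (ω : Coins) (n : ℕ) (ε δ α β : ℝ),
        Reach db ω layoutProg (layoutStart d k n ε δ α β) fun t s' =>
          t ≤ 800 * (d.choose k * 2 ^ k) ∧ s'.nat 13 0 = N ∧ s'.nat 18 0 = 2 ^ k ∧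
          s'.nat 19 0 = 2 ^ d - 1 ∧ ∀ q e, s'.nat 11 (s'.nat 12 q + e) = blk q e := by
  have hstart : ∀ (n : ℕ) (ε δ α β : ℝ), (layoutStart d k n ε δ α β).nat 1 0 = d ∧
      (layoutStart d k n ε δ α β).nat 2 0 = k := by
    intro n ε δ α β
    constructor <;> simp [layoutStart, setEntry_apply]
  -- A reference run on an empty database vector and zero coins defines the layout; `Exec.agree`
  -- transfers it to every other run.
  obtain ⟨t, s, hs, ht, h18, h19, A, L⟩ := reach_layoutProg (db := fun _ => 0) (ω := fun _ => 0)
    hk hkd (hstart 0 0 0 0 0).1 (hstart 0 0 0 0 0).2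
  refine ⟨_, A, _, L, fun db ω n ε δ α β => ?_⟩
  obtain ⟨s', hs', ha⟩ := hs.agree (db' := db) (ω' := ω) readsOnly_layoutProg
    (layoutStart d k n ε δ α β) (agree_layoutStart _ _ _ _ _ _ _ _ _ _ _ _)
  refine ⟨t, s', hs', ht, ?_, ?_, ?_, fun q e => ?_⟩
  · rw [← ha 13 (by norm_num)]
  · rw [← ha 18 (by norm_num), h18]
  · rw [← ha 19 (by norm_num), h19]
  · rw [← ha 11 (by norm_num), ← ha 12 (by norm_num)]

theorem reach_releaseProg {d k N : ℕ} {A : ℕ → Finset ℕ} {blk : ℕ → ℕ → ℕ} {ε δ α β : ℝ}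
    (hk : 1 ≤ k) (hkd : k ≤ d) (hd : 2 ≤ d) (hα : 0 < α) (L : IsLayout d k N A blk)
    (hL : ∀ (db : ℕ → ℕ) (ω : Coins) (n : ℕ) (ε δ α β : ℝ),
        Reach db ω layoutProg (layoutStart d k n ε δ α β) fun t s' =>
          t ≤ 800 * (d.choose k * 2 ^ k) ∧ s'.nat 13 0 = N ∧ s'.nat 18 0 = 2 ^ k ∧
          s'.nat 19 0 = 2 ^ d - 1 ∧ ∀ q e, s'.nat 11 (s'.nat 12 q + e) = blk q e)
    (D : Multiset (Fin d → Bool)) (ω : Coins) :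
    Reach (histogram D) ω releaseProg (initialState d k (Multiset.card D) ε δ α β) fun t s' =>
      t ≤ 2000 * (rounds k α * (d.choose k * 2 ^ k)) ∧
      s'.out = mechanism d N (2 ^ k) blk (α / 8) (expParam k ε δ α) (rounds k α) D ω := by
  set n := Multiset.card D with hn
  have hN : N = d.choose k := L.card_eq
  have hN0 : 0 < N := hN ▸ Nat.choose_pos hkd
  have i0 : (initialState d k n ε δ α β).nat 0 0 = d := by simp [initialState, setEntry_apply]
  have i1 : (initialState d k n ε δ α β).nat 0 1 = k := by simp [initialState, setEntry_apply]
  rw [releaseProg, reach_ite]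
  simp only [BExp.holds, NExp.eval, i0]
  refine ⟨fun h => by omega, fun _ => ?_⟩
  simp +decide only [reach_seq, reach_setNat, NExp.eval, NExp.cost, BExp.cost, i0, i1,
    setEntry_ne, ne_eq]
  refine (hL (histogram D) ω n ε δ α β).withFrame.mono ?_
  rintro t₁ s₁ ⟨⟨ht₁, h13, h18, h19, hblk⟩, hf₁⟩
  have a0 : s₁.nat 0 2 = n := by
    rw [hf₁.nat 0 (by simp [Prog.KeepsNat, layoutProg, powersProg, nodesProg, blocksProg,
      blockProg])]
    simp [layoutStart, initialState, setEntry_apply]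
  have a2 : s₁.nat 2 0 = k := by
    rw [hf₁.nat 2 (by simp [Prog.KeepsNat, layoutProg, powersProg, nodesProg, blocksProg,
      blockProg])]
    simp [layoutStart, initialState, setEntry_apply]
  have a23 : s₁.nat 23 0 = 0 := by
    rw [hf₁.nat 23 (by simp [Prog.KeepsNat, layoutProg, powersProg, nodesProg, blocksProg,
      blockProg])]
    simp [layoutStart, initialState, setEntry_apply]
  have ar : ∀ a, s₁.real a = (initialState d k n ε δ α β).real a := fun a =>
    hf₁.real a (by simp [Prog.KeepsReal, layoutProg, powersProg, nodesProg, blocksProg, blockProg])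
  have ao : s₁.out = fun _ => 0 :=
    hf₁.out (by simp [Prog.KeepsOut, layoutProg, powersProg, nodesProg, blocksProg, blockProg])
  have au : s₁.used = 0 :=
    hf₁.used (by simp [Prog.KeepsUsed, layoutProg, powersProg, nodesProg, blocksProg, blockProg])
  have r0 : s₁.real 0 0 = ε := by simp [ar, initialState, setEntry_apply]
  have r1 : s₁.real 0 1 = δ := by simp [ar, initialState, setEntry_apply]
  have r2 : s₁.real 0 2 = α := by simp [ar, initialState, setEntry_apply]
  have rv : s₁.real 1 = fun _ => 0 := by
    rw [ar]
    funext c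
    simp [initialState, setEntry_apply]
  have ra : s₁.real 2 = fun _ => 0 := by
    rw [ar]
    funext c
    simp [initialState, setEntry_apply]
  simp +decide only [paramProg, reach_seq, reach_setReal, RExp.eval, RExp.cost, NExp.eval,
    NExp.cost, setEntry_ne, ne_eq, r0, r1, r2, a2, h18, Nat.cast_ofNat]
  set s₂ : State := { s₁ with
    real := setEntry (setEntry (setEntry s₁.real 8 0 (ε * α /
      (25 * Real.exp (Real.log k / 2) * Real.log (4 / δ)))) 9 0 (α / 8)) 10 0
        (((1 : ℕ) : ℝ) / ((2 ^ k : ℕ) : ℝ)) } with hs₂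
  have H : Static d k N (2 ^ k) n blk (α / 8) (expParam k ε δ α) α s₂ := by
    constructor
    · exact a0
    · exact a2
    · exact hblk
    · exact h13
    · exact h18
    · exact h19
    · simp +decide only [hs₂, setEntry_ne, ne_eq, r2]
    · simp +decide only [hs₂, setEntry_self, setEntry_ne, ne_eq, Function.update_self, expParam]
    · simp +decide only [hs₂, setEntry_self, setEntry_ne, ne_eq, Function.update_self]
    · simp +decide only [hs₂, setEntry_self, Function.update_self, Nat.cast_one]
  refine (reach_mainLoop H hN0 Nat.one_le_two_pow hα (fun q hq => L.injOn hq) ?_ ?_ a23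
    au).withFrame.mono ?_
  · simpa +decide only [hs₂, setEntry_ne, ne_eq] using rv
  · simpa +decide only [hs₂, setEntry_ne, ne_eq] using ra
  rintro t₃ s₃ ⟨⟨ht₃, h23, h2⟩, hf₃⟩
  have ho₃ : s₃.out = fun _ => 0 := by
    rw [hf₃.out (by simp [Prog.KeepsOut, mainLoop, roundProg, scoresProg, sumProg, pickProg,
      updateProg])]
    exact ao
  refine (reach_outputProg (H.frame hf₃ keepsStatic_mainLoop) h23 h2 ho₃).mono ?_
  rintro t₄ s₄ ⟨ht₄, hout⟩
  refine ⟨?_, hout⟩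
  have hT := rounds_pos (α := α) hk hα
  have h2k : 1 ≤ 2 ^ k := Nat.one_le_two_pow
  rw [← hN] at ht₁ ⊢
  have h6 : N ≤ N * 2 ^ k := Nat.le_mul_of_pos_right _ h2k
  have h7 : N * 2 ^ k ≤ rounds k α * (N * 2 ^ k) := Nat.le_mul_of_pos_left _ hT
  have h8 : rounds k α * (700 * (N * 2 ^ k)) = 700 * (rounds k α * (N * 2 ^ k)) := by ring
  omega

/-! ### Running time, and the case of one variable. -/

theorem softO_mono {K x y : ℝ} {c : ℕ} (hK : 0 ≤ K) (hx : 0 ≤ x) (hxy : x ≤ y) :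
    softO K c x ≤ softO K c y := by
  unfold softO
  have h : Real.log (x + 2) ≤ Real.log (y + 2) := Real.log_le_log (by linarith) (by linarith)
  have h0 : 0 ≤ Real.log (x + 2) := Real.log_nonneg (by linarith)
  have hKy : 0 ≤ K * y := mul_nonneg hK (hx.trans hxy)
  gcongr

theorem card_conj {d k : ℕ} (hkd : k ≤ d) : Fintype.card (Conj d (d - k)) = d.choose k := by
  rw [Fintype.card_finset_len, Fintype.card_fin, Nat.choose_symm hkd]

/-- The factor `k` of the number of rounds is at most `log (X + 2) / log 2` because `2^k ≤ X`; so
one logarithm suffices, and `2000 · 65 ≤ 200000 log 2` gives the constant. -/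
theorem le_softO {d k t : ℕ} {α : ℝ} (hk : 1 ≤ k) (hkd : k ≤ d) (hα : 0 < α) (hα1 : α ≤ 1)
    (ht : t ≤ 2000 * (rounds k α * (d.choose k * 2 ^ k))) :
    (t : ℝ) ≤ softO 200000 1 ((Fintype.card (Conj d (d - k)) : ℝ) * 2 ^ k / α ^ 2) := by
  rw [card_conj hkd, softO, pow_one]
  have hN : (1 : ℝ) ≤ d.choose k := by exact_mod_cast Nat.choose_pos hkd
  have hk' : (1 : ℝ) ≤ k := by exact_mod_cast hk
  set X : ℝ := (d.choose k : ℝ) * 2 ^ k / α ^ 2 with hX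
  have hX0 : 0 ≤ X := by positivity
  have h2k : (2 : ℝ) ^ k ≤ X := by
    rw [hX, le_div_iff₀ (by positivity)]
    have h1 : α ^ 2 ≤ 1 := pow_le_one₀ hα.le hα1
    have h2 : (0 : ℝ) < 2 ^ k := by positivity
    nlinarith
  have hlog : k * Real.log 2 ≤ Real.log (X + 2) := by
    rw [← Real.log_pow]
    exact Real.log_le_log (by positivity) (by linarith)
  have hklog : 130000 * (k : ℝ) ≤ 200000 * Real.log (X + 2) := by
    nlinarith [Real.log_two_gt_d9]
  calc (t : ℝ) ≤ 2000 * (rounds k α * (d.choose k * 2 ^ k)) := by exact_mod_cast ht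
    _ ≤ 2000 * (65 * k / α ^ 2 * (d.choose k * 2 ^ k)) := by
      gcongr
      exact rounds_le hk hα hα1
    _ = 130000 * k * X := by
      rw [hX]
      ring
    _ ≤ 200000 * Real.log (X + 2) * X := mul_le_mul_of_nonneg_right hklog hX0
    _ = 200000 * X * Real.log (X + 2) := by ring

theorem card_conj_mul_le {d k : ℕ} {α : ℝ} (hkd : k ≤ d) :
    (Fintype.card (Conj d (d - k)) : ℝ) * 2 ^ k / α ^ 2 ≤ (2 * (d : ℝ)) ^ k / α ^ 2 := by
  rw [card_conj hkd, mul_pow, mul_comm (2 ^ k : ℝ)]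
  gcongr
  exact_mod_cast Nat.choose_le_pow d k

/-- For one variable and `k = 1` the only query is the constant one. -/
theorem one_variable {ε δ α β : ℝ} (hε : 0 < ε) (hδ : 0 < δ) (hδ1 : δ < 1) (hα : 0 < α)
    (hβ : 0 < β) (hβ1 : β < 1) :
    (∀ (D : Multiset (Fin 1 → Bool)) (ω : Coins), Reach (histogram D) ω releaseProg
      (initialState 1 1 (Multiset.card D) ε δ α β) fun t s' =>
        t ≤ 2000 * (rounds 1 α * ((1 : ℕ).choose 1 * 2 ^ 1)) ∧
        s'.out = Function.update (fun _ => 0) 0 1) ∧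
      IsDifferentiallyPrivate coinMeasure ε δ
        (fun (_ : Multiset (Fin 1 → Bool)) (_ : Coins) =>
          Function.update (fun _ : ℕ => (0 : ℝ)) 0 1) ∧
      ∀ n : ℕ, 100 * (((1 : ℕ) : ℝ) ^ (1.5 : ℝ) * Real.log (4 / δ) *
          Real.log (((1 : ℕ) : ℝ) / β) / (ε * α ^ 2)) ≤ (n : ℝ) →
        IsAccurate coinMeasure α β (fun S : Conj 1 (1 - 1) => conjunction S.1)
          (fun S r => r (setCode S.1)) (fun (_ : Multiset (Fin 1 → Bool)) (_ : Coins) =>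
            Function.update (fun _ : ℕ => (0 : ℝ)) 0 1) n := by
  refine ⟨fun D ω => ?_, fun D D' _ S _ => ?_, fun n hn D hD => ?_⟩
  · have i0 : (initialState 1 1 (Multiset.card D) ε δ α β).nat 0 0 = 1 := by
      simp [initialState, setEntry_apply]
    rw [releaseProg, reach_ite]
    simp only [BExp.holds, NExp.eval, i0]
    refine ⟨fun _ => ?_, fun h => by omega⟩
    simp only [reach_output, NExp.eval, NExp.cost, BExp.cost, RExp.eval, RExp.cost, Nat.cast_one]
    refine ⟨?_, rfl⟩
    have := rounds_pos (k := 1) (α := α) le_rfl hα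
    simp only [Nat.choose_self]
    omega
  · have h1 : (1 : ENNReal) ≤ ENNReal.ofReal (Real.exp ε) := by
      rw [ENNReal.one_le_ofReal]
      exact Real.one_le_exp hε.le
    exact le_add_right (le_mul_of_one_le_left zero_le h1)
  · have hL := one_le_log_four_div hδ hδ1
    -- As `β < 1`, the size bound is strictly positive, so `D` is nonempty and the constant query
    -- has value 1 instead of `0 / 0 = 0`.
    have hlog : 0 < Real.log (((1 : ℕ) : ℝ) / β) := by
      rw [Nat.cast_one]
      exact Real.log_pos ((one_lt_div hβ).2 hβ1)
    have hn0 : (0 : ℝ) < n := lt_of_lt_of_le (by positivity) hn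
    have huniv : {ω : Coins | ∀ S : Conj 1 (1 - 1), |queryValue (conjunction S.1) D
        - Function.update (fun _ : ℕ => (0 : ℝ)) 0 1 (setCode S.1)| ≤ α} = Set.univ := by
      refine Set.eq_univ_of_forall fun ω S => ?_
      have hS : S.1 = ∅ := card_eq_zero.1 S.2
      rw [hS]
      have hq : queryValue (conjunction (∅ : Finset (Fin 1))) D = 1 := by
        have : conjunction (∅ : Finset (Fin 1)) = fun _ => 1 := by
          funext x
          simp [conjunction]
        rw [queryValue, this, hD]
        simp only [Multiset.map_const', Multiset.sum_replicate, hD, nsmul_eq_mul, mul_one]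
        exact div_self hn0.ne'
      rw [hq]
      simp [setCode, hα.le]
    have hprob : coinMeasure (Set.univ : Set Coins) = 1 := by
      unfold coinMeasure
      exact measure_univ
    change _ ≤ coinMeasure {ω : Coins | ∀ S : Conj 1 (1 - 1), |queryValue (conjunction S.1) D
        - Function.update (fun _ : ℕ => (0 : ℝ)) 0 1 (setCode S.1)| ≤ α}
    rw [huniv, hprob, ENNReal.ofReal_le_one]
    linarith

end SparseRelease

end

theorem mainTheorem5 :
    ∃ (prog : SparseRelease.Prog) (K₁ K₂ : ℝ) (c : ℕ),
      ∀ (d k : ℕ), 1 ≤ k → k ≤ d →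
      ∀ (ε δ α β : ℝ), 0 < ε → ε < 1 → 0 < δ → δ < 1 → 0 < α → α ≤ 1 → 0 < β → β < 1 →
      ∃ M : Multiset (Fin d → Bool) → SparseRelease.Coins → (ℕ → ℝ),
        (∀ D, Measurable (M D)) ∧
        -- `M` is computed by `prog` within the claimed time
        (∀ D ω, ∃ (t : ℕ) (s : SparseRelease.State),
          SparseRelease.Exec (SparseRelease.histogram D) ω prog
            (SparseRelease.initialState d k (Multiset.card D) ε δ α β) t s ∧
          s.out = M D ω ∧
          (t : ℝ) ≤ SparseRelease.softO K₁ c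
            ((Fintype.card (SparseRelease.Conj d (d - k)) : ℝ) * 2 ^ k / α ^ 2) ∧
          (t : ℝ) ≤ SparseRelease.softO K₁ c ((2 * (d : ℝ)) ^ k / α ^ 2)) ∧
        SparseRelease.IsDifferentiallyPrivate SparseRelease.coinMeasure ε δ M ∧
        ∀ n : ℕ,
          K₂ * ((k : ℝ) ^ (1.5 : ℝ) * Real.log (4 / δ) * Real.log ((d : ℝ) / β)
            / (ε * α ^ 2)) ≤ (n : ℝ) →
          SparseRelease.IsAccurate SparseRelease.coinMeasure α β
            (fun S : SparseRelease.Conj d (d - k) => SparseRelease.conjunction S.1)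
            (fun S r => r (SparseRelease.setCode S.1)) M n := by
  open SparseRelease in
  refine ⟨releaseProg, 200000, 100, 1, fun d k hk hkd ε δ α β hε hε1 hδ hδ1 hα hα1 hβ hβ1 => ?_⟩
  have time : ∀ t : ℕ, t ≤ 2000 * (rounds k α * (d.choose k * 2 ^ k)) →
      (t : ℝ) ≤ softO 200000 1 ((Fintype.card (Conj d (d - k)) : ℝ) * 2 ^ k / α ^ 2) ∧
        (t : ℝ) ≤ softO 200000 1 ((2 * (d : ℝ)) ^ k / α ^ 2) := fun t ht =>
    have h := le_softO hk hkd hα hα1 ht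
    ⟨h, h.trans (softO_mono (by norm_num) (by positivity) (card_conj_mul_le hkd))⟩
  -- For `d = 1` the term `log d` vanishes and cannot absorb the `log 2` from the two signs, so this
  -- case is treated separately.
  rcases lt_or_ge d 2 with hd | hd
  · obtain rfl : d = 1 := by omega
    obtain rfl : k = 1 := by omega
    obtain ⟨hrun, hpriv, hacc⟩ := one_variable hε hδ hδ1 hα hβ hβ1
    refine ⟨_, fun _ => measurable_const, fun D ω => ?_, hpriv, hacc⟩
    obtain ⟨t, s, he, ht, ho⟩ := hrun D ω
    exact ⟨t, s, he, ho, time t ht⟩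
  · obtain ⟨N, A, blk, L, hL⟩ := exists_layout hk hkd
    have hN : N = d.choose k := L.card_eq
    have hN0 : 0 < N := hN ▸ Nat.choose_pos hkd
    have hlam := expParam_pos (k := k) hε hδ hδ1 hα
    have hlog := one_le_log_four_div hδ hδ1
    refine ⟨mechanism d N (2 ^ k) blk (α / 8) (expParam k ε δ α) (rounds k α),
      fun D => measurable_mechanism (by omega) D, fun D ω => ?_, ?_, fun n hn D hD => ?_⟩
    · obtain ⟨t, s, he, ht, ho⟩ := reach_releaseProg (ε := ε) (δ := δ) (β := β) hk hkd hd hα L hL D ω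
      exact ⟨t, s, he, ho, time t ht⟩
    · exact L.isDifferentiallyPrivate hN0 hlam.le
        (expParam_le_one hk hε hε1 hδ hδ1 hα hα1) (by positivity)
        (two_log_div_mul_expParam_le hk hε hδ hδ1 hα1) (exp_privacy_le hk hε hε1 hδ hδ1 hα hα1)
    · have hd' : (2 : ℝ) ≤ d := by exact_mod_cast hd
      have hlogd : 0 < Real.log ((d : ℝ) / β) := Real.log_pos ((one_lt_div hβ).2 (by linarith))
      have hk0 : (0 : ℝ) < k := by exact_mod_cast hk
      have hn0 : (0 : ℝ) < n := lt_of_lt_of_le (by positivity) hn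
      refine L.accurate hN0 hk hkd hlam hα hα1 hβ (le_rounds_mul hα)
        (by rw [hD]; exact_mod_cast hn0) ?_
      rw [hN, hD]
      exact accuracy_size_le hk hd hε hδ hδ1 hα hβ hβ1 hn
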